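/- Let $\mathbb H=\{z\in\mathbb C\mid \mathrm{Im}\,z>0\}$, $\omega=\frac{-1+\sqrt3\,i}{2}$, let $B$ be the beta function and let $F(a,b,c;z)=\sum_{n\ge 0}\frac{(a)_n(b)_n}{(c)_n\,n!}z^n$ be the hypergeometric series. On $\{|z|<1\}\cap\{|1-z|<1\}$ put $$\varphi_1(z)=\omega^2+i\,\frac{B(\frac16,\frac12)}{\pi}\cdot\frac{F(\frac16,\frac12,\frac23;1-z)}{F(\frac16,\frac12,1;z)},\qquad \varphi_2(z)=i\,\frac{B(\frac1{12},\frac5{12})}{2\pi}\cdot\frac{F(\frac1{12},\frac5{12},\frac12;1-z)}{F(\frac1{12},\frac5{12},1;z)}-i .$$ Both functions continue analytically (without poles) to $\mathbb C$ minus the two closed vertical rays going down from $0$ and from $1$, a simply connected domain containing $\mathbb H$ and the real intervals $(-\infty,0)$, $(0,1)$, $(1,\infty)$. Denote the continuations again by $\varphi_1,\varphi_2$; on the intervals they are thus continued through the upper half-plane. Let $$\mathbb D=\{\tau\in\mathbb H\mid -\tfrac12<\mathrm{Re}\,\tau\le\tfrac12,\ |\tau|>1\}\cup\{\tau\in\mathbb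 H\mid |\tau|=1,\ 0\le\mathrm{Re}\,\tau\le\tfrac12\},$$ the fundamental domain for $\mathrm{PSL}_2(\mathbb Z)$. (1) The Schwarz triangle of $\varphi_1$ is $$\varphi_1(\mathbb H)=\{\tau\in\mathbb H\mid -\tfrac12<\mathrm{Re}\,\tau<\tfrac12,\ |\tau|>1\},$$ which is the interior of $\mathbb D$. Its vertices $\varphi_1(z_0)=\lim_{z\to z_0,\,z\in\mathbb H}\varphi_1(z)$ $(z_0=0,1,\infty)$ are $$\varphi_1(0)=i\infty,\qquad \varphi_1(1)=\omega,\qquad \varphi_1(\infty)=-\omega^2,$$ where the first equality means that $\mathrm{Im}\,\varphi_1(z)\to+\infty$. The images of the intervals $(0,1)$, $(-\infty,0)$, $(1,\infty)$ under $\varphi_1$ are, respectively, $$\{\mathrm{Re}\,\tau=-\tfrac12,\ \mathrm{Im}\,\tau>\tfrac{\sqrt3}2\},\qquad \{\mathrm{Re}\,\tau=\tfrac12,\ \mathrm{Im}\,\tau>\tfrac{\sqrt3}2\},\qquad \{\tau\in\mathbb H\mid |\tau|=1,\ |\mathrm{Re}\,\tau|<\tfrac12\}.$$ (2) The Schwarz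 triangle of $\varphi_2$ is $$\varphi_2(\mathbb H)=\{\tau\in\mathbb H\mid 0<\mathrm{Re}\,\tau<\tfrac12,\ |\tau|>1\},$$ which is the interior of the right half $\{\tau\in\mathbb D\mid \mathrm{Re}\,\tau\ge 0\}$ of $\mathbb D$. Its vertices $\varphi_2(z_0)=\lim_{z\to z_0,\,z\in\mathbb H}\varphi_2(z)$ are $$\varphi_2(0)=i\infty,\qquad \varphi_2(1)=i,\qquad \varphi_2(\infty)=-\omega^2,$$ where the first equality means that $\mathrm{Im}\,\varphi_2(z)\to+\infty$. -/

import Mathlib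

open Complex Set Filter Topology

/-- The primitive cube root of unity `ω = (-1 + √3 i) / 2`. -/
noncomputable def omega : ℂ := (-1 + (Real.sqrt 3 : ℂ) * I) / 2

/-- The open upper half-plane, as a subset of `ℂ`. -/
def upperHalf : Set ℂ := {z | 0 < z.im}

/-- The intersection of the open unit disks centred at `0` and at `1`, on which both hypergeometric
series `F(a, b, c; z)` and `F(a, b, c'; 1 - z)` converge. -/
def lens : Set ℂ := {z | ‖z‖ < 1 ∧ ‖1 - z‖ < 1}

/-- The plane cut along the two closed vertical rays going down from `0` and from `1`. It is a
simply connected open subset of `ℂ - {0, 1}` that contains the lens, the upper half-plane and the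
three open real intervals `(-∞, 0)`, `(0, 1)`, `(1, ∞)`. A function on `ℂ - {0, 1}` obtained by
analytic continuation is single valued here, and its values on the three intervals are the boundary
values from the upper half-plane. -/
def cutPlane : Set ℂ := {z | z.re = 0 ∨ z.re = 1 → 0 < z.im}

theorem lens_subset_cutPlane : lens ⊆ cutPlane := by
  rintro z ⟨h0, h1⟩ h
  exfalso
  have a := (Complex.abs_re_le_norm z).trans_lt h0
  have b := (Complex.abs_re_le_norm (1 - z)).trans_lt h1
  rcases h with h | h
  · rw [Complex.sub_re, h] at b; norm_num at b
  · rw [h] at a; norm_num at a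

theorem upperHalf_subset_cutPlane : upperHalf ⊆ cutPlane := fun _ hz _ => hz

theorem ofReal_mem_cutPlane {x : ℝ} (h0 : x ≠ 0) (h1 : x ≠ 1) : (x : ℂ) ∈ cutPlane := by
  rintro (h | h)
  · exact absurd (by simpa using h) h0
  · exact absurd (by simpa using h) h1

/-- `φ` is, on the cut plane, the analytic continuation of the function `f` given on the lens. -/
def IsContinuationOf (f φ : ℂ → ℂ) : Prop :=
  DifferentiableOn ℂ φ cutPlane ∧ EqOn φ f lens

/-- The local expression on the lens of Schwarz's map for `(a, b, c) = (1/6, 1/2, 1)`. -/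
noncomputable def schwarzLocal₁ (z : ℂ) : ℂ :=
  omega ^ 2 + I * (betaIntegral (1 / 6) (1 / 2) / (Real.pi : ℂ)) *
    (ordinaryHypergeometric (1 / 6 : ℂ) (1 / 2) (2 / 3) (1 - z) /
      ordinaryHypergeometric (1 / 6 : ℂ) (1 / 2) 1 z)

/-- The local expression on the lens of Schwarz's map for `(a, b, c) = (1/12, 5/12, 1)`. -/
noncomputable def schwarzLocal₂ (z : ℂ) : ℂ :=
  I * (betaIntegral (1 / 12) (5 / 12) / (2 * (Real.pi : ℂ))) *
    (ordinaryHypergeometric (1 / 12 : ℂ) (5 / 12) (1 / 2) (1 - z) /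
      ordinaryHypergeometric (1 / 12 : ℂ) (5 / 12) 1 z) - I

/-- The filter of neighbourhoods of the cusp `i∞`: a map tends to `i∞` when its imaginary part tends
to `+∞`. -/
def atCusp : Filter ℂ := comap Complex.im atTop

/-- The fundamental domain of `PSL₂(ℤ)` acting on the upper half-plane. -/
def fundDomain : Set ℂ :=
  {τ | 0 < τ.im ∧ -(1 / 2) < τ.re ∧ τ.re ≤ 1 / 2 ∧ 1 < ‖τ‖} ∪
    {τ | 0 < τ.im ∧ ‖τ‖ = 1 ∧ 0 ≤ τ.re ∧ τ.re ≤ 1 / 2}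

/-! The Schwarz map is an affine function of a quotient of two Euler integrals. For `z` in the upper
half-plane, the form `t ^ (a - 1) * (1 - t) ^ (-b) * (t - z) ^ (-a) dt` integrated over `(-∞, 0)`,
`(0, 1)` and `(1, ∞)` gives, up to constants, `solNeg`, `solMid` and `solOne`. All three are
instances of one integral `betaMean`, and Euler's formula identifies `solNeg` and `solOne` with the
two hypergeometric series of the statement. The integrand is holomorphic in `t` in the lower
half-plane and decays like `|t| ^ (-1 - b)`, so Cauchy's theorem makes the sum of the three
integrals vanish: this is the linear relation `betaMean_relation`.

With this relation the Schwarz map has three expressions that agree on the upper half-plane, each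
using two of the three solutions. On each real interval two of the solutions are given by convergent
real integrals, and the expression in those two is analytic in the adjacent vertical strip or
half-plane; gluing gives `triangleMap` on the whole cut plane. Denominators do not vanish because
the integrands stay in a fixed open half-plane. On the intervals the real integrals show that the
values lie on a vertical line or on the unit circle, and monotonicity of the integrand places them
on the correct arc. Letting `z` tend to `1` and to `∞` in the linear relation produces the sine
identities that locate the two finite vertices. At `0` the integral `solNeg` diverges
logarithmically, which gives the cusp.

The image is then found topologically, without proving injectivity. It is open, and every point of
its closure outside it is a boundary value or a finite vertex, hence lies on the sides of the
triangle (`mem_image_or_boundary`). The exterior of the triangle is connected and contains the value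
`rot (-(a + b))`, which is omitted because `solNeg` has no zero; so the image avoids the exterior.
Being open, it lies in the open triangle, and as the triangle is connected it is all of it
(`triangleMap_image_upperHalf`). The sides are filled by the same closure argument. Finally the
identity theorem on the connected cut plane transfers everything to an arbitrary continuation. -/

/-! ### Euler-type integrals over a segment: convergence, limits, holomorphy. -/

section BetaMean

open MeasureTheory

/-- The density of the beta distribution, up to normalisation. -/
noncomputable def betaWeight (x y s : ℝ) : ℝ := s ^ (x - 1) * (1 - s) ^ (y - 1)

/-- The affine parametrisation of the segment from `p` to `q`. -/
noncomputable def chord (p q : ℂ) (s : ℝ) : ℂ := p * (1 - s) + q * s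

/-- The integrand of `betaMean`. -/
noncomputable def betaKernel (x y a : ℝ) (p q : ℂ) (s : ℝ) : ℂ :=
  (betaWeight x y s : ℂ) * chord p q s ^ ((-a : ℝ) : ℂ)

/-- The integral of `u ^ (-a)` over the segment from `p` to `q` against a beta density. -/
noncomputable def betaMean (x y a : ℝ) (p q : ℂ) : ℂ :=
  ∫ s in Ioo (0 : ℝ) 1, betaKernel x y a p q s

theorem betaWeight_pos {x y s : ℝ} (hs : s ∈ Ioo (0 : ℝ) 1) : 0 < betaWeight x y s :=
  mul_pos (Real.rpow_pos_of_pos hs.1 _) (Real.rpow_pos_of_pos (sub_pos.2 hs.2) _)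

theorem ofReal_betaWeight {x y s : ℝ} (hs : s ∈ Ioo (0 : ℝ) 1) :
    (betaWeight x y s : ℂ) = (s : ℂ) ^ ((x : ℂ) - 1) * (1 - (s : ℂ)) ^ ((y : ℂ) - 1) := by
  have h1 : (0 : ℝ) ≤ 1 - s := by linarith [hs.2]
  rw [betaWeight, ofReal_mul, ofReal_cpow hs.1.le, ofReal_cpow h1]
  push_cast
  rfl

theorem integrableOn_betaWeight {x y : ℝ} (hx : 0 < x) (hy : 0 < y) :
    IntegrableOn (betaWeight x y) (Ioo (0 : ℝ) 1) := by
  have h := (betaIntegral_convergent (u := x) (v := y) (by simpa) (by simpa))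
  rw [intervalIntegrable_iff_integrableOn_Ioo_of_le zero_le_one] at h
  refine (IntegrableOn.congr_fun h.norm (fun s hs => ?_) measurableSet_Ioo)
  simp only [← ofReal_betaWeight hs, norm_real, Real.norm_eq_abs, abs_of_pos (betaWeight_pos hs)]

theorem integral_betaWeight (x y : ℝ) :
    ((∫ s in Ioo (0 : ℝ) 1, betaWeight x y s : ℝ) : ℂ) = betaIntegral x y := by
  rw [betaIntegral, intervalIntegral.integral_of_le zero_le_one, integral_Ioc_eq_integral_Ioo]
  refine (integral_ofReal (𝕜 := ℂ)).symm.trans ?_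
  exact setIntegral_congr_fun measurableSet_Ioo fun s hs => ofReal_betaWeight hs

theorem measurable_betaWeight (x y : ℝ) : Measurable (betaWeight x y) := by
  unfold betaWeight; fun_prop

theorem continuous_chord (p q : ℂ) : Continuous (chord p q) := by
  unfold chord; fun_prop

theorem measurable_betaKernel (x y a : ℝ) (p q : ℂ) : Measurable (betaKernel x y a p q) := by
  have h1 := measurable_betaWeight x y
  have h2 := (continuous_chord p q).measurable
  unfold betaKernel
  exact (measurable_ofReal.comp h1).mul (h2.pow_const _)

theorem norm_betaKernel {x y a s : ℝ} {p q : ℂ} (hs : s ∈ Ioo (0 : ℝ) 1) :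
    ‖betaKernel x y a p q s‖ = betaWeight x y s * ‖chord p q s‖ ^ (-a) := by
  rw [betaKernel, norm_mul, norm_cpow_real, norm_real, Real.norm_eq_abs,
    abs_of_pos (betaWeight_pos hs)]

theorem norm_betaKernel_le {x y a s c : ℝ} {p q : ℂ} (ha : 0 ≤ a) (hs : s ∈ Ioo (0 : ℝ) 1)
    (hc : 0 < c) (h : c ≤ ‖chord p q s‖) :
    ‖betaKernel x y a p q s‖ ≤ betaWeight x y s * c ^ (-a) := by
  rw [norm_betaKernel hs]
  exact mul_le_mul_of_nonneg_left (Real.rpow_le_rpow_of_nonpos hc h (by linarith))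
    (betaWeight_pos hs).le

/-- The exponent `-a` is nonpositive, so a positive lower bound `h` for the modulus of the chord
gives an upper bound for the kernel. The bound may depend on `s`, because at the vertices one end of
the segment is `0`. -/
theorem integrableOn_betaKernel {x y a : ℝ} {p q : ℂ} {h : ℝ → ℝ} (ha : 0 ≤ a)
    (hpos : ∀ s ∈ Ioo (0 : ℝ) 1, 0 < h s)
    (hint : IntegrableOn (fun s => betaWeight x y s * h s ^ (-a)) (Ioo 0 1))
    (hle : ∀ s ∈ Ioo (0 : ℝ) 1, h s ≤ ‖chord p q s‖) :
    IntegrableOn (betaKernel x y a p q) (Ioo 0 1) := by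
  refine Integrable.mono' hint (measurable_betaKernel ..).aestronglyMeasurable ?_
  refine (ae_restrict_iff' measurableSet_Ioo).2 (ae_of_all _ fun s hs => ?_)
  exact norm_betaKernel_le ha hs (hpos s hs) (hle s hs)

/-- Dominated convergence, with a lower bound `h` for the chords as in `integrableOn_betaKernel`.
Only interior points of the limit segment must avoid the branch cut, so an endpoint may degenerate
to `0`. -/
theorem tendsto_betaMean {ι : Type*} {l : Filter ι} [l.IsCountablyGenerated] {x y a : ℝ}
    {p q : ι → ℂ} {p₀ q₀ : ℂ} {h : ℝ → ℝ} (ha : 0 ≤ a)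
    (hpos : ∀ s ∈ Ioo (0 : ℝ) 1, 0 < h s)
    (hint : IntegrableOn (fun s => betaWeight x y s * h s ^ (-a)) (Ioo 0 1))
    (hp : Tendsto p l (𝓝 p₀)) (hq : Tendsto q l (𝓝 q₀))
    (hle : ∀ᶠ i in l, ∀ s ∈ Ioo (0 : ℝ) 1, h s ≤ ‖chord (p i) (q i) s‖)
    (hslit : ∀ s ∈ Ioo (0 : ℝ) 1, chord p₀ q₀ s ∈ slitPlane) :
    Tendsto (fun i => betaMean x y a (p i) (q i)) l (𝓝 (betaMean x y a p₀ q₀)) := by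
  refine tendsto_integral_filter_of_dominated_convergence _
    (Eventually.of_forall fun i => (measurable_betaKernel ..).aestronglyMeasurable) ?_ hint ?_
  · filter_upwards [hle] with i hi
    refine (ae_restrict_iff' measurableSet_Ioo).2 (ae_of_all _ fun s hs => ?_)
    exact norm_betaKernel_le ha hs (hpos s hs) (hi s hs)
  · refine (ae_restrict_iff' measurableSet_Ioo).2 (ae_of_all _ fun s hs => ?_)
    refine Tendsto.const_mul _ ?_
    have hc : Tendsto (fun i => chord (p i) (q i) s) l (𝓝 (chord p₀ q₀ s)) :=
      (hp.mul_const _).add (hq.mul_const _)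
    exact (continuousAt_cpow_const (hslit s hs)).tendsto.comp hc

theorem integrableOn_betaWeight_mul_const {x y : ℝ} (hx : 0 < x) (hy : 0 < y) (c : ℝ) :
    IntegrableOn (fun s => betaWeight x y s * c) (Ioo (0 : ℝ) 1) :=
  (integrableOn_betaWeight hx hy).mul_const c

/-- A chord vanishing linearly at `s = 0` lowers the first beta exponent from `x` to `x - a`. The
next lemma is the same at `s = 1`. -/
theorem integrableOn_betaWeight_mul_left {x y a c : ℝ} (hc : 0 ≤ c) (hx : 0 < x - a) (hy : 0 < y) :
    IntegrableOn (fun s => betaWeight x y s * (c * s) ^ (-a)) (Ioo (0 : ℝ) 1) := by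
  refine (integrableOn_betaWeight_mul_const hx hy (c ^ (-a))).congr_fun (fun s hs => ?_)
    measurableSet_Ioo
  rw [Real.mul_rpow hc hs.1.le]
  simp only [betaWeight]
  rw [show x - a - 1 = x - 1 + -a by ring, Real.rpow_add hs.1]
  ring

theorem integrableOn_betaWeight_mul_right {x y a c : ℝ} (hc : 0 ≤ c) (hx : 0 < x) (hy : 0 < y - a) :
    IntegrableOn (fun s => betaWeight x y s * (c * (1 - s)) ^ (-a)) (Ioo (0 : ℝ) 1) := by
  refine (integrableOn_betaWeight_mul_const hx hy (c ^ (-a))).congr_fun (fun s hs => ?_)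
    measurableSet_Ioo
  have h1 : 0 < 1 - s := sub_pos.2 hs.2
  rw [Real.mul_rpow hc h1.le]
  simp only [betaWeight]
  rw [show y - a - 1 = y - 1 + -a by ring, Real.rpow_add h1]
  ring

theorem setIntegral_Ioo_pos {f : ℝ → ℝ} (hf : IntegrableOn f (Ioo (0 : ℝ) 1))
    (hpos : ∀ s ∈ Ioo (0 : ℝ) 1, 0 < f s) : 0 < ∫ s in Ioo (0 : ℝ) 1, f s := by
  rw [setIntegral_pos_iff_support_of_nonneg_ae ?_ hf]
  · have : Function.support f ∩ Ioo (0 : ℝ) 1 = Ioo 0 1 :=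
      inter_eq_right.2 fun s hs => (hpos s hs).ne'
    rw [this]; simp
  · exact (ae_restrict_iff' measurableSet_Ioo).2 (ae_of_all _ fun s hs => (hpos s hs).le)

theorem betaMean_inner_pos {x y a : ℝ} {p q w : ℂ}
    (hf : IntegrableOn (betaKernel x y a p q) (Ioo (0 : ℝ) 1))
    (hpos : ∀ s ∈ Ioo (0 : ℝ) 1, 0 < (w * chord p q s ^ ((-a : ℝ) : ℂ)).re) :
    0 < (w * betaMean x y a p q).re := by
  have h1 : w * betaMean x y a p q = ∫ s in Ioo (0 : ℝ) 1, w * betaKernel x y a p q s :=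
    (integral_const_mul w _).symm
  have h2 : IntegrableOn (fun s => w * betaKernel x y a p q s) (Ioo (0 : ℝ) 1) := hf.const_mul w
  rw [h1, show (∫ s in Ioo (0 : ℝ) 1, w * betaKernel x y a p q s).re =
    ∫ s in Ioo (0 : ℝ) 1, (w * betaKernel x y a p q s).re from (integral_re h2).symm]
  refine setIntegral_Ioo_pos (h2.re) fun s hs => ?_
  have : w * betaKernel x y a p q s = (betaWeight x y s : ℂ) * (w * chord p q s ^ ((-a : ℝ) : ℂ)) := by
    rw [betaKernel]; ring
  rw [this, re_ofReal_mul]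
  exact mul_pos (betaWeight_pos hs) (hpos s hs)

theorem chord_mem_of_starConvex {S : Set ℂ} {p q : ℂ} (hS : StarConvex ℝ p S) (hq : q ∈ S) {s : ℝ}
    (hs : s ∈ Ioo (0 : ℝ) 1) : chord p q s ∈ S := by
  have := hS hq (sub_nonneg.2 hs.2.le) hs.1.le (sub_add_cancel 1 s)
  simpa [chord, mul_comm] using this

/-- Compactness of the segment. As `0` is outside the slit plane, the same `δ` also bounds from
below the modulus of every point of the segment (`le_norm_of_thickening`). -/
theorem exists_le_norm_chord {p q : ℂ} (h : segment ℝ p q ⊆ slitPlane) :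
    ∃ δ > 0, Metric.thickening δ (segment ℝ p q) ⊆ slitPlane := by
  have hc : IsCompact (segment ℝ p q) := by
    rw [segment_eq_image]
    exact isCompact_Icc.image (by fun_prop)
  exact hc.exists_thickening_subset_open isOpen_slitPlane h

theorem chord_mem_segment (p q : ℂ) {s : ℝ} (hs : s ∈ Ioo (0 : ℝ) 1) : chord p q s ∈ segment ℝ p q :=
  chord_mem_of_starConvex ((convex_segment p q) (left_mem_segment ℝ p q))
    (right_mem_segment ℝ p q) hs

theorem le_norm_of_thickening {δ : ℝ} {S : Set ℂ} (h : Metric.thickening δ S ⊆ slitPlane) {u : ℂ}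
    (hu : u ∈ S) : δ ≤ ‖u‖ := by
  by_contra! hlt
  exact zero_notMem_slitPlane (h (Metric.mem_thickening_iff.2 ⟨u, hu, by simpa using hlt⟩))

theorem integrableOn_betaKernel_of_segment {x y a : ℝ} {p q : ℂ} (ha : 0 ≤ a) (hx : 0 < x)
    (hy : 0 < y) (h : segment ℝ p q ⊆ slitPlane) :
    IntegrableOn (betaKernel x y a p q) (Ioo 0 1) := by
  obtain ⟨δ, hδ, ht⟩ := exists_le_norm_chord h
  exact integrableOn_betaKernel (h := fun _ => δ) ha (fun _ _ => hδ)
    (integrableOn_betaWeight_mul_const hx hy _)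
    fun s hs => le_norm_of_thickening ht (chord_mem_segment p q hs)

theorem norm_chord_le (p q : ℂ) {s : ℝ} (hs : s ∈ Ioo (0 : ℝ) 1) :
    ‖chord p q s‖ ≤ ‖p‖ + ‖q‖ := by
  have h1 : ‖(1 - s : ℂ)‖ ≤ 1 := by
    rw [← ofReal_one, ← ofReal_sub, norm_real, Real.norm_eq_abs, abs_le]
    constructor <;> linarith [hs.1, hs.2]
  have h2 : ‖(s : ℂ)‖ ≤ 1 := by
    rw [norm_real, Real.norm_eq_abs, abs_le]; constructor <;> linarith [hs.1, hs.2]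
  refine (norm_add_le _ _).trans (add_le_add ?_ ?_) <;> rw [norm_mul]
  · exact mul_le_of_le_one_right (norm_nonneg _) h1
  · exact mul_le_of_le_one_right (norm_nonneg _) h2

theorem chord_add (p q p' q' : ℂ) (s : ℝ) :
    chord (p + p') (q + q') s = chord p q s + chord p' q' s := by
  simp only [chord]; ring

theorem chord_mul (z p q : ℂ) (s : ℝ) : chord (z * p) (z * q) s = z * chord p q s := by
  simp only [chord]; ring

/-- Differentiation under the integral sign. Endpoints affine in `z` cover all the solutions used
later. -/
theorem differentiableAt_betaMean {x y a : ℝ} {p q p' q' z₀ : ℂ} (ha : 0 ≤ a) (hx : 0 < x)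
    (hy : 0 < y) (h : segment ℝ (p + z₀ * p') (q + z₀ * q') ⊆ slitPlane) :
    DifferentiableAt ℂ (fun z => betaMean x y a (p + z * p') (q + z * q')) z₀ := by
  obtain ⟨δ, hδ, ht⟩ := exists_le_norm_chord h
  set M : ℝ := ‖p'‖ + ‖q'‖ + 1
  have hM : 0 < M := by positivity
  -- `M` exceeds the modulus of the direction of motion of every chord point, so within radius `δ /
  -- (2 * M)` the chord moves by less than `δ / 2`: it stays in the thickening and keeps distance at
  -- least `δ / 2` from `0`.
  have key : ∀ s ∈ Ioo (0 : ℝ) 1, ∀ z ∈ Metric.ball z₀ (δ / (2 * M)),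
      chord (p + z * p') (q + z * q') s ∈ slitPlane ∧
        δ / 2 ≤ ‖chord (p + z * p') (q + z * q') s‖ := by
    intro s hs z hz
    have hd : dist (chord (p + z * p') (q + z * q') s)
        (chord (p + z₀ * p') (q + z₀ * q') s) < δ / 2 := by
      rw [dist_eq_norm, chord_add, chord_add, chord_mul, chord_mul, add_sub_add_left_eq_sub,
        ← sub_mul, norm_mul]
      have h1 := norm_chord_le p' q' hs
      have h2 : ‖z - z₀‖ < δ / (2 * M) := by simpa [dist_eq_norm] using hz
      calc ‖z - z₀‖ * ‖chord p' q' s‖ ≤ ‖z - z₀‖ * M := by gcongr; simp only [M]; linarith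
        _ < δ / (2 * M) * M := by gcongr
        _ = δ / 2 := by field_simp
    have hmem := chord_mem_segment (p + z₀ * p') (q + z₀ * q') hs
    refine ⟨ht (Metric.mem_thickening_iff.2 ⟨_, hmem, hd.trans (by linarith)⟩), ?_⟩
    have h3 := le_norm_of_thickening ht hmem
    rw [dist_comm, dist_eq_norm] at hd
    have := norm_sub_norm_le (chord (p + z₀ * p') (q + z₀ * q') s) (chord (p + z * p') (q + z * q') s)
    linarith
  refine (hasDerivAt_integral_of_dominated_loc_of_deriv_le
    (F := fun z s => betaKernel x y a (p + z * p') (q + z * q') s)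
    (F' := fun z s => (betaWeight x y s : ℂ) * (((-a : ℝ) : ℂ) *
      chord (p + z * p') (q + z * q') s ^ (((-a : ℝ) : ℂ) - 1) * chord p' q' s))
    (bound := fun s => betaWeight x y s * (a * (δ / 2) ^ (-a - 1) * M))
    (Metric.ball_mem_nhds z₀ (by positivity : 0 < δ / (2 * M)))
    (Eventually.of_forall fun z => (measurable_betaKernel ..).aestronglyMeasurable)
    (integrableOn_betaKernel_of_segment ha hx hy h) ?_ ?_
    (integrableOn_betaWeight_mul_const hx hy _) ?_).2.differentiableAt
  · refine Measurable.aestronglyMeasurable ?_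
    have h1 := measurable_ofReal.comp (measurable_betaWeight x y)
    have h2 := (continuous_chord (p + z₀ * p') (q + z₀ * q')).measurable
    exact h1.mul (((h2.pow_const _).const_mul _).mul (continuous_chord p' q').measurable)
  · refine (ae_restrict_iff' measurableSet_Ioo).2 (ae_of_all _ fun s hs z hz => ?_)
    obtain ⟨-, hn⟩ := key s hs z hz
    rw [norm_mul, norm_mul, norm_mul, norm_real, Real.norm_eq_abs, abs_of_pos (betaWeight_pos hs)]
    refine mul_le_mul_of_nonneg_left ?_ (betaWeight_pos hs).le
    have e1 : ‖((-a : ℝ) : ℂ)‖ = a := by simp [abs_of_nonneg ha]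
    have e2 : (((-a : ℝ) : ℂ) - 1) = ((-a - 1 : ℝ) : ℂ) := by push_cast; ring
    rw [e1, e2, norm_cpow_real]
    have e3 : ‖chord p' q' s‖ ≤ M := (norm_chord_le p' q' hs).trans (by simp only [M]; linarith)
    have e4 := Real.rpow_le_rpow_of_nonpos (by positivity) hn (by linarith : -a - 1 ≤ 0)
    gcongr
  · refine (ae_restrict_iff' measurableSet_Ioo).2 (ae_of_all _ fun s hs z hz => ?_)
    refine HasDerivAt.const_mul _ (HasDerivAt.cpow_const ?_ (key s hs z hz).1)
    simp only [chord_add, chord_mul]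
    simpa using ((hasDerivAt_id z).mul_const (chord p' q' s)).const_add (chord p q s)

end BetaMean

/-! ### Euler's integral and the hypergeometric series. -/

section Euler

open MeasureTheory
open scoped Nat

theorem betaIntegral_add_nat {x y : ℝ} (hx : 0 < x) (hy : 0 < y) (n : ℕ) :
    betaIntegral ((x + n : ℝ) : ℂ) y = betaIntegral x y *
      ((ascPochhammer ℂ n).eval (x : ℂ) * ((ascPochhammer ℂ n).eval ((x + y : ℝ) : ℂ))⁻¹) := by
  have hne : ∀ {t : ℝ}, 0 < t → ∀ k : ℕ, (t : ℂ) ≠ -k := by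
    intro t ht k h
    have := congrArg Complex.re h
    simp at this
    have : (0 : ℝ) ≤ k := k.cast_nonneg
    linarith
  have hn : (0 : ℝ) ≤ n := n.cast_nonneg
  rw [betaIntegral_eq_Gamma_mul_div _ _ (by simp; positivity) (by simpa),
    betaIntegral_eq_Gamma_mul_div _ _ (by simpa) (by simpa),
    ← Gamma_add_nat_div_Gamma_eq _ (hne hx), ← Gamma_add_nat_div_Gamma_eq _ (hne (add_pos hx hy))]
  have h1 : Gamma (x : ℂ) ≠ 0 := Gamma_ne_zero (hne hx)
  have h2 : Gamma ((x + y : ℝ) : ℂ) ≠ 0 := Gamma_ne_zero (hne (add_pos hx hy))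
  have h3 : Gamma ((x + y : ℝ) + n : ℂ) ≠ 0 := by
    have := Gamma_ne_zero (hne (by positivity : 0 < x + y + n))
    simpa using this
  push_cast at *
  rw [show (x + n + y : ℂ) = x + y + n by ring]
  field_simp

theorem hasSum_one_sub_cpow_neg (a : ℂ) {u : ℂ} (hu : ‖u‖ < 1) :
    HasSum (fun n : ℕ => ((n ! : ℂ)⁻¹ * (ascPochhammer ℂ n).eval a) * u ^ n) ((1 - u) ^ (-a)) := by
  have hu' : u ∈ Metric.eball (0 : ℂ) 1 := by
    rw [Metric.mem_eball, edist_zero_right, ← ofReal_norm]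
    exact ENNReal.ofReal_lt_one.2 hu
  have h := (one_div_one_sub_cpow_hasFPowerSeriesOnBall_zero a).hasSum hu'
  simp only [zero_add, one_div, ← cpow_neg] at h
  refine Eq.subst (motive := fun f => HasSum f _) (funext fun n => ?_) h
  rw [FormalMultilinearSeries.ofScalars_apply_eq, Ring.choose_eq_smul,
    Polynomial.descPochhammer_smeval_eq_ascPochhammer, Polynomial.ascPochhammer_smeval_cast,
    Polynomial.ascPochhammer_smeval_eq_eval, show a + n - 1 - n + 1 = a by ring]
  simp

theorem integral_betaWeight_mul_pow {x y : ℝ} (hx : 0 < x) (hy : 0 < y) (n : ℕ) :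
    ∫ s in Ioo (0 : ℝ) 1, (betaWeight x y s : ℂ) * (s : ℂ) ^ n = betaIntegral x y *
      ((ascPochhammer ℂ n).eval (x : ℂ) * ((ascPochhammer ℂ n).eval ((x + y : ℝ) : ℂ))⁻¹) := by
  rw [← betaIntegral_add_nat hx hy, ← integral_betaWeight]
  refine Eq.trans ?_ (integral_ofReal (𝕜 := ℂ))
  refine setIntegral_congr_fun measurableSet_Ioo fun s hs => ?_
  simp only [betaWeight]
  rw [show x + n - 1 = x - 1 + n by ring, Real.rpow_add hs.1, Real.rpow_natCast]
  simp
  ring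

/-- Euler's integral for the hypergeometric series. -/
theorem betaMean_eq_hypergeometric {x y a : ℝ} (hx : 0 < x) (hy : 0 < y) {ζ : ℂ} (hζ : ‖ζ‖ < 1) :
    betaMean x y a 1 (1 - ζ) =
      betaIntegral x y * ordinaryHypergeometric (a : ℂ) (x : ℂ) ((x + y : ℝ) : ℂ) ζ := by
  set c : ℕ → ℂ := fun n => (n ! : ℂ)⁻¹ * (ascPochhammer ℂ n).eval (a : ℂ)
  have hnorm : ‖((‖ζ‖ : ℝ) : ℂ)‖ < 1 := by simpa using hζ
  have hsum : Summable fun n => ‖c n‖ * ‖ζ‖ ^ n := by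
    simpa [c] using (hasSum_one_sub_cpow_neg (a : ℂ) hnorm).summable.norm
  -- The factor `(1 - ζ * s) ^ (-a)` is expanded by the binomial series and integrated term by term;
  -- since `0 < s < 1`, the absolutely convergent series at `‖ζ‖` is a majorant uniform in `s`.
  have key := hasSum_integral_of_dominated_convergence (μ := volume.restrict (Ioo (0 : ℝ) 1))
    (F := fun n s => (betaWeight x y s : ℂ) * (c n * (ζ * s) ^ n)) (f := betaKernel x y a 1 (1 - ζ))
    (fun n s => betaWeight x y s * (‖c n‖ * ‖ζ‖ ^ n)) (fun n => ?_) (fun n => ?_)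
    (ae_of_all _ fun s => hsum.mul_left _) ?_ ?_
  · rw [ordinaryHypergeometric_eq_tsum]
    simp only []
    rw [← tsum_mul_left, betaMean, ← key.tsum_eq]
    refine tsum_congr fun n => ?_
    have : ∀ s : ℝ, (betaWeight x y s : ℂ) * (c n * (ζ * s) ^ n) =
      (c n * ζ ^ n) * ((betaWeight x y s : ℂ) * (s : ℂ) ^ n) := fun s => by rw [mul_pow]; ring
    simp_rw [this]
    rw [integral_const_mul, integral_betaWeight_mul_pow hx hy]
    simp only [c, smul_eq_mul]
    ring
  · refine Measurable.aestronglyMeasurable ?_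
    have h1 := measurable_ofReal.comp (measurable_betaWeight x y)
    exact h1.mul (by fun_prop)
  · refine (ae_restrict_iff' measurableSet_Ioo).2 (ae_of_all _ fun s hs => ?_)
    rw [norm_mul, norm_mul _ ((ζ * s) ^ n), norm_pow, norm_mul ζ, norm_real, norm_real,
      Real.norm_eq_abs, Real.norm_eq_abs, abs_of_pos (betaWeight_pos hs), abs_of_pos hs.1]
    have := (betaWeight_pos (x := x) (y := y) hs).le
    have h1 := hs.1.le
    gcongr
    exact mul_le_of_le_one_right (norm_nonneg _) hs.2.le
  · simp only [tsum_mul_left]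
    exact integrableOn_betaWeight_mul_const hx hy _
  · refine (ae_restrict_iff' measurableSet_Ioo).2 (ae_of_all _ fun s hs => ?_)
    have h1 : ‖ζ * s‖ < 1 := by
      rw [norm_mul, norm_real, Real.norm_eq_abs, abs_of_pos hs.1]
      exact (mul_le_of_le_one_right (norm_nonneg _) hs.2.le).trans_lt hζ
    have h2 := (hasSum_one_sub_cpow_neg (a : ℂ) h1).mul_left (betaWeight x y s : ℂ)
    have e : betaKernel x y a 1 (1 - ζ) s = (betaWeight x y s : ℂ) * (1 - ζ * s) ^ (-(a : ℂ)) := by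
      rw [betaKernel, chord]
      congr 2
      · ring
      · push_cast; ring
    rw [e]
    exact h2

end Euler

/-! ### Cauchy's theorem in the lower half-plane. -/

section Contour

open MeasureTheory

theorem mul_cpow_of_arg {u v : ℂ} (hu : u ≠ 0) (hv : v ≠ 0) (h : arg u + arg v ∈ Ioc (-Real.pi) Real.pi)
    (c : ℂ) : (u * v) ^ c = u ^ c * v ^ c := by
  rw [cpow_def_of_ne_zero (mul_ne_zero hu hv), cpow_def_of_ne_zero hu, cpow_def_of_ne_zero hv,
    log_mul hu hv h, add_mul, exp_add]

theorem ofReal_mul_cpow {r : ℝ} (hr : 0 < r) {v : ℂ} (hv : v ≠ 0) (c : ℂ) :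
    ((r : ℂ) * v) ^ c = (r : ℂ) ^ c * v ^ c := by
  refine mul_cpow_of_arg (ofReal_ne_zero.2 hr.ne') hv ?_ c
  rw [arg_ofReal_of_nonneg hr.le, zero_add]
  exact arg_mem_Ioc v

theorem I_mul_cpow {v : ℂ} (hv : v.im < 0) (c : ℂ) : (I * v) ^ c = I ^ c * v ^ c := by
  have hv0 : v ≠ 0 := by rintro rfl; simp at hv
  refine mul_cpow_of_arg I_ne_zero hv0 ?_ c
  have h1 := arg_neg_iff.2 hv
  have h2 := neg_pi_lt_arg v
  rw [arg_I]
  constructor <;> linarith [Real.pi_pos]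

theorem neg_I_mul_cpow {v : ℂ} (hv : 0 < v.im) (c : ℂ) : (-I * v) ^ c = (-I) ^ c * v ^ c := by
  have hv0 : v ≠ 0 := by rintro rfl; simp at hv
  refine mul_cpow_of_arg (neg_ne_zero.2 I_ne_zero) hv0 ?_ c
  have h1 := arg_nonneg_iff.2 hv.le
  have h2 := arg_le_pi v
  rw [arg_neg_I]
  constructor <;> linarith [Real.pi_pos]

/-- The integrand `t ^ (a - 1) * (1 - t) ^ (-b) * (t - z) ^ (-a)`, up to a constant factor, with
branches that are holomorphic for `t` in the lower half-plane. -/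
noncomputable def lowerKernel (a b : ℝ) (z t : ℂ) : ℂ :=
  (I * t) ^ ((a - 1 : ℝ) : ℂ) * (-I * (1 - t)) ^ ((-b : ℝ) : ℂ) * (I * (t - z)) ^ ((-a : ℝ) : ℂ)

theorem norm_lowerKernel (a b : ℝ) (z t : ℂ) :
    ‖lowerKernel a b z t‖ = ‖t‖ ^ (a - 1) * ‖1 - t‖ ^ (-b) * ‖t - z‖ ^ (-a) := by
  simp only [lowerKernel, norm_mul, norm_cpow_real, norm_I, norm_neg, one_mul]

theorem norm_lowerKernel_le {a b : ℝ} (ha : 0 < a) (ha1 : a < 1) (hb : 0 < b) {z t : ℂ} {r₁ r₂ r₃ : ℝ}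
    (h1 : 0 < r₁) (h2 : 0 < r₂) (h3 : 0 < r₃) (h1' : r₁ ≤ ‖t‖) (h2' : r₂ ≤ ‖1 - t‖)
    (h3' : r₃ ≤ ‖t - z‖) :
    ‖lowerKernel a b z t‖ ≤ r₁ ^ (a - 1) * r₂ ^ (-b) * r₃ ^ (-a) := by
  rw [norm_lowerKernel]
  have e1 := Real.rpow_le_rpow_of_nonpos h1 h1' (by linarith : a - 1 ≤ 0)
  have e2 := Real.rpow_le_rpow_of_nonpos h2 h2' (by linarith : -b ≤ 0)
  have e3 := Real.rpow_le_rpow_of_nonpos h3 h3' (by linarith : -a ≤ 0)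
  gcongr

theorem lowerKernel_factors {z t : ℂ} (hz : 0 < z.im) (ht : t.im ≤ 0) (h0 : t ≠ 0)
    (h1 : t ≠ 1) : I * t ∈ slitPlane ∧ -I * (1 - t) ∈ slitPlane ∧ I * (t - z) ∈ slitPlane := by
  refine ⟨?_, ?_, ?_⟩
  · rw [mem_slitPlane_iff]
    simp only [mul_re, I_re, I_im, mul_im]
    rcases ht.lt_or_eq with h | h
    · left; linarith
    · right
      have : t.re ≠ 0 := fun h' => h0 (Complex.ext h' h)
      simpa
  · rw [mem_slitPlane_iff]
    simp only [mul_re, I_re, I_im, mul_im, neg_re, neg_im, sub_re, sub_im, one_re, one_im]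
    rcases ht.lt_or_eq with h | h
    · left; linarith
    · right
      have : t.re ≠ 1 := fun h' => h1 (Complex.ext h' h)
      intro h2
      exact this (by linarith)
  · rw [mem_slitPlane_iff]
    left
    simp only [mul_re, I_re, I_im, sub_re, sub_im]
    linarith

theorem differentiableAt_lowerKernel (a b : ℝ) {z t : ℂ} (hz : 0 < z.im) (ht : t.im ≤ 0)
    (h0 : t ≠ 0) (h1 : t ≠ 1) : DifferentiableAt ℂ (lowerKernel a b z) t := by
  obtain ⟨e1, e2, e3⟩ := lowerKernel_factors hz ht h0 h1
  unfold lowerKernel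
  refine ((DifferentiableAt.cpow_const ?_ e1).mul (DifferentiableAt.cpow_const ?_ e2)).mul
    (DifferentiableAt.cpow_const ?_ e3) <;> fun_prop

/-- The three exponents add up to `(a - 1) - b - a = -1 - b`. The condition on `X` keeps `1 - t` and
`t - z` at modulus at least `X / 2`. -/
theorem norm_lowerKernel_far {a b : ℝ} (ha : 0 < a) (ha1 : a < 1) (hb : 0 < b) {z t : ℂ} {X : ℝ}
    (hX : 2 + 2 * ‖z‖ ≤ X) (ht : X ≤ ‖t‖) :
    ‖lowerKernel a b z t‖ ≤ 2 ^ (a + b) * X ^ (-1 - b) := by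
  have hz := norm_nonneg z
  have hX0 : 0 < X := by linarith
  have h2 : X / 2 ≤ ‖1 - t‖ := by
    have := norm_sub_norm_le t 1
    rw [norm_sub_rev, norm_one] at this
    linarith
  have h3 : X / 2 ≤ ‖t - z‖ := by
    have := norm_sub_norm_le t z
    linarith
  refine (norm_lowerKernel_le ha ha1 hb hX0 (half_pos hX0) (half_pos hX0) ht h2 h3).trans_eq ?_
  rw [Real.div_rpow hX0.le (by norm_num), Real.div_rpow hX0.le (by norm_num),
    show -1 - b = (a - 1) + -b + -a by ring, Real.rpow_add hX0, Real.rpow_add hX0,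
    Real.rpow_add two_pos, Real.rpow_neg two_pos.le, Real.rpow_neg two_pos.le]
  have := Real.rpow_pos_of_pos two_pos a
  have := Real.rpow_pos_of_pos two_pos b
  field_simp

/-- Cauchy's theorem on the rectangle between heights `-ε` and `-X`. The other three sides have
total length at most `4 * X` and the kernel there is `O(X ^ (-1 - b))`, so their contribution is
`O(X ^ (-b))`. -/
theorem tendsto_intervalIntegral_lowerKernel {a b ε : ℝ} (ha : 0 < a) (ha1 : a < 1) (hb : 0 < b)
    {z : ℂ} (hz : 0 < z.im) (hε : 0 < ε) :
    Tendsto (fun X : ℝ => ∫ x in (-X)..X, lowerKernel a b z (x + ((-ε : ℝ) : ℂ) * I)) atTop (𝓝 0) := by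
  have hlim : Tendsto (fun X : ℝ => 4 * 2 ^ (a + b) * X ^ (-b)) atTop (𝓝 0) := by
    simpa using (tendsto_rpow_neg_atTop hb).const_mul (4 * 2 ^ (a + b))
  refine squeeze_zero_norm' ?_ hlim
  filter_upwards [eventually_ge_atTop (2 + 2 * ‖z‖), eventually_ge_atTop ε] with X hX hXε
  have hX0 : 0 < X := by linarith [norm_nonneg z]
  set C : ℝ := 2 ^ (a + b) * X ^ (-1 - b)
  have hrect := integral_boundary_rect_eq_zero_of_differentiableOn (lowerKernel a b z)
    ⟨-X, -ε⟩ ⟨X, -X⟩ (by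
      intro t ht
      rw [mem_reProdIm, uIcc_of_ge (by linarith : -X ≤ -ε)] at ht
      have him : t.im < 0 := lt_of_le_of_lt ht.2.2 (neg_lt_zero.2 hε)
      refine (differentiableAt_lowerKernel a b hz him.le ?_ ?_).differentiableWithinAt <;>
        rintro rfl <;> simp at him)
  have hC : ∀ t : ℂ, X ≤ ‖t‖ → ‖lowerKernel a b z t‖ ≤ C := fun t ht =>
    norm_lowerKernel_far ha ha1 hb hX ht
  have hbot : ‖∫ x in (-X)..X, lowerKernel a b z (x + ((-X : ℝ) : ℂ) * I)‖ ≤ C * |X - -X| := by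
    refine intervalIntegral.norm_integral_le_of_norm_le_const fun x _ => hC _ ?_
    refine le_trans ?_ (abs_im_le_norm _)
    simp [abs_of_pos hX0]
  have hside : ∀ c : ℝ, |c| = X →
      ‖∫ y in (-ε)..(-X), lowerKernel a b z ((c : ℂ) + y * I)‖ ≤ C * |-X - -ε| := by
    intro c hc
    refine intervalIntegral.norm_integral_le_of_norm_le_const fun x _ => hC _ ?_
    refine le_trans ?_ (abs_re_le_norm _)
    simp [hc]
  have h1 := hside X (abs_of_pos hX0)
  have h2 := hside (-X) (by rw [abs_neg, abs_of_pos hX0])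
  have hCX : 4 * 2 ^ (a + b) * X ^ (-b) = C * (4 * X) := by
    simp only [C]
    rw [show -b = (-1 - b) + 1 by ring, Real.rpow_add hX0, Real.rpow_one]
    ring
  have hC0 : 0 ≤ C := by positivity
  rw [hCX]
  have e1 : |X - -X| = 2 * X := by rw [abs_of_pos] <;> linarith
  have e2 : |-X - -ε| ≤ X := by rw [abs_le]; constructor <;> linarith
  have e3 := mul_le_mul_of_nonneg_left e2 hC0
  rw [e1] at hbot
  rw [show (∫ x in (-X)..X, lowerKernel a b z (x + ((-ε : ℝ) : ℂ) * I)) =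
    (∫ x in (-X)..X, lowerKernel a b z (x + ((-X : ℝ) : ℂ) * I)) -
      I • (∫ y in (-ε)..(-X), lowerKernel a b z ((X : ℂ) + y * I)) +
      I • (∫ y in (-ε)..(-X), lowerKernel a b z (((-X : ℝ) : ℂ) + y * I)) from by
    linear_combination hrect]
  refine (norm_add_le _ _).trans ?_
  have := norm_sub_le (∫ x in (-X)..X, lowerKernel a b z (x + ((-X : ℝ) : ℂ) * I))
    (I • (∫ y in (-ε)..(-X), lowerKernel a b z ((X : ℂ) + y * I)))
  rw [norm_smul, norm_I, one_mul] at this ⊢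
  linarith

theorem measurable_lowerKernel_line (a b y : ℝ) (z : ℂ) :
    Measurable fun x : ℝ => lowerKernel a b z (x + ((-y : ℝ) : ℂ) * I) := by
  unfold lowerKernel
  have h1 : Measurable fun x : ℝ => (x + ((-y : ℝ) : ℂ) * I : ℂ) := by fun_prop
  exact (((h1.const_mul I).pow_const _).mul (((h1.const_sub 1).const_mul (-I)).pow_const _)).mul
    (((h1.sub_const z).const_mul I).pow_const _)

/-- Moving down from the real axis does not decrease the distance to `0`, to `1`, or to `z`, which
lies above the axis; all three exponents are negative. The kernel on the real line therefore
dominates all lower lines. -/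
theorem norm_lowerKernel_line_le {a b : ℝ} (ha : 0 < a) (ha1 : a < 1) (hb : 0 < b) {z : ℂ}
    (hz : 0 < z.im) {y x : ℝ} (hy : 0 ≤ y) (h0 : x ≠ 0) (h1 : x ≠ 1) :
    ‖lowerKernel a b z (x + ((-y : ℝ) : ℂ) * I)‖ ≤ ‖lowerKernel a b z x‖ := by
  rw [norm_lowerKernel a b z x]
  refine norm_lowerKernel_le ha ha1 hb ?_ ?_ ?_ ?_ ?_ ?_
  · exact norm_pos_iff.2 (ofReal_ne_zero.2 h0)
  · refine norm_pos_iff.2 (sub_ne_zero.2 ?_)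
    exact_mod_cast h1.symm
  · refine norm_pos_iff.2 (sub_ne_zero.2 ?_)
    rintro rfl
    simp at hz
  · refine le_trans ?_ (abs_re_le_norm _)
    simp
  · refine le_trans ?_ (abs_re_le_norm _)
    rw [← ofReal_one, ← ofReal_sub, norm_real]
    simp
  · rw [Complex.norm_def, Complex.norm_def]
    refine Real.sqrt_le_sqrt ?_
    rw [normSq_apply, normSq_apply]
    simp only [sub_re, sub_im, add_re, add_im, ofReal_re, ofReal_im, mul_re, mul_im, I_re, I_im]
    nlinarith [mul_nonneg hy hz.le, mul_nonneg hy hy]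

/-- The integral vanishes on each line at height `-ε`, and dominated convergence allows `ε → 0`. -/
theorem integral_lowerKernel_eq_zero {a b : ℝ} (ha : 0 < a) (ha1 : a < 1) (hb : 0 < b) {z : ℂ}
    (hz : 0 < z.im) (hint : Integrable fun x : ℝ => lowerKernel a b z x) :
    ∫ x : ℝ, lowerKernel a b z x = 0 := by
  have hae : ∀ᵐ x : ℝ, x ≠ 0 ∧ x ≠ 1 := by
    filter_upwards [Measure.ae_ne volume (0 : ℝ), Measure.ae_ne volume (1 : ℝ)] with x h0 h1
    exact ⟨h0, h1⟩
  have hline : ∀ ε : ℝ, 0 < ε → ∫ x : ℝ, lowerKernel a b z (x + ((-ε : ℝ) : ℂ) * I) = 0 := by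
    intro ε hε
    refine tendsto_nhds_unique (intervalIntegral_tendsto_integral ?_ tendsto_neg_atTop_atBot tendsto_id)
      (tendsto_intervalIntegral_lowerKernel ha ha1 hb hz hε)
    refine hint.mono (measurable_lowerKernel_line ..).aestronglyMeasurable ?_
    filter_upwards [hae] with x hx
    exact norm_lowerKernel_line_le ha ha1 hb hz hε.le hx.1 hx.2
  have hlim : Tendsto (fun ε : ℝ => ∫ x : ℝ, lowerKernel a b z (x + ((-ε : ℝ) : ℂ) * I)) (𝓝[>] 0)
      (𝓝 (∫ x : ℝ, lowerKernel a b z x)) := by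
    refine tendsto_integral_filter_of_dominated_convergence (fun x : ℝ => ‖lowerKernel a b z x‖)
      (Eventually.of_forall fun ε => (measurable_lowerKernel_line ..).aestronglyMeasurable) ?_
      hint.norm ?_
    · filter_upwards [self_mem_nhdsWithin] with ε hε
      filter_upwards [hae] with x hx
      exact norm_lowerKernel_line_le ha ha1 hb hz (le_of_lt hε) hx.1 hx.2
    · filter_upwards [hae] with x hx
      have hc : ContinuousAt (lowerKernel a b z) (x : ℂ) :=
        (differentiableAt_lowerKernel a b hz (by simp) (ofReal_ne_zero.2 hx.1)
          (by exact_mod_cast hx.2)).continuousAt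
      refine hc.tendsto.comp (tendsto_nhdsWithin_of_tendsto_nhds ?_)
      have : Continuous fun ε : ℝ => (x + ((-ε : ℝ) : ℂ) * I : ℂ) := by fun_prop
      simpa using this.tendsto 0
  refine tendsto_nhds_unique hlim (tendsto_const_nhds.congr' ?_)
  filter_upwards [self_mem_nhdsWithin] with ε hε
  exact (hline ε hε).symm

end Contour

/-! ### The three intervals and the linear relation between their integrals. -/

section Relation

open MeasureTheory

theorem image_one_div_Ioo : (fun s : ℝ => 1 / s) '' Ioo 0 1 = Ioi 1 := by
  ext x
  constructor
  · rintro ⟨s, hs, rfl⟩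
    exact (one_lt_div hs.1).2 hs.2
  · intro hx
    have hx0 : (0 : ℝ) < x := zero_lt_one.trans hx
    exact ⟨1 / x, ⟨by positivity, (div_lt_one hx0).2 hx⟩, by simp⟩

theorem image_one_sub_one_div_Ioo : (fun s : ℝ => 1 - 1 / s) '' Ioo 0 1 = Iio 0 := by
  ext x
  constructor
  · rintro ⟨s, hs, rfl⟩
    have := (one_lt_div hs.1).2 hs.2
    simp only [mem_Iio]; linarith
  · intro hx
    have hx0 : (1 : ℝ) < 1 - x := by simp only [mem_Iio] at hx; linarith
    exact ⟨1 / (1 - x), ⟨by positivity, (div_lt_one (by linarith)).2 hx0⟩, by simp⟩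

theorem chord_im (p q : ℂ) (s : ℝ) : (chord p q s).im = p.im * (1 - s) + q.im * s := by
  simp [chord]

theorem chord_re (p q : ℂ) (s : ℝ) : (chord p q s).re = p.re * (1 - s) + q.re * s := by
  simp [chord]

/-- On `(0, 1)` no substitution is needed; only the constants `I` and `-I` built into the branches
have to be pulled out of the powers, with `I ^ (a - 1) * I ^ (-a) = -I`. -/
theorem lowerKernel_Ioo {a b : ℝ} {z : ℂ} (hz : 0 < z.im) {s : ℝ} (hs : s ∈ Ioo (0 : ℝ) 1) :
    lowerKernel a b z s =
      -I * (-I) ^ ((-b : ℝ) : ℂ) * betaKernel a (1 - b) a (-z) (1 - z) s := by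
  have h1 : 0 < 1 - s := sub_pos.2 hs.2
  have e1 : (I * (s : ℂ)) ^ ((a - 1 : ℝ) : ℂ) = (s : ℂ) ^ ((a - 1 : ℝ) : ℂ) * I ^ ((a - 1 : ℝ) : ℂ) := by
    rw [mul_comm, ofReal_mul_cpow hs.1 I_ne_zero]
  have e2 : (-I * (1 - s : ℂ)) ^ ((-b : ℝ) : ℂ) =
      ((1 - s : ℝ) : ℂ) ^ ((-b : ℝ) : ℂ) * (-I) ^ ((-b : ℝ) : ℂ) := by
    rw [mul_comm, ← ofReal_mul_cpow h1 (neg_ne_zero.2 I_ne_zero)]; push_cast; rfl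
  have e3 : (s : ℂ) - z = chord (-z) (1 - z) s := by simp only [chord]; ring
  have e4 : I ^ ((a - 1 : ℝ) : ℂ) * I ^ ((-a : ℝ) : ℂ) = -I := by
    rw [← cpow_add _ _ I_ne_zero, ← ofReal_add, show a - 1 + -a = -1 by ring]
    simp [cpow_neg_one]
  rw [lowerKernel, e1, e2, I_mul_cpow (by simpa using hz), e3, betaKernel, betaWeight, ofReal_mul,
    ofReal_cpow hs.1.le, ofReal_cpow h1.le, show 1 - b - 1 = -b by ring]
  linear_combination ((s : ℂ) ^ ((a - 1 : ℝ) : ℂ) * ((1 - s : ℝ) : ℂ) ^ ((-b : ℝ) : ℂ) *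
    (-I) ^ ((-b : ℝ) : ℂ) * chord (-z) (1 - z) s ^ ((-a : ℝ) : ℂ)) * e4

/-- The substitution `t = 1 / s` carries `(0, 1)` to `(1, ∞)`; the scalar in front is its Jacobian.
The factor `1 - t` changes sign there, which is why `I ^ (-b)` replaces the `(-I) ^ (-b)` of the
other two intervals. -/
theorem lowerKernel_one_div {a b : ℝ} {z : ℂ} (hz : 0 < z.im) {s : ℝ} (hs : s ∈ Ioo (0 : ℝ) 1) :
    |-(1 / s ^ 2)| • lowerKernel a b z ((1 / s : ℝ) : ℂ) =
      -I * I ^ ((-b : ℝ) : ℂ) * betaKernel b (1 - b) a 1 (1 - z) s := by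
  have h1 : 0 < 1 - s := sub_pos.2 hs.2
  have h0 := hs.1
  have hsC : (s : ℂ) ≠ 0 := ofReal_ne_zero.2 h0.ne'
  have hr : 0 < 1 / s := by positivity
  have hr1 : 0 < (1 - s) / s := by positivity
  have him : (chord 1 (1 - z) s).im < 0 := by
    rw [chord_im]; simp; positivity
  have hne : chord 1 (1 - z) s ≠ 0 := by rintro h; simp [h] at him
  have e1 : (I * ((1 / s : ℝ) : ℂ)) ^ ((a - 1 : ℝ) : ℂ) =
      ((1 / s : ℝ) : ℂ) ^ ((a - 1 : ℝ) : ℂ) * I ^ ((a - 1 : ℝ) : ℂ) := by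
    rw [mul_comm, ofReal_mul_cpow hr I_ne_zero]
  have e2 : (-I * (1 - ((1 / s : ℝ) : ℂ))) ^ ((-b : ℝ) : ℂ) =
      (((1 - s) / s : ℝ) : ℂ) ^ ((-b : ℝ) : ℂ) * I ^ ((-b : ℝ) : ℂ) := by
    rw [← ofReal_mul_cpow hr1 I_ne_zero]; congr 1; push_cast; field_simp; ring
  have e3 : ((1 / s : ℝ) : ℂ) - z = ((1 / s : ℝ) : ℂ) * chord 1 (1 - z) s := by
    simp only [chord]; push_cast; field_simp; ring
  have e5 : (I * (((1 / s : ℝ) : ℂ) - z)) ^ ((-a : ℝ) : ℂ) =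
      I ^ ((-a : ℝ) : ℂ) * (((1 / s : ℝ) : ℂ) ^ ((-a : ℝ) : ℂ) *
        chord 1 (1 - z) s ^ ((-a : ℝ) : ℂ)) := by
    rw [I_mul_cpow, e3, ofReal_mul_cpow hr hne]
    simpa using hz
  have e4 : I ^ ((a - 1 : ℝ) : ℂ) * I ^ ((-a : ℝ) : ℂ) = -I := by
    rw [← cpow_add _ _ I_ne_zero, ← ofReal_add, show a - 1 + -a = -1 by ring]
    simp [cpow_neg_one]
  have e6 : 1 / s ^ 2 * (1 / s) ^ (a - 1) * ((1 - s) / s) ^ (-b) * (1 / s) ^ (-a) =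
      betaWeight b (1 - b) s := by
    rw [betaWeight, Real.div_rpow h1.le h0.le, one_div, one_div, Real.inv_rpow h0.le,
      Real.inv_rpow h0.le, ← Real.rpow_neg h0.le, ← Real.rpow_neg h0.le, div_eq_mul_inv,
      ← Real.rpow_neg h0.le, ← Real.rpow_natCast s 2, ← Real.rpow_neg h0.le]
    rw [show b - 1 = -((2 : ℕ) : ℝ) + -(a - 1) + -(-b) + -(-a) by push_cast; ring,
      Real.rpow_add h0, Real.rpow_add h0, Real.rpow_add h0, show 1 - b - 1 = -b by ring]
    ring
  have e7 := congrArg (fun r : ℝ => (r : ℂ)) e6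
  simp only [ofReal_mul] at e7
  rw [ofReal_cpow hr.le, ofReal_cpow hr1.le, ofReal_cpow hr.le] at e7
  rw [abs_neg, abs_of_pos (by positivity), real_smul, lowerKernel, e1, e2, e5, betaKernel, ← e7]
  linear_combination (((1 / s ^ 2 : ℝ) : ℂ) * ((1 / s : ℝ) : ℂ) ^ ((a - 1 : ℝ) : ℂ) *
    (((1 - s) / s : ℝ) : ℂ) ^ ((-b : ℝ) : ℂ) * I ^ ((-b : ℝ) : ℂ) *
    ((1 / s : ℝ) : ℂ) ^ ((-a : ℝ) : ℂ) * chord 1 (1 - z) s ^ ((-a : ℝ) : ℂ)) * e4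

/-- The substitution `t = 1 - 1 / s` carries `(0, 1)` to `(-∞, 0)` and turns `t - z` into a negative
multiple of the chord from `1` to `z`. -/
theorem lowerKernel_one_sub_one_div {a b : ℝ} {z : ℂ} (hz : 0 < z.im) {s : ℝ}
    (hs : s ∈ Ioo (0 : ℝ) 1) :
    |1 / s ^ 2| • lowerKernel a b z ((1 - 1 / s : ℝ) : ℂ) =
      I * (-I) ^ ((-b : ℝ) : ℂ) * betaKernel b a a 1 z s := by
  have h1 : 0 < 1 - s := sub_pos.2 hs.2
  have h0 := hs.1
  have hsC : (s : ℂ) ≠ 0 := ofReal_ne_zero.2 h0.ne'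
  have hr : 0 < 1 / s := by positivity
  have hr1 : 0 < (1 - s) / s := by positivity
  have him : 0 < (chord 1 z s).im := by
    rw [chord_im]; simp; positivity
  have hne : chord 1 z s ≠ 0 := by rintro h; simp [h] at him
  have e1 : (I * ((1 - 1 / s : ℝ) : ℂ)) ^ ((a - 1 : ℝ) : ℂ) =
      (((1 - s) / s : ℝ) : ℂ) ^ ((a - 1 : ℝ) : ℂ) * (-I) ^ ((a - 1 : ℝ) : ℂ) := by
    rw [← ofReal_mul_cpow hr1 (neg_ne_zero.2 I_ne_zero)]; congr 1; push_cast; field_simp; ring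
  have e2 : (-I * (1 - ((1 - 1 / s : ℝ) : ℂ))) ^ ((-b : ℝ) : ℂ) =
      ((1 / s : ℝ) : ℂ) ^ ((-b : ℝ) : ℂ) * (-I) ^ ((-b : ℝ) : ℂ) := by
    rw [← ofReal_mul_cpow hr (neg_ne_zero.2 I_ne_zero)]; congr 1; push_cast; ring
  have e3 : I * (((1 - 1 / s : ℝ) : ℂ) - z) = ((1 / s : ℝ) : ℂ) * (-I * chord 1 z s) := by
    simp only [chord]; push_cast; field_simp; ring
  have e5 : (I * (((1 - 1 / s : ℝ) : ℂ) - z)) ^ ((-a : ℝ) : ℂ) =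
      (-I) ^ ((-a : ℝ) : ℂ) * (((1 / s : ℝ) : ℂ) ^ ((-a : ℝ) : ℂ) *
        chord 1 z s ^ ((-a : ℝ) : ℂ)) := by
    rw [e3, ofReal_mul_cpow hr (mul_ne_zero (neg_ne_zero.2 I_ne_zero) hne), neg_I_mul_cpow him]
    ring
  have e4 : (-I) ^ ((a - 1 : ℝ) : ℂ) * (-I) ^ ((-a : ℝ) : ℂ) = I := by
    rw [← cpow_add _ _ (neg_ne_zero.2 I_ne_zero), ← ofReal_add, show a - 1 + -a = -1 by ring]
    simp [cpow_neg_one]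
  have e6 : 1 / s ^ 2 * ((1 - s) / s) ^ (a - 1) * (1 / s) ^ (-b) * (1 / s) ^ (-a) =
      betaWeight b a s := by
    rw [betaWeight, Real.div_rpow h1.le h0.le, one_div, one_div, Real.inv_rpow h0.le,
      Real.inv_rpow h0.le, ← Real.rpow_neg h0.le, ← Real.rpow_neg h0.le, div_eq_mul_inv,
      ← Real.rpow_neg h0.le, ← Real.rpow_natCast s 2, ← Real.rpow_neg h0.le]
    rw [show b - 1 = -((2 : ℕ) : ℝ) + -(a - 1) + -(-b) + -(-a) by push_cast; ring,
      Real.rpow_add h0, Real.rpow_add h0, Real.rpow_add h0]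
    ring
  have e7 := congrArg (fun r : ℝ => (r : ℂ)) e6
  simp only [ofReal_mul] at e7
  rw [ofReal_cpow hr.le, ofReal_cpow hr1.le, ofReal_cpow hr.le] at e7
  rw [abs_of_pos (by positivity), real_smul, lowerKernel, e1, e2, e5, betaKernel, ← e7]
  linear_combination (((1 / s ^ 2 : ℝ) : ℂ) * (((1 - s) / s : ℝ) : ℂ) ^ ((a - 1 : ℝ) : ℂ) *
    ((1 / s : ℝ) : ℂ) ^ ((-b : ℝ) : ℂ) * (-I) ^ ((-b : ℝ) : ℂ) *
    ((1 / s : ℝ) : ℂ) ^ ((-a : ℝ) : ℂ) * chord 1 z s ^ ((-a : ℝ) : ℂ)) * e4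

theorem segment_subset_slitPlane_one {q : ℂ} (hq : q ∈ slitPlane) : segment ℝ 1 q ⊆ slitPlane :=
  starConvex_one_slitPlane.segment_subset hq

theorem segment_subset_slitPlane_im_pos {p q : ℂ} (hp : 0 < p.im) (hq : 0 < q.im) :
    segment ℝ p q ⊆ slitPlane :=
  ((convex_halfSpace_im_gt 0).segment_subset hp hq).trans fun _ h => Or.inr (ne_of_gt h)

theorem segment_subset_slitPlane_im_neg {p q : ℂ} (hp : p.im < 0) (hq : q.im < 0) :
    segment ℝ p q ⊆ slitPlane :=
  ((convex_halfSpace_im_lt 0).segment_subset hp hq).trans fun _ h => Or.inr (ne_of_lt h)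

theorem segment_subset_slitPlane_re_pos {p q : ℂ} (hp : 0 < p.re) (hq : 0 < q.re) :
    segment ℝ p q ⊆ slitPlane :=
  ((convex_halfSpace_re_gt 0).segment_subset hp hq).trans fun _ h => Or.inl h

/-- The linear relation between the three solutions attached to the intervals `(-∞, 0)`, `(0, 1)`
and `(1, ∞)`. -/
theorem betaMean_relation {a b : ℝ} (ha : 0 < a) (hab : a < b) (hb : b < 1) {z : ℂ} (hz : 0 < z.im) :
    betaMean b a a 1 z = betaMean a (1 - b) a (-z) (1 - z) +
      exp (-(Real.pi * b : ℝ) * I) * betaMean b (1 - b) a 1 (1 - z) := by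
  have hb0 : 0 < b := ha.trans hab
  have i2 : IntegrableOn (betaKernel b a a 1 z) (Ioo 0 1) :=
    integrableOn_betaKernel_of_segment ha.le hb0 ha
      (segment_subset_slitPlane_one (Or.inr hz.ne'))
  have i3 : IntegrableOn (betaKernel a (1 - b) a (-z) (1 - z)) (Ioo 0 1) :=
    integrableOn_betaKernel_of_segment ha.le ha (by linarith)
      (segment_subset_slitPlane_im_neg (by simpa) (by simpa))
  have i1 : IntegrableOn (betaKernel b (1 - b) a 1 (1 - z)) (Ioo 0 1) :=
    integrableOn_betaKernel_of_segment ha.le hb0 (by linarith)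
      (segment_subset_slitPlane_one (Or.inr (by simpa using hz.ne')))
  have d1 : ∀ s ∈ Ioo (0 : ℝ) 1, HasDerivWithinAt (fun s : ℝ => 1 / s) (-(1 / s ^ 2)) (Ioo 0 1) s := by
    intro s hs
    have := (hasDerivAt_inv hs.1.ne').hasDerivWithinAt (s := Ioo (0 : ℝ) 1)
    simpa [one_div] using this
  have d2 : ∀ s ∈ Ioo (0 : ℝ) 1, HasDerivWithinAt (fun s : ℝ => 1 - 1 / s) (1 / s ^ 2) (Ioo 0 1) s := by
    intro s hs
    simpa using (d1 s hs).const_sub 1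
  have j1 : InjOn (fun s : ℝ => 1 / s) (Ioo 0 1) := fun s _ t _ h => by simpa using h
  have j2 : InjOn (fun s : ℝ => 1 - 1 / s) (Ioo 0 1) := fun s _ t _ h => by simpa using h
  have k1 : IntegrableOn (fun x : ℝ => lowerKernel a b z x) (Ioi 1) := by
    rw [← image_one_div_Ioo, integrableOn_image_iff_integrableOn_abs_deriv_smul measurableSet_Ioo d1 j1]
    exact IntegrableOn.congr_fun (i1.const_mul (-I * I ^ ((-b : ℝ) : ℂ)))
      (fun s hs => (lowerKernel_one_div hz hs).symm) measurableSet_Ioo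
  have k2 : IntegrableOn (fun x : ℝ => lowerKernel a b z x) (Iio 0) := by
    rw [← image_one_sub_one_div_Ioo,
      integrableOn_image_iff_integrableOn_abs_deriv_smul measurableSet_Ioo d2 j2]
    exact IntegrableOn.congr_fun (i2.const_mul (I * (-I) ^ ((-b : ℝ) : ℂ)))
      (fun s hs => (lowerKernel_one_sub_one_div hz hs).symm) measurableSet_Ioo
  have k3 : IntegrableOn (fun x : ℝ => lowerKernel a b z x) (Ioo 0 1) :=
    IntegrableOn.congr_fun (i3.const_mul (-I * (-I) ^ ((-b : ℝ) : ℂ)))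
      (fun s hs => (lowerKernel_Ioo hz hs).symm) measurableSet_Ioo
  have k2' := (integrableOn_Iic_iff_integrableOn_Iio (by simp)).2 k2
  have k3' := (integrableOn_Ioc_iff_integrableOn_Ioo (by simp)).2 k3
  have k4 : IntegrableOn (fun x : ℝ => lowerKernel a b z x) (Ioi 0) := by
    rw [← Ioc_union_Ioi_eq_Ioi zero_le_one]
    exact k3'.union k1
  have k5 : Integrable (fun x : ℝ => lowerKernel a b z x) := by
    rw [← integrableOn_univ, ← Iic_union_Ioi (a := (0 : ℝ))]
    exact k2'.union k4
  have v1 : ∫ x in Ioi (1 : ℝ), lowerKernel a b z x =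
      -I * I ^ ((-b : ℝ) : ℂ) * betaMean b (1 - b) a 1 (1 - z) := by
    rw [← image_one_div_Ioo, integral_image_eq_integral_abs_deriv_smul measurableSet_Ioo d1 j1,
      setIntegral_congr_fun measurableSet_Ioo (fun s hs => lowerKernel_one_div hz hs)]
    exact integral_const_mul _ _
  have v2 : ∫ x in Iic (0 : ℝ), lowerKernel a b z x =
      I * (-I) ^ ((-b : ℝ) : ℂ) * betaMean b a a 1 z := by
    rw [integral_Iic_eq_integral_Iio, ← image_one_sub_one_div_Ioo,
      integral_image_eq_integral_abs_deriv_smul measurableSet_Ioo d2 j2,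
      setIntegral_congr_fun measurableSet_Ioo (fun s hs => lowerKernel_one_sub_one_div hz hs)]
    exact integral_const_mul _ _
  have v3 : ∫ x in Ioc (0 : ℝ) 1, lowerKernel a b z x =
      -I * (-I) ^ ((-b : ℝ) : ℂ) * betaMean a (1 - b) a (-z) (1 - z) := by
    rw [integral_Ioc_eq_integral_Ioo,
      setIntegral_congr_fun measurableSet_Ioo (fun s hs => lowerKernel_Ioo hz hs)]
    exact integral_const_mul _ _
  have v4 : ∫ x in Ioi (0 : ℝ), lowerKernel a b z x =
      (∫ x in Ioc (0 : ℝ) 1, lowerKernel a b z x) + ∫ x in Ioi (1 : ℝ), lowerKernel a b z x := by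
    rw [← Ioc_union_Ioi_eq_Ioi zero_le_one]
    exact setIntegral_union (Ioc_disjoint_Ioi le_rfl) measurableSet_Ioi k3' k1
  -- The vanishing integral over the line is split at `0` and `1`; what remains is to divide by the
  -- common factor `I * (-I) ^ (-b)`.
  have v5 := intervalIntegral.integral_Iic_add_Ioi k2' k4
  rw [integral_lowerKernel_eq_zero ha (hab.trans hb) hb0 hz k5, v4, v1, v2, v3] at v5
  have hψ : (-I) ^ ((-b : ℝ) : ℂ) ≠ 0 := by
    simp [cpow_eq_zero_iff]
  -- The principal logarithms of `I` and `-I` differ by `π * I`; this is the source of the phase in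
  -- the relation.
  have hratio : I ^ ((-b : ℝ) : ℂ) = exp (-(Real.pi * b : ℝ) * I) * (-I) ^ ((-b : ℝ) : ℂ) := by
    rw [cpow_def_of_ne_zero I_ne_zero, cpow_def_of_ne_zero (neg_ne_zero.2 I_ne_zero), log_I,
      log_neg_I, ← exp_add]
    congr 1
    push_cast
    ring
  rw [hratio] at v5
  have hfac : I * (-I) ^ ((-b : ℝ) : ℂ) * (betaMean b a a 1 z - betaMean a (1 - b) a (-z) (1 - z) -
      exp (-(Real.pi * b : ℝ) * I) * betaMean b (1 - b) a 1 (1 - z)) = 0 := by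
    linear_combination v5
  rcases mul_eq_zero.1 hfac with h | h
  · exact absurd h (mul_ne_zero I_ne_zero hψ)
  · linear_combination h

end Relation

/-! ### Real integrals: positivity, monotonicity, scaling, divergence. -/

section RealValues

open MeasureTheory

/-- The real version of `betaMean`. -/
noncomputable def betaMeanReal (x y a p q : ℝ) : ℝ :=
  ∫ s in Ioo (0 : ℝ) 1, betaWeight x y s * (p * (1 - s) + q * s) ^ (-a)

theorem ofReal_chord (p q s : ℝ) : chord p q s = ((p * (1 - s) + q * s : ℝ) : ℂ) := by
  simp [chord]

theorem betaMean_ofReal {x y a p q : ℝ} (h : ∀ s ∈ Ioo (0 : ℝ) 1, 0 ≤ p * (1 - s) + q * s) :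
    betaMean x y a p q = betaMeanReal x y a p q := by
  refine Eq.trans ?_ (integral_ofReal (𝕜 := ℂ))
  refine setIntegral_congr_fun measurableSet_Ioo fun s hs => ?_
  simp only [betaKernel]
  rw [ofReal_chord, ← ofReal_cpow (h s hs)]
  exact (ofReal_mul _ _).symm

theorem integrableOn_betaMeanReal {x y a p q : ℝ} {h : ℝ → ℝ} (ha : 0 ≤ a)
    (hpos : ∀ s ∈ Ioo (0 : ℝ) 1, 0 < h s)
    (hint : IntegrableOn (fun s => betaWeight x y s * h s ^ (-a)) (Ioo 0 1))
    (hle : ∀ s ∈ Ioo (0 : ℝ) 1, h s ≤ p * (1 - s) + q * s) :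
    IntegrableOn (fun s => betaWeight x y s * (p * (1 - s) + q * s) ^ (-a)) (Ioo 0 1) := by
  refine Integrable.mono' hint ?_ ?_
  · have := measurable_betaWeight x y
    exact (this.mul ((by fun_prop : Measurable fun s : ℝ => p * (1 - s) + q * s).pow_const
      _)).aestronglyMeasurable
  · refine (ae_restrict_iff' measurableSet_Ioo).2 (ae_of_all _ fun s hs => ?_)
    have h1 := (hpos s hs).trans_le (hle s hs)
    rw [norm_mul, Real.norm_eq_abs, Real.norm_eq_abs, abs_of_pos (betaWeight_pos hs),
      abs_of_pos (Real.rpow_pos_of_pos h1 _)]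
    exact mul_le_mul_of_nonneg_left (Real.rpow_le_rpow_of_nonpos (hpos s hs) (hle s hs)
      (by linarith)) (betaWeight_pos hs).le

theorem betaMeanReal_pos {x y a p q : ℝ} {h : ℝ → ℝ} (ha : 0 ≤ a)
    (hpos : ∀ s ∈ Ioo (0 : ℝ) 1, 0 < h s)
    (hint : IntegrableOn (fun s => betaWeight x y s * h s ^ (-a)) (Ioo 0 1))
    (hle : ∀ s ∈ Ioo (0 : ℝ) 1, h s ≤ p * (1 - s) + q * s) : 0 < betaMeanReal x y a p q :=
  setIntegral_Ioo_pos (integrableOn_betaMeanReal ha hpos hint hle) fun s hs =>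
    mul_pos (betaWeight_pos hs) (Real.rpow_pos_of_pos ((hpos s hs).trans_le (hle s hs)) _)

/-- A pointwise larger chord gives a smaller integral, since the exponent is negative. Every
inequality on the sides of the triangle comes from this comparison. -/
theorem betaMeanReal_lt {x y a p q p' q' : ℝ} {h : ℝ → ℝ} (ha : 0 < a)
    (hpos : ∀ s ∈ Ioo (0 : ℝ) 1, 0 < h s)
    (hint : IntegrableOn (fun s => betaWeight x y s * h s ^ (-a)) (Ioo 0 1))
    (hle : ∀ s ∈ Ioo (0 : ℝ) 1, h s ≤ p' * (1 - s) + q' * s)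
    (hlt : ∀ s ∈ Ioo (0 : ℝ) 1, p' * (1 - s) + q' * s < p * (1 - s) + q * s) :
    betaMeanReal x y a p q < betaMeanReal x y a p' q' := by
  have i1 := integrableOn_betaMeanReal ha.le hpos hint hle
  have i2 := integrableOn_betaMeanReal ha.le hpos hint fun s hs => (hle s hs).trans (hlt s hs).le
  rw [← sub_pos, betaMeanReal, betaMeanReal, ← integral_sub i1 i2]
  refine setIntegral_Ioo_pos (i1.sub i2) fun s hs => ?_
  rw [← mul_sub]
  exact mul_pos (betaWeight_pos hs) (sub_pos.2 (Real.rpow_lt_rpow_of_neg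
    ((hpos s hs).trans_le (hle s hs)) (hlt s hs) (by linarith)))

theorem betaMeanReal_mul {x y a p q κ : ℝ} (hκ : 0 ≤ κ)
    (h : ∀ s ∈ Ioo (0 : ℝ) 1, 0 ≤ p * (1 - s) + q * s) :
    betaMeanReal x y a (κ * p) (κ * q) = κ ^ (-a) * betaMeanReal x y a p q := by
  rw [betaMeanReal, betaMeanReal, ← integral_const_mul]
  refine setIntegral_congr_fun measurableSet_Ioo fun s hs => ?_
  rw [show κ * p * (1 - s) + κ * q * s = κ * (p * (1 - s) + q * s) by ring,
    Real.mul_rpow hκ (h s hs)]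
  ring

/-- At `δ = 0` the integrand behaves like `1 / (1 - s)` near `s = 1`. For `s ≤ 1 - δ` one has `1 - s
+ δ * s ≤ 2 * (1 - s)`, which gives the explicit lower bound `2 ^ (-a) * (-log δ)`. -/
theorem tendsto_betaMeanReal_atTop {b a : ℝ} (ha : 0 < a) (hb0 : 0 < b) (hb : b < 1) :
    Tendsto (fun δ => betaMeanReal b a a 1 δ) (𝓝[>] 0) atTop := by
  have hlog : Tendsto (fun δ : ℝ => 2 ^ (-a) * -Real.log δ) (𝓝[>] 0) atTop :=
    (tendsto_neg_atBot_atTop.comp Real.tendsto_log_nhdsGT_zero).const_mul_atTop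
      (Real.rpow_pos_of_pos two_pos _)
  refine tendsto_atTop_mono' _ ?_ hlog
  filter_upwards [Ioo_mem_nhdsGT (zero_lt_one (α := ℝ))] with δ hδ
  have hint : IntegrableOn (fun s => betaWeight b a s * (1 * (1 - s) + δ * s) ^ (-a)) (Ioo 0 1) :=
    integrableOn_betaMeanReal (h := fun _ => δ) ha.le (fun _ _ => hδ.1)
      (integrableOn_betaWeight_mul_const hb0 ha _) fun s hs => by
        nlinarith [hs.1, hs.2, hδ.1, hδ.2, mul_nonneg (sub_nonneg.2 hδ.2.le) (sub_nonneg.2 hs.2.le)]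
  have hsub : Ioc (0 : ℝ) (1 - δ) ⊆ Ioo 0 1 := fun s hs => ⟨hs.1, by linarith [hs.2, hδ.1]⟩
  have h1 : ∫ s in (0 : ℝ)..(1 - δ), 2 ^ (-a) * (1 - s)⁻¹ = 2 ^ (-a) * -Real.log δ := by
    rw [intervalIntegral.integral_const_mul,
      intervalIntegral.integral_comp_sub_left (fun s => s⁻¹) 1, sub_sub_cancel, sub_zero,
      integral_inv_of_pos hδ.1 one_pos, one_div, Real.log_inv]
  rw [← h1, intervalIntegral.integral_of_le (by linarith [hδ.2])]
  refine (setIntegral_mono_on ?_ (hint.mono_set hsub) measurableSet_Ioc fun s hs => ?_).trans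
    (setIntegral_mono_set hint ?_ hsub.eventuallyLE)
  · have hc : ContinuousOn (fun s : ℝ => 2 ^ (-a) * (1 - s)⁻¹) (Icc 0 (1 - δ)) := by
      refine ContinuousOn.mul continuousOn_const (ContinuousOn.inv₀ (by fun_prop) fun s hs => ?_)
      have := hs.2
      have := hδ.1
      exact ne_of_gt (by linarith)
    exact hc.integrableOn_Icc.mono_set Ioc_subset_Icc_self
  · have hs' := hsub hs
    have h2 : 0 < 1 - s := sub_pos.2 hs'.2
    have e1 : 1 ≤ s ^ (b - 1) := Real.one_le_rpow_of_pos_of_le_one_of_nonpos hs'.1 hs'.2.le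
      (by linarith)
    have e2 : (2 * (1 - s)) ^ (-a) ≤ (1 * (1 - s) + δ * s) ^ (-a) := by
      refine Real.rpow_le_rpow_of_nonpos ?_ ?_ (by linarith)
      · have := mul_pos hδ.1 hs'.1; linarith
      · nlinarith [hs.2, hδ.1, hs'.1]
    have e3 : 2 ^ (-a) * (1 - s)⁻¹ = 1 * (1 - s) ^ (a - 1) * (2 * (1 - s)) ^ (-a) := by
      rw [Real.mul_rpow two_pos.le h2.le, ← Real.rpow_neg_one, show (-1 : ℝ) = (a - 1) + -a by ring,
        Real.rpow_add h2]
      ring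
    rw [e3, betaWeight]
    have := Real.rpow_pos_of_pos h2 (a - 1)
    gcongr
  · refine (ae_restrict_iff' measurableSet_Ioo).2 (ae_of_all _ fun s hs => ?_)
    have := mul_pos hδ.1 hs.1
    exact mul_nonneg (betaWeight_pos hs).le (Real.rpow_nonneg (by linarith [hs.2]) _)

end RealValues

/-! ### Control of arguments: half-planes and sectors containing the integrals. -/

section Sectors

open MeasureTheory

theorem re_exp_mul_cpow (v : ℂ) (θ a : ℝ) :
    (exp (θ * I) * v ^ ((-a : ℝ) : ℂ)).re = ‖v‖ ^ (-a) * Real.cos (θ - a * arg v) := by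
  rw [cpow_ofReal, exp_mul_I, ← ofReal_cos, ← ofReal_sin, Real.cos_sub]
  simp only [mul_re, mul_im, add_re, add_im, ofReal_re, ofReal_im, I_re, I_im, mul_neg, Real.cos_neg,
    Real.sin_neg]
  rw [mul_comm (arg v) a]
  ring_nf

/-- A half-plane through `0` is a convex cone, so an integrand staying in it keeps the integral
there. The angle `θ` selects the half-plane. -/
theorem exp_mul_betaMean_re_pos {x y a θ : ℝ} {p q : ℂ} (ha : 0 ≤ a) (hx : 0 < x) (hy : 0 < y)
    (h : segment ℝ p q ⊆ slitPlane)
    (harg : ∀ v ∈ segment ℝ p q, θ - a * arg v ∈ Ioo (-(Real.pi / 2)) (Real.pi / 2)) :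
    0 < (exp (θ * I) * betaMean x y a p q).re := by
  refine betaMean_inner_pos (integrableOn_betaKernel_of_segment ha hx hy h) fun s hs => ?_
  have hm := chord_mem_segment p q hs
  have h0 := slitPlane_ne_zero (h hm)
  rw [re_exp_mul_cpow]
  exact mul_pos (Real.rpow_pos_of_pos (norm_pos_iff.2 h0) _) (Real.cos_pos_of_mem_Ioo (harg _ hm))

theorem betaMean_re_pos {x y a : ℝ} {p q : ℂ} (ha : 0 < a) (ha2 : a < 1 / 2) (hx : 0 < x)
    (hy : 0 < y) (h : segment ℝ p q ⊆ slitPlane) : 0 < (betaMean x y a p q).re := by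
  have := exp_mul_betaMean_re_pos (θ := 0) ha.le hx hy h fun v hv => ?_
  · simpa using this
  · have h1 := neg_pi_lt_arg v
    have h2 := arg_le_pi v
    have h3 := Real.pi_pos
    constructor <;> nlinarith

theorem betaMean_mul {x y a : ℝ} {w p q : ℂ} (hw0 : w ≠ 0) (hw : 0 ≤ w.re)
    (h : ∀ s ∈ Ioo (0 : ℝ) 1, 0 < (chord p q s).re) :
    betaMean x y a (w * p) (w * q) = w ^ ((-a : ℝ) : ℂ) * betaMean x y a p q := by
  rw [betaMean, betaMean, ← integral_const_mul]
  refine setIntegral_congr_fun measurableSet_Ioo fun s hs => ?_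
  have h1 := abs_le.1 (abs_arg_le_pi_div_two_iff.2 hw)
  have h2 := abs_lt.1 (abs_arg_lt_pi_div_two_iff.2 (Or.inl (h s hs)))
  have h3 : chord p q s ≠ 0 := fun h0 => by simpa [h0] using h s hs
  simp only [betaKernel]
  rw [chord_mul, mul_cpow_of_arg hw0 h3]
  · ring
  · constructor <;> linarith [h1.1, h1.2, h2.1, h2.2]

theorem neg_cpow_of_im_pos {v : ℂ} (hv : 0 < v.im) (a : ℝ) :
    (-v) ^ ((-a : ℝ) : ℂ) = exp ((Real.pi * a : ℝ) * I) * v ^ ((-a : ℝ) : ℂ) := by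
  have hv0 : v ≠ 0 := by rintro rfl; simp at hv
  rw [cpow_def_of_ne_zero (neg_ne_zero.2 hv0), cpow_def_of_ne_zero hv0, ← exp_add, log, log,
    arg_neg_eq_arg_sub_pi_of_im_pos hv, norm_neg]
  congr 1
  push_cast
  ring

theorem betaMean_neg {x y a : ℝ} {p q : ℂ} (hp : 0 < p.im) (hq : 0 < q.im) :
    betaMean x y a (-p) (-q) = exp ((Real.pi * a : ℝ) * I) * betaMean x y a p q := by
  rw [betaMean, betaMean, ← integral_const_mul]
  refine setIntegral_congr_fun measurableSet_Ioo fun s hs => ?_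
  have h1 : chord (-p) (-q) s = -chord p q s := by simp only [chord]; ring
  have h2 : 0 < (chord p q s).im := by
    rw [chord_im]
    exact add_pos (mul_pos hp (sub_pos.2 hs.2)) (mul_pos hq hs.1)
  simp only [betaKernel]
  rw [h1, neg_cpow_of_im_pos h2]
  ring

/-- The modulus of the chord is at most the chord of the moduli, and its argument lies in `[0, π]`,
so each power loses at most the factor `cos (π * a)` in its real part. This reduces the divergence
at `0` to the real integral. -/
theorem re_betaMean_ge {b a : ℝ} (ha : 0 < a) (ha2 : a < 1 / 2) (hb : 0 < b) {z : ℂ}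
    (hz : 0 < z.im) :
    Real.cos (Real.pi * a) * betaMeanReal b a a 1 ‖z‖ ≤ (betaMean b a a 1 z).re := by
  have hz0 : z ≠ 0 := by rintro rfl; simp at hz
  have hzn : 0 < ‖z‖ := norm_pos_iff.2 hz0
  have hi : IntegrableOn (betaKernel b a a 1 z) (Ioo 0 1) := integrableOn_betaKernel_of_segment
    ha.le hb ha (segment_subset_slitPlane_one (Or.inr hz.ne'))
  rw [betaMeanReal, ← integral_const_mul, show (betaMean b a a 1 z).re =
    ∫ s in Ioo (0 : ℝ) 1, (betaKernel b a a 1 z s).re from (integral_re hi).symm]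
  refine setIntegral_mono_on (Integrable.const_mul (integrableOn_betaMeanReal
    (h := fun _ => min 1 ‖z‖) ha.le (fun _ _ => lt_min one_pos hzn)
    (integrableOn_betaWeight_mul_const hb ha _) fun s hs => ?_) _) hi.re measurableSet_Ioo
    fun s hs => ?_
  · have h1 := min_le_left 1 ‖z‖
    have h2 := min_le_right 1 ‖z‖
    have h3 := sub_pos.2 hs.2
    have h4 := hs.1
    calc min 1 ‖z‖ = min 1 ‖z‖ * (1 - s) + min 1 ‖z‖ * s := by ring
      _ ≤ 1 * (1 - s) + ‖z‖ * s := by gcongr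
  · have him : 0 < (chord 1 z s).im := by
      rw [chord_im]; simpa using mul_pos hz hs.1
    have h0 : chord 1 z s ≠ 0 := fun h => by simp [h] at him
    have hre : (betaKernel b a a 1 z s).re =
        betaWeight b a s * (‖chord 1 z s‖ ^ (-a) * Real.cos (a * arg (chord 1 z s))) := by
      have := re_exp_mul_cpow (chord 1 z s) 0 a
      simp only [ofReal_zero, zero_mul, exp_zero, one_mul, zero_sub, Real.cos_neg] at this
      rw [betaKernel, re_ofReal_mul, this]
    rw [hre]
    have hn : ‖chord 1 z s‖ ≤ 1 * (1 - s) + ‖z‖ * s := by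
      refine (norm_add_le _ _).trans_eq ?_
      rw [norm_mul, norm_mul, norm_one, norm_real, Real.norm_eq_abs, abs_of_pos hs.1, ← ofReal_one,
        ← ofReal_sub, norm_real, Real.norm_eq_abs, abs_of_pos (sub_pos.2 hs.2)]
    have e1 := Real.rpow_le_rpow_of_nonpos (norm_pos_iff.2 h0) hn (by linarith : -a ≤ 0)
    have e2 : Real.cos (Real.pi * a) ≤ Real.cos (a * arg (chord 1 z s)) := by
      have h1 := arg_nonneg_iff.2 him.le
      have h2 := arg_le_pi (chord 1 z s)
      refine Real.cos_le_cos_of_nonneg_of_le_pi (by positivity) ?_ ?_ <;> nlinarith [Real.pi_pos]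
    have e3 : 0 ≤ Real.cos (Real.pi * a) :=
      Real.cos_nonneg_of_mem_Icc ⟨by nlinarith [Real.pi_pos], by nlinarith [Real.pi_pos]⟩
    have e4 := (betaWeight_pos (x := b) (y := a) hs).le
    have e5 : 0 ≤ 1 * (1 - s) + ‖z‖ * s := (norm_nonneg _).trans hn
    calc _ = betaWeight b a s * ((1 * (1 - s) + ‖z‖ * s) ^ (-a) * Real.cos (Real.pi * a)) := by ring
      _ ≤ _ := by gcongr

end Sectors

/-! ### The solutions attached to the three intervals. -/

section Solutions

/-- The solution attached to the interval `(1, ∞)`, a multiple of `F(a, b, 1; z)`. -/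
noncomputable def solOne (a b : ℝ) (z : ℂ) : ℂ := betaMean b (1 - b) a 1 (1 - z)

/-- The solution attached to `(-∞, 0)`, a multiple of `F(a, b, a + b; 1 - z)`. -/
noncomputable def solNeg (a b : ℝ) (z : ℂ) : ℂ := betaMean b a a 1 z

/-- The solution attached to `(0, 1)`, with the branch that is positive on `(1, ∞)`. -/
noncomputable def solMid (a b : ℝ) (z : ℂ) : ℂ := betaMean a (1 - b) a z (z - 1)

/-- The solution attached to `(0, 1)`, with the branch that is positive on `(-∞, 0)`. -/
noncomputable def solMid' (a b : ℝ) (z : ℂ) : ℂ := betaMean a (1 - b) a (-z) (1 - z)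

variable {a b : ℝ}

theorem solOne_differentiableAt (ha : 0 < a) (hb0 : 0 < b) (hb : b < 1) {z : ℂ}
    (hz : 1 - z ∈ slitPlane) : DifferentiableAt ℂ (solOne a b) z := by
  have := differentiableAt_betaMean (p := 1) (p' := 0) (q := 1) (q' := -1) (z₀ := z) (a := a)
    (x := b) (y := 1 - b) ha.le hb0 (by linarith)
    (by simpa [← sub_eq_add_neg] using segment_subset_slitPlane_one hz)
  change DifferentiableAt ℂ (fun z => betaMean b (1 - b) a 1 (1 - z)) z
  simpa [← sub_eq_add_neg] using this

theorem solNeg_differentiableAt (ha : 0 < a) (hb0 : 0 < b) {z : ℂ}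
    (hz : z ∈ slitPlane) : DifferentiableAt ℂ (solNeg a b) z := by
  have := differentiableAt_betaMean (p := 1) (p' := 0) (q := 0) (q' := 1) (z₀ := z) (a := a)
    (x := b) (y := a) ha.le hb0 ha
    (by simpa using segment_subset_slitPlane_one hz)
  change DifferentiableAt ℂ (fun z => betaMean b a a 1 z) z
  simpa using this

theorem solMid_differentiableAt (ha : 0 < a) (hb : b < 1) {z : ℂ}
    (hz : 0 < z.im ∨ 1 < z.re) : DifferentiableAt ℂ (solMid a b) z := by
  have := differentiableAt_betaMean (p := 0) (p' := 1) (q := -1) (q' := 1) (z₀ := z) (a := a)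
    (x := a) (y := 1 - b) ha.le ha (by linarith) (by
      rcases hz with h | h
      · exact segment_subset_slitPlane_im_pos (by simpa) (by simpa)
      · exact segment_subset_slitPlane_re_pos (by simp; linarith) (by simpa))
  change DifferentiableAt ℂ (fun z => betaMean a (1 - b) a z (z - 1)) z
  simpa [neg_add_eq_sub] using this

theorem solMid'_differentiableAt (ha : 0 < a) (hb : b < 1) {z : ℂ}
    (hz : 0 < z.im ∨ z.re < 0) : DifferentiableAt ℂ (solMid' a b) z := by
  have := differentiableAt_betaMean (p := 0) (p' := -1) (q := 1) (q' := -1) (z₀ := z) (a := a)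
    (x := a) (y := 1 - b) ha.le ha (by linarith) (by
      rcases hz with h | h
      · exact segment_subset_slitPlane_im_neg (by simpa) (by simpa)
      · exact segment_subset_slitPlane_re_pos (by simpa) (by simp; linarith))
  change DifferentiableAt ℂ (fun z => betaMean a (1 - b) a (-z) (1 - z)) z
  simpa [← sub_eq_add_neg] using this

theorem solOne_ne_zero (ha : 0 < a) (ha2 : a < 1 / 2) (hb0 : 0 < b) (hb : b < 1) {z : ℂ}
    (hz : 1 - z ∈ slitPlane) : solOne a b z ≠ 0 := fun h => by
  have := betaMean_re_pos (y := 1 - b) ha ha2 hb0 (by linarith) (segment_subset_slitPlane_one hz)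
  rw [solOne] at h
  simp [h] at this

theorem solNeg_ne_zero (ha : 0 < a) (ha2 : a < 1 / 2) (hb0 : 0 < b) {z : ℂ}
    (hz : z ∈ slitPlane) : solNeg a b z ≠ 0 := fun h => by
  have := betaMean_re_pos ha ha2 hb0 ha (segment_subset_slitPlane_one hz)
  rw [solNeg] at h
  simp [h] at this

theorem solMid'_eq {z : ℂ} (hz : 0 < z.im) :
    solMid' a b z = exp ((Real.pi * a : ℝ) * I) * solMid a b z := by
  rw [solMid', solMid, ← betaMean_neg hz (by simpa), neg_sub]

theorem sol_relation (ha : 0 < a) (hab : a < b) (hb : b < 1) {z : ℂ} (hz : 0 < z.im) :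
    solNeg a b z = solMid' a b z + exp (-(Real.pi * b : ℝ) * I) * solOne a b z :=
  betaMean_relation ha hab hb hz

/-- For `1 < z.re` both segments lie in the right half-plane, so both integrals lie strictly within
angle `π * a / 2` of the positive axis. Multiplying one of them by `exp (π * a * I)` leaves the two
sectors disjoint. The rotations in `h1` and `h2` separate them. -/
theorem solNeg_sub_ne_zero (ha : 0 < a) (ha2 : a < 1 / 2) (hb0 : 0 < b) (hb : b < 1) {z : ℂ}
    (hz : 1 < z.re) :
    solNeg a b z - exp ((Real.pi * a : ℝ) * I) * solMid a b z ≠ 0 := fun h => by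
  have hpi := Real.pi_pos
  have harg : ∀ v : ℂ, 0 < v.re → arg v ∈ Ioo (-(Real.pi / 2)) (Real.pi / 2) := fun v hv =>
    abs_lt.1 (abs_arg_lt_pi_div_two_iff.2 (Or.inl hv))
  have h1 : 0 < (exp (((Real.pi / 2 - Real.pi * a / 2 : ℝ) : ℂ) * I) * solNeg a b z).re := by
    refine exp_mul_betaMean_re_pos ha.le hb0 ha
      (segment_subset_slitPlane_re_pos (by simp) (by linarith)) fun v hv => ?_
    have hv' := harg v ((convex_halfSpace_re_gt 0).segment_subset
      (show (1 : ℂ) ∈ {w : ℂ | 0 < w.re} by simp) (show z ∈ {w : ℂ | 0 < w.re} by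
        simp only [mem_ofPred_eq]; linarith) hv)
    constructor <;> nlinarith [hv'.1, hv'.2]
  have h2 : 0 < (exp (((-(Real.pi / 2) + Real.pi * a / 2 : ℝ) : ℂ) * I) * solMid a b z).re := by
    refine exp_mul_betaMean_re_pos ha.le ha (by linarith)
      (segment_subset_slitPlane_re_pos (by linarith) (by simpa)) fun v hv => ?_
    have hv' := harg v ((convex_halfSpace_re_gt 0).segment_subset
      (show z ∈ {w : ℂ | 0 < w.re} by simp only [mem_ofPred_eq]; linarith)
      (show z - 1 ∈ {w : ℂ | 0 < w.re} by simpa using hz) hv)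
    constructor <;> nlinarith [hv'.1, hv'.2]
  have h3 : exp (((Real.pi / 2 - Real.pi * a / 2 : ℝ) : ℂ) * I) * exp ((Real.pi * a : ℝ) * I) =
      -exp (((-(Real.pi / 2) + Real.pi * a / 2 : ℝ) : ℂ) * I) := by
    rw [← exp_add, ← neg_one_mul, ← exp_pi_mul_I, ← exp_add]
    congr 1
    push_cast
    ring
  have h4 : exp (((Real.pi / 2 - Real.pi * a / 2 : ℝ) : ℂ) * I) * solNeg a b z =
      -(exp (((-(Real.pi / 2) + Real.pi * a / 2 : ℝ) : ℂ) * I) * solMid a b z) := by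
    rw [← neg_mul, ← h3, mul_assoc, sub_eq_zero.1 h]
  rw [h4, neg_re] at h1
  linarith

/-- The value at `1` of `solOne`. -/
noncomputable def oneA (a b : ℝ) : ℝ := betaMeanReal b (1 - b) a 1 0
/-- The value at `1` of `solNeg`. -/
noncomputable def negA (a b : ℝ) : ℝ := betaMeanReal b a a 1 1
/-- The value at `1` of `solMid`. -/
noncomputable def midA (a b : ℝ) : ℝ := betaMeanReal a (1 - b) a 1 0
/-- The leading coefficient at `∞` of `solOne`. -/
noncomputable def oneB (a b : ℝ) : ℝ := betaMeanReal b (1 - b) a 0 1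
/-- The leading coefficient at `∞` of `solNeg`. -/
noncomputable def negB (a b : ℝ) : ℝ := betaMeanReal b a a 0 1
/-- The leading coefficient at `∞` of `solMid`. -/
noncomputable def midB (a b : ℝ) : ℝ := betaMeanReal a (1 - b) a 1 1

theorem oneA_pos (ha : 0 < a) (hab : a < b) (hb : a + b < 1) : 0 < oneA a b :=
  betaMeanReal_pos (h := fun s => 1 * (1 - s)) ha.le (fun s hs => by linarith [hs.2])
    (integrableOn_betaWeight_mul_right zero_le_one (by linarith) (by linarith))
    fun s _ => by linarith

theorem negA_pos (ha : 0 < a) (hab : a < b) : 0 < negA a b :=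
  betaMeanReal_pos (h := fun _ => 1) ha.le (fun _ _ => one_pos)
    (integrableOn_betaWeight_mul_const (by linarith) ha _) fun s _ => by linarith

theorem oneB_pos (ha : 0 < a) (hab : a < b) (hb : b < 1) : 0 < oneB a b :=
  betaMeanReal_pos (h := fun s => 1 * s) ha.le (fun s hs => by linarith [hs.1])
    (integrableOn_betaWeight_mul_left zero_le_one (by linarith) (by linarith))
    fun s _ => by linarith

theorem midB_pos (ha : 0 < a) (hb : b < 1) : 0 < midB a b :=
  betaMeanReal_pos (h := fun _ => 1) ha.le (fun _ _ => one_pos)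
    (integrableOn_betaWeight_mul_const ha (by linarith) _) fun s _ => by linarith

/-! ### Limits of the solutions at `1` and at `∞`. -/

section Limits

/-- The limit segment ends at `0`. The condition `z.re ≤ 1` keeps the real part of the chord at
least `1 - s`, and `a + b < 1` makes the resulting majorant integrable. For `solMid` the opposite
side of the line `re = 1` plays this role. -/
theorem tendsto_solOne_one {l : Filter ℂ} [l.IsCountablyGenerated] (ha : 0 < a) (hab : a < b) (hb : a + b < 1) (hl : l ≤ 𝓝 1)
    (hre : ∀ᶠ z in l, z.re ≤ 1) : Tendsto (solOne a b) l (𝓝 (oneA a b)) := by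
  have h0 : ((oneA a b : ℝ) : ℂ) = betaMean b (1 - b) a 1 0 := by
    rw [oneA, ← betaMean_ofReal fun s hs => by linarith [hs.2]]; simp
  rw [h0]
  refine tendsto_betaMean (h := fun s => 1 * (1 - s)) ha.le (fun s hs => by linarith [hs.2])
    (integrableOn_betaWeight_mul_right zero_le_one (by linarith) (by linarith))
    tendsto_const_nhds ?_ ?_ ?_
  · have : Tendsto (fun z : ℂ => 1 - z) (𝓝 1) (𝓝 (1 - 1)) := tendsto_const_nhds.sub tendsto_id
    rw [sub_self] at this
    exact this.mono_left hl
  · filter_upwards [hre] with z hz s hs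
    refine le_trans ?_ (re_le_norm _)
    rw [chord_re]
    simp only [one_re, sub_re]
    nlinarith [hs.1]
  · intro s hs
    left
    rw [chord_re]
    simp
    exact hs.2

theorem tendsto_solMid_one {l : Filter ℂ} [l.IsCountablyGenerated] (ha : 0 < a) (hb : a + b < 1) (hl : l ≤ 𝓝 1)
    (hre : ∀ᶠ z in l, 1 ≤ z.re) : Tendsto (solMid a b) l (𝓝 (midA a b)) := by
  have h0 : ((midA a b : ℝ) : ℂ) = betaMean a (1 - b) a 1 0 := by
    rw [midA, ← betaMean_ofReal fun s hs => by linarith [hs.2]]; simp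
  rw [h0]
  refine tendsto_betaMean (h := fun s => 1 * (1 - s)) ha.le (fun s hs => by linarith [hs.2])
    (integrableOn_betaWeight_mul_right zero_le_one ha (by linarith)) hl ?_ ?_ ?_
  · have : Tendsto (fun z : ℂ => z - 1) (𝓝 1) (𝓝 (1 - 1)) := tendsto_id.sub tendsto_const_nhds
    rw [sub_self] at this
    exact this.mono_left hl
  · filter_upwards [hre] with z hz s hs
    refine le_trans ?_ (re_le_norm _)
    rw [chord_re]
    simp only [one_re, sub_re]
    nlinarith [hs.1]
  · intro s hs
    left
    rw [chord_re]
    simp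
    exact hs.2

theorem tendsto_solNeg_one {l : Filter ℂ} (ha : 0 < a) (hb0 : 0 < b) (hl : l ≤ 𝓝 1) :
    Tendsto (solNeg a b) l (𝓝 (negA a b)) := by
  have h0 : ((negA a b : ℝ) : ℂ) = solNeg a b 1 := by
    rw [negA, solNeg, ← betaMean_ofReal fun s hs => by linarith [hs.2]]; simp
  rw [h0]
  exact (solNeg_differentiableAt ha hb0 one_mem_slitPlane).continuousAt.tendsto.mono_left hl

theorem tendsto_inv_of_cobounded {l : Filter ℂ} (hl : l ≤ Bornology.cobounded ℂ) :
    Tendsto (fun z : ℂ => 1 / z) l (𝓝 0) := by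
  simpa [one_div] using (tendsto_inv₀_cobounded (α := ℂ)).mono_left hl

theorem one_div_re_le {z : ℂ} : (1 / z).re = z.re / normSq z := by
  rw [one_div, inv_re]

theorem eventually_norm_one_div {l : Filter ℂ} (hl : l ≤ Bornology.cobounded ℂ) :
    ∀ᶠ z in l, ‖1 / z‖ < 1 / 2 := by
  simpa using (tendsto_inv_of_cobounded hl).norm.eventually (gt_mem_nhds (by simp : ‖(0:ℂ)‖ < 1 / 2))

theorem half_le_chord_re {z : ℂ} (hz : ‖1 / z‖ < 1 / 2) {s : ℝ} (hs : s ∈ Ioo (0 : ℝ) 1) :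
    1 / 2 ≤ (chord 1 (1 - 1 / z) s).re := by
  have h1 := (re_le_norm (1 / z)).trans hz.le
  rw [chord_re, sub_re, one_re]
  nlinarith [hs.1, hs.2]

theorem tendsto_mid_infty {l : Filter ℂ} [l.IsCountablyGenerated] (ha : 0 < a) (hb : b < 1) (hl : l ≤ Bornology.cobounded ℂ) :
    Tendsto (fun z => betaMean a (1 - b) a 1 (1 - 1 / z)) l (𝓝 (midB a b)) := by
  have h0 : ((midB a b : ℝ) : ℂ) = betaMean a (1 - b) a 1 1 := by
    rw [midB, ← betaMean_ofReal fun s hs => by linarith [hs.2]]; simp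
  rw [h0]
  refine tendsto_betaMean (h := fun _ => 1 / 2) ha.le (fun s hs => by norm_num)
    (integrableOn_betaWeight_mul_const ha (by linarith) _)
    tendsto_const_nhds ?_ ?_ ?_
  · simpa using (tendsto_inv_of_cobounded hl).const_sub 1
  · filter_upwards [eventually_norm_one_div hl] with z hz s hs
    exact (half_le_chord_re hz hs).trans (re_le_norm _)
  · intro s _
    left
    rw [chord_re]
    simp

/-- This is `solOne` after the factor `(-z) ^ (-a)` is removed (`solOne_eq_scaled`). Here the chord
degenerates at `s = 0`, and integrability of the majorant needs `a < b`. -/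
theorem tendsto_one_infty {l : Filter ℂ} [l.IsCountablyGenerated] (ha : 0 < a) (hab : a < b) (hb : b < 1) (hl : l ≤ Bornology.cobounded ℂ)
    (hre : ∀ᶠ z in l, z.re ≤ 0) :
    Tendsto (fun z => betaMean b (1 - b) a (-1 / z) (1 - 1 / z)) l (𝓝 (oneB a b)) := by
  have h0 : ((oneB a b : ℝ) : ℂ) = betaMean b (1 - b) a 0 1 := by
    rw [oneB, ← betaMean_ofReal fun s hs => by linarith [hs.1]]; simp
  rw [h0]
  refine tendsto_betaMean (h := fun s => 1 * s) ha.le (fun s hs => by linarith [hs.1])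
    (integrableOn_betaWeight_mul_left zero_le_one (by linarith) (by linarith)) ?_ ?_ ?_ ?_
  · have := (tendsto_inv_of_cobounded hl).neg
    rw [neg_zero] at this
    exact this.congr fun z => by ring
  · simpa using (tendsto_inv_of_cobounded hl).const_sub 1
  · filter_upwards [hre] with z hz s hs
    refine le_trans ?_ (re_le_norm _)
    have : (1 / z).re ≤ 0 := by
      rw [one_div_re_le]; exact div_nonpos_of_nonpos_of_nonneg hz (normSq_nonneg z)
    rw [chord_re, neg_div, neg_re, sub_re, one_re]
    linarith
  · intro s hs
    left
    rw [chord_re]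
    simpa using hs.1

theorem tendsto_neg_infty {l : Filter ℂ} [l.IsCountablyGenerated] (ha : 0 < a) (hab : a < b) (hl : l ≤ Bornology.cobounded ℂ)
    (hre : ∀ᶠ z in l, 0 ≤ z.re) :
    Tendsto (fun z => betaMean b a a (1 / z) 1) l (𝓝 (negB a b)) := by
  have h0 : ((negB a b : ℝ) : ℂ) = betaMean b a a 0 1 := by
    rw [negB, ← betaMean_ofReal fun s hs => by linarith [hs.1]]; simp
  rw [h0]
  refine tendsto_betaMean (h := fun s => 1 * s) ha.le (fun s hs => by linarith [hs.1])
    (integrableOn_betaWeight_mul_left zero_le_one (by linarith) ha)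
    (tendsto_inv_of_cobounded hl) tendsto_const_nhds ?_ ?_
  · filter_upwards [hre] with z hz s hs
    refine le_trans ?_ (re_le_norm _)
    have : 0 ≤ (1 / z).re := by
      rw [one_div_re_le]; exact div_nonneg hz (normSq_nonneg z)
    rw [chord_re, one_re]
    nlinarith [hs.1, hs.2]
  · intro s hs
    left
    rw [chord_re]
    simpa using hs.1

end Limits

/-- The integral is homogeneous of degree `-a` in its endpoints. The half-plane conditions keep the
sum of the two arguments within `(-π, π)`, so that the principal power is multiplicative. The next
three lemmas rest on the same principle. -/
theorem solOne_eq_scaled {z : ℂ} (hz : z.re ≤ 0) (hz0 : z ≠ 0) :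
    solOne a b z = (-z) ^ ((-a : ℝ) : ℂ) * betaMean b (1 - b) a (-1 / z) (1 - 1 / z) := by
  rw [← betaMean_mul (neg_ne_zero.2 hz0) (by simpa) fun s hs => ?_, solOne]
  · congr 1 <;> field_simp; ring
  · have : (1 / z).re ≤ 0 := by
      rw [one_div_re_le]; exact div_nonpos_of_nonpos_of_nonneg hz (normSq_nonneg z)
    rw [chord_re, neg_div, neg_re, sub_re, one_re]
    nlinarith [hs.1]

theorem solMid'_eq_scaled {z : ℂ} (hz : z.re ≤ 0) (hz0 : z ≠ 0) (hn : ‖1 / z‖ < 1 / 2) :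
    solMid' a b z = (-z) ^ ((-a : ℝ) : ℂ) * betaMean a (1 - b) a 1 (1 - 1 / z) := by
  rw [← betaMean_mul (neg_ne_zero.2 hz0) (by simpa) fun s hs => ?_, solMid']
  · congr 1 <;> field_simp; ring
  · linarith [half_le_chord_re hn hs]

theorem solMid_eq_scaled {z : ℂ} (hz : 0 ≤ z.re) (hz0 : z ≠ 0) (hn : ‖1 / z‖ < 1 / 2) :
    solMid a b z = z ^ ((-a : ℝ) : ℂ) * betaMean a (1 - b) a 1 (1 - 1 / z) := by
  rw [← betaMean_mul hz0 hz fun s hs => ?_, solMid]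
  · congr 1 <;> field_simp
  · linarith [half_le_chord_re hn hs]

theorem solNeg_eq_scaled {z : ℂ} (hz : 0 ≤ z.re) (hz0 : z ≠ 0) :
    solNeg a b z = z ^ ((-a : ℝ) : ℂ) * betaMean b a a (1 / z) 1 := by
  rw [← betaMean_mul hz0 hz fun s hs => ?_, solNeg]
  · congr 1 <;> field_simp
  · have : 0 ≤ (1 / z).re := by
      rw [one_div_re_le]; exact div_nonneg hz (normSq_nonneg z)
    rw [chord_re, one_re]
    nlinarith [hs.1, hs.2]

/-- The point `1` is approached along the vertical line `re = 1`, where the one-sided limits of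
`solOne` and of `solMid` are both available. -/
theorem relation_at_one (ha : 0 < a) (hab : a < b) (hb : a + b < 1) :
    (negA a b : ℂ) = exp ((Real.pi * a : ℝ) * I) * midA a b +
      exp (-(Real.pi * b : ℝ) * I) * oneA a b := by
  have hb0 : 0 < b := ha.trans hab
  set c : ℝ → ℂ := fun ε => 1 + ε * I
  have hc : Tendsto c (𝓝[>] 0) (𝓝 1) := by
    have : Continuous c := by fun_prop
    simpa [c] using (this.tendsto 0).mono_left nhdsWithin_le_nhds
  set l : Filter ℂ := map c (𝓝[>] 0)
  have hre : ∀ᶠ z in l, z.re = 1 ∧ 0 < z.im := by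
    refine eventually_map.2 ?_
    filter_upwards [self_mem_nhdsWithin] with ε hε
    simpa [c] using hε
  have t1 := tendsto_solOne_one (l := l) ha hab hb hc (hre.mono fun z h => h.1.le)
  have t2 := tendsto_solNeg_one (l := l) ha hb0 hc
  have t3 := tendsto_solMid_one (l := l) ha hb hc (hre.mono fun z h => h.1.ge)
  refine tendsto_nhds_unique t2 (((t3.const_mul _).add (t1.const_mul _)).congr' ?_)
  filter_upwards [hre] with z hz
  rw [sol_relation ha hab (by linarith) hz.2, solMid'_eq hz.2]

/-- The limit is taken along the positive imaginary axis, where the scaled forms for `z.re ≤ 0` and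
for `0 ≤ z.re` both apply; the common factor `z ^ (-a)` cancels. -/
theorem relation_at_infty (ha : 0 < a) (hab : a < b) (hb : b < 1) :
    (negB a b : ℂ) = exp ((Real.pi * a : ℝ) * I) * (midB a b +
      exp (-(Real.pi * b : ℝ) * I) * oneB a b) := by
  have hb0 : 0 < b := ha.trans hab
  set c : ℝ → ℂ := fun y => y * I
  have hc : Tendsto c atTop (Bornology.cobounded ℂ) := by
    rw [← tendsto_norm_atTop_iff_cobounded]
    simpa [c] using tendsto_abs_atTop_atTop
  set l : Filter ℂ := map c atTop
  have hre : ∀ᶠ z in l, z.re = 0 ∧ 0 < z.im := by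
    refine eventually_map.2 ?_
    filter_upwards [eventually_gt_atTop 0] with ε hε
    simpa [c] using hε
  have t1 := tendsto_one_infty (l := l) ha hab hb hc (hre.mono fun z h => h.1.le)
  have t2 := tendsto_neg_infty (l := l) ha hab hc (hre.mono fun z h => h.1.ge)
  have t3 := tendsto_mid_infty (l := l) ha hb hc
  refine tendsto_nhds_unique t2 (((t3.add (t1.const_mul _)).const_mul _).congr' ?_)
  filter_upwards [hre, eventually_norm_one_div hc] with z hz hn
  have hz0 : z ≠ 0 := by rintro rfl; simp at hz
  have h1 := sol_relation ha hab hb hz.2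
  rw [solMid'_eq hz.2, solNeg_eq_scaled hz.1.ge hz0, solMid_eq_scaled hz.1.ge hz0 hn,
    solOne_eq_scaled hz.1.le hz0, neg_cpow_of_im_pos hz.2] at h1
  have h2 : z ^ ((-a : ℝ) : ℂ) ≠ 0 := by simp [cpow_eq_zero_iff, hz0]
  refine mul_left_cancel₀ h2 ?_
  rw [h1]
  ring

end Solutions

/-! ### The Schwarz map and its three expressions. -/

section TriangleMap

/-- The point of the unit circle at angle `π * t`. -/
noncomputable def rot (t : ℝ) : ℂ := exp ((Real.pi * t : ℝ) * I)

theorem rot_ne_zero (t : ℝ) : rot t ≠ 0 := exp_ne_zero _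

theorem rot_add (s t : ℝ) : rot (s + t) = rot s * rot t := by
  rw [rot, rot, rot, ← exp_add]; congr 1; push_cast; ring

theorem rot_neg (t : ℝ) : rot (-t) = (rot t)⁻¹ := by
  rw [rot, rot, ← exp_neg]; congr 1; push_cast; ring

theorem rot_sub (s t : ℝ) : rot (s - t) = rot s / rot t := by
  rw [sub_eq_add_neg, rot_add, rot_neg, div_eq_mul_inv]

theorem rot_re (t : ℝ) : (rot t).re = Real.cos (Real.pi * t) := exp_ofReal_mul_I_re _

theorem rot_im (t : ℝ) : (rot t).im = Real.sin (Real.pi * t) := exp_ofReal_mul_I_im _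

theorem norm_rot (t : ℝ) : ‖rot t‖ = 1 := norm_exp_ofReal_mul_I _

theorem rot_sub_inv (t : ℝ) : rot t - (rot t)⁻¹ = ((2 * Real.sin (Real.pi * t) : ℝ) : ℂ) * I := by
  rw [← rot_neg]
  apply Complex.ext
  · simp only [sub_re, rot_re, mul_neg, Real.cos_neg, sub_self, re_ofReal_mul, I_re, mul_zero]
  · simp only [sub_im, rot_im, mul_neg, Real.sin_neg, im_ofReal_mul, I_im, mul_one]
    ring

theorem conj_rot (t : ℝ) : (starRingEnd ℂ) (rot t) = (rot t)⁻¹ := by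
  rw [← rot_neg]
  apply Complex.ext <;> simp [rot_re, rot_im]

/-- The Schwarz map in terms of the solutions attached to `(-∞, 0)` and `(1, ∞)`. -/
noncomputable def triangleNegOne (a b : ℝ) (z : ℂ) : ℂ :=
  (rot a * rot b)⁻¹ + (rot a - (rot a)⁻¹) * (solNeg a b z / solOne a b z)

/-- The Schwarz map in terms of the solutions attached to `(0, 1)` and `(1, ∞)`. -/
noncomputable def triangleMidOne (a b : ℝ) (z : ℂ) : ℂ :=
  rot a / rot b + (rot a - (rot a)⁻¹) * (solMid' a b z / solOne a b z)

/-- The Schwarz map in terms of the solutions attached to `(-∞, 0)` and `(0, 1)`. -/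
noncomputable def triangleNegMid (a b : ℝ) (z : ℂ) : ℂ :=
  (rot b)⁻¹ * ((rot a * solNeg a b z - solMid a b z) / (solNeg a b z - rot a * solMid a b z))

open Classical in
/-- The Schwarz map on the cut plane. -/
noncomputable def triangleMap (a b : ℝ) (z : ℂ) : ℂ :=
  if z.re < 0 then triangleMidOne a b z else
    if 1 < z.re then triangleNegMid a b z else triangleNegOne a b z

/-- The parameters `a`, `b` of the Schwarz triangles with a cusp considered here. -/
structure TriangleParams (a b : ℝ) : Prop where
  pos : 0 < a
  lt : a < b
  add_lt : a + b < 1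

theorem TriangleParams.b_pos {a b : ℝ} (h : TriangleParams a b) : 0 < b := h.pos.trans h.lt

theorem TriangleParams.b_lt {a b : ℝ} (h : TriangleParams a b) : b < 1 := by
  linarith [h.pos, h.add_lt]

theorem TriangleParams.a_lt {a b : ℝ} (h : TriangleParams a b) : a < 1 / 2 := by
  linarith [h.lt, h.add_lt]

theorem sin_pi_mul_pos {t : ℝ} (h0 : 0 < t) (h1 : t < 1) : 0 < Real.sin (Real.pi * t) :=
  Real.sin_pos_of_pos_of_lt_pi (mul_pos Real.pi_pos h0) (by nlinarith [Real.pi_pos])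

variable {a b : ℝ}

theorem exp_neg_eq_rot_inv (b : ℝ) : exp (-(Real.pi * b : ℝ) * I) = (rot b)⁻¹ := by
  rw [rot, ← exp_neg, neg_mul]

theorem sol_relation_rot (h : TriangleParams a b) {z : ℂ} (hz : 0 < z.im) :
    solNeg a b z = solMid' a b z + (rot b)⁻¹ * solOne a b z := by
  rw [← exp_neg_eq_rot_inv]
  exact sol_relation h.pos h.lt h.b_lt hz

theorem solMid'_eq_rot {z : ℂ} (hz : 0 < z.im) : solMid' a b z = rot a * solMid a b z :=
  solMid'_eq hz

theorem one_sub_mem_slitPlane {z : ℂ} (hz : 0 < z.im ∨ z.re < 1) : 1 - z ∈ slitPlane := by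
  rcases hz with h | h
  · right; simpa using h.ne'
  · left; simpa

theorem mem_slitPlane_of_im_or_re {z : ℂ} (hz : 0 < z.im ∨ 0 < z.re) : z ∈ slitPlane := by
  rcases hz with h | h
  · exact Or.inr h.ne'
  · exact Or.inl h

theorem TriangleParams.solOne_ne_zero (h : TriangleParams a b) {z : ℂ} (hz : 0 < z.im ∨ z.re < 1) :
    solOne a b z ≠ 0 :=
  _root_.solOne_ne_zero h.pos h.a_lt h.b_pos h.b_lt (one_sub_mem_slitPlane hz)

/-- The denominator of `triangleNegMid` is a rotated `solOne`, written without reference to `solOne`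
so that it continues across `(1, ∞)`. -/
theorem solNeg_sub_eq (h : TriangleParams a b) {z : ℂ} (hz : 0 < z.im) :
    solNeg a b z - rot a * solMid a b z = (rot b)⁻¹ * solOne a b z := by
  rw [sol_relation_rot h hz, solMid'_eq_rot hz]; ring

theorem TriangleParams.solNeg_sub_ne_zero (h : TriangleParams a b) {z : ℂ}
    (hz : 0 < z.im ∨ 1 < z.re) : solNeg a b z - rot a * solMid a b z ≠ 0 := by
  rcases hz with hz | hz
  · rw [solNeg_sub_eq h hz]
    exact mul_ne_zero (inv_ne_zero (rot_ne_zero b)) (h.solOne_ne_zero (Or.inl hz))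
  · exact _root_.solNeg_sub_ne_zero h.pos h.a_lt h.b_pos h.b_lt hz

/-- The linear relation eliminates one solution. In this lemma and the next, the additive and
multiplicative constants of the three expressions are exactly those that make them agree. -/
theorem triangleMidOne_eq (h : TriangleParams a b) {z : ℂ} (hz : 0 < z.im) :
    triangleMidOne a b z = triangleNegOne a b z := by
  have h1 := h.solOne_ne_zero (Or.inl hz)
  have ha := rot_ne_zero a
  have hb := rot_ne_zero b
  rw [triangleMidOne, triangleNegOne, sol_relation_rot h hz]
  field_simp
  ring

theorem triangleNegMid_eq (h : TriangleParams a b) {z : ℂ} (hz : 0 < z.im) :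
    triangleNegMid a b z = triangleNegOne a b z := by
  have h1 := h.solOne_ne_zero (Or.inl hz)
  have ha := rot_ne_zero a
  have hb := rot_ne_zero b
  have h2 := solNeg_sub_eq h hz
  have h3 : solOne a b z = rot b * (solNeg a b z - rot a * solMid a b z) := by
    rw [h2]; field_simp
  have h4 := h.solNeg_sub_ne_zero (Or.inl hz)
  rw [triangleNegMid, triangleNegOne, h3]
  field_simp
  ring

theorem triangleMap_eq_negOne (h : TriangleParams a b) {z : ℂ}
    (hz : 0 < z.im ∨ 0 ≤ z.re ∧ z.re ≤ 1) : triangleMap a b z = triangleNegOne a b z := by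
  unfold triangleMap
  split_ifs with h1 h2
  · exact triangleMidOne_eq h (hz.resolve_right fun h3 => by linarith [h3.1])
  · exact triangleNegMid_eq h (hz.resolve_right fun h3 => by linarith [h3.2])
  · rfl

theorem triangleMap_eq_midOne (h : TriangleParams a b) {z : ℂ} (hz : 0 < z.im ∨ z.re < 0) :
    triangleMap a b z = triangleMidOne a b z := by
  rcases hz with hz | hz
  · rw [triangleMidOne_eq h hz, triangleMap_eq_negOne h (Or.inl hz)]
  · simp [triangleMap, hz]

theorem triangleMap_eq_negMid (h : TriangleParams a b) {z : ℂ} (hz : 0 < z.im ∨ 1 < z.re) :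
    triangleMap a b z = triangleNegMid a b z := by
  rcases hz with hz | hz
  · rw [triangleNegMid_eq h hz, triangleMap_eq_negOne h (Or.inl hz)]
  · have : ¬ z.re < 0 := by linarith
    simp [triangleMap, hz, this]

theorem isOpen_setOf_re_lt (c : ℝ) : IsOpen {z : ℂ | z.re < c} :=
  isOpen_lt continuous_re continuous_const

theorem isOpen_setOf_lt_re (c : ℝ) : IsOpen {z : ℂ | c < z.re} :=
  isOpen_lt continuous_const continuous_re

theorem isOpen_upperHalf : IsOpen upperHalf := isOpen_lt continuous_const continuous_im

theorem triangleMap_differentiableAt (h : TriangleParams a b) {z : ℂ} (hz : z ∈ cutPlane) :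
    DifferentiableAt ℂ (triangleMap a b) z := by
  -- The cut plane is covered by four open sets, on each of which a single expression is valid.
  have hstrip : 0 < z.im ∨ (0 < z.re ∧ z.re < 1) ∨ z.re < 0 ∨ 1 < z.re := by
    by_contra! hcon
    obtain ⟨h1, h2, h3, h4⟩ := hcon
    rcases h3.eq_or_lt with h5 | h5
    · exact absurd (hz (Or.inl h5.symm)) (not_lt.2 h1)
    · exact absurd (hz (Or.inr (le_antisymm h4 (h2 h5)))) (not_lt.2 h1)
  have key : ∀ {f : ℂ → ℂ} {U : Set ℂ}, IsOpen U → z ∈ U → (∀ w ∈ U, triangleMap a b w = f w) →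
      DifferentiableAt ℂ f z → DifferentiableAt ℂ (triangleMap a b) z := fun hU hzU heq hf =>
    hf.congr_of_eventuallyEq (eventually_of_mem (hU.mem_nhds hzU) heq)
  have dNegOne : (0 < z.im ∨ 0 < z.re ∧ z.re < 1) → DifferentiableAt ℂ (triangleNegOne a b) z := by
    intro hz
    have h1 : 0 < z.im ∨ z.re < 1 := hz.imp_right And.right
    have h2 : 0 < z.im ∨ 0 < z.re := hz.imp_right And.left
    exact (((solNeg_differentiableAt h.pos h.b_pos (mem_slitPlane_of_im_or_re h2)).div
      (solOne_differentiableAt h.pos h.b_pos h.b_lt (one_sub_mem_slitPlane h1))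
      (h.solOne_ne_zero h1)).const_mul _).const_add _
  rcases hstrip with hz | hz | hz | hz
  · exact key isOpen_upperHalf hz (fun w hw => triangleMap_eq_negOne h (Or.inl hw))
      (dNegOne (Or.inl hz))
  · exact key ((isOpen_setOf_lt_re 0).inter (isOpen_setOf_re_lt 1)) hz
      (fun w hw => triangleMap_eq_negOne h (Or.inr ⟨le_of_lt hw.1, le_of_lt hw.2⟩))
      (dNegOne (Or.inr hz))
  · refine key (isOpen_setOf_re_lt 0) hz (fun w hw => triangleMap_eq_midOne h (Or.inr hw)) ?_
    have h1 : 0 < z.im ∨ z.re < 1 := Or.inr (by linarith)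
    exact (((solMid'_differentiableAt h.pos h.b_lt (Or.inr hz)).div
      (solOne_differentiableAt h.pos h.b_pos h.b_lt (one_sub_mem_slitPlane h1))
      (h.solOne_ne_zero h1)).const_mul _).const_add _
  · refine key (isOpen_setOf_lt_re 1) hz (fun w hw => triangleMap_eq_negMid h (Or.inr hw)) ?_
    have h1 : 0 < z.im ∨ 0 < z.re := Or.inr (by linarith)
    have d1 := solNeg_differentiableAt h.pos h.b_pos (mem_slitPlane_of_im_or_re h1)
    have d2 := solMid_differentiableAt h.pos h.b_lt (Or.inr hz)
    exact (((d1.const_mul _).sub d2).div (d1.sub (d2.const_mul _))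
      (h.solNeg_sub_ne_zero (Or.inr hz))).const_mul _

/-! ### Sine identities between the values at the vertices. -/

section Constants

theorem relation_at_one_rot (h : TriangleParams a b) :
    (negA a b : ℂ) = rot a * midA a b + (rot b)⁻¹ * oneA a b := by
  rw [← exp_neg_eq_rot_inv]
  exact relation_at_one h.pos h.lt h.add_lt

theorem relation_at_infty_rot (h : TriangleParams a b) :
    (negB a b : ℂ) = rot a * (midB a b + (rot b)⁻¹ * oneB a b) := by
  rw [← exp_neg_eq_rot_inv]
  exact relation_at_infty h.pos h.lt h.b_lt

/-- All three constants are real, so the single complex relation splits into two real ones; these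
fix all the ratios that determine the vertices. -/
theorem relations_at_one (h : TriangleParams a b) :
    negA a b = Real.cos (Real.pi * a) * midA a b + Real.cos (Real.pi * b) * oneA a b ∧
      Real.sin (Real.pi * a) * midA a b = Real.sin (Real.pi * b) * oneA a b := by
  have h1 := relation_at_one_rot h
  rw [← rot_neg] at h1
  have hre := congrArg Complex.re h1
  have him := congrArg Complex.im h1
  simp [rot_re, rot_im] at hre him
  constructor <;> linarith

theorem relations_at_infty (h : TriangleParams a b) :
    negB a b = Real.cos (Real.pi * a) * midB a b + Real.cos (Real.pi * (b - a)) * oneB a b ∧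
      Real.sin (Real.pi * a) * midB a b = Real.sin (Real.pi * (b - a)) * oneB a b := by
  have h1 : (negB a b : ℂ) = rot a * midB a b + rot (-(b - a)) * oneB a b := by
    rw [relation_at_infty_rot h, neg_sub, rot_sub]; ring
  have hre := congrArg Complex.re h1
  have him := congrArg Complex.im h1
  simp only [ofReal_re, ofReal_im, add_re, add_im, re_mul_ofReal, im_mul_ofReal, rot_re, rot_im,
    mul_neg, Real.cos_neg, Real.sin_neg] at hre him
  constructor <;> linarith

theorem negA_mul_sin (h : TriangleParams a b) :
    negA a b * Real.sin (Real.pi * a) = oneA a b * Real.sin (Real.pi * (a + b)) := by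
  obtain ⟨h1, h2⟩ := relations_at_one h
  rw [mul_add, Real.sin_add]
  linear_combination Real.sin (Real.pi * a) * h1 + Real.cos (Real.pi * a) * h2

theorem midA_mul_sin (h : TriangleParams a b) :
    midA a b * Real.sin (Real.pi * (a + b)) = negA a b * Real.sin (Real.pi * b) := by
  obtain ⟨h1, h2⟩ := relations_at_one h
  rw [mul_add, Real.sin_add]
  linear_combination -Real.sin (Real.pi * b) * h1 + Real.cos (Real.pi * b) * h2

theorem midB_mul_sin (h : TriangleParams a b) :
    midB a b * Real.sin (Real.pi * a) = oneB a b * Real.sin (Real.pi * (b - a)) := by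
  obtain ⟨h1, h2⟩ := relations_at_infty h
  linear_combination h2

theorem negB_mul_sin (h : TriangleParams a b) :
    negB a b * Real.sin (Real.pi * a) = oneB a b * Real.sin (Real.pi * b) := by
  obtain ⟨h1, h2⟩ := relations_at_infty h
  have : Real.sin (Real.pi * b) = Real.sin (Real.pi * (b - a) + Real.pi * a) := by ring_nf
  rw [this, Real.sin_add]
  linear_combination Real.sin (Real.pi * a) * h1 + Real.cos (Real.pi * a) * h2

theorem midB_mul_sin' (h : TriangleParams a b) :
    midB a b * Real.sin (Real.pi * b) = negB a b * Real.sin (Real.pi * (b - a)) := by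
  have h1 := midB_mul_sin h
  have h2 := negB_mul_sin h
  have h3 := (sin_pi_mul_pos h.pos (by linarith [h.a_lt])).ne'
  refine mul_right_cancel₀ h3 ?_
  linear_combination Real.sin (Real.pi * b) * h1 - Real.sin (Real.pi * (b - a)) * h2

end Constants

/-! ### The finite vertices of the triangle. -/

section VertexLimits

theorem isCountablyGenerated_cobounded : (Bornology.cobounded ℂ).IsCountablyGenerated := by
  rw [← comap_norm_atTop]; infer_instance

/-- The limits of the solutions hold only on one side of a vertical line, so each vertex is
approached separately from two closed half-planes, with a different expression of the Schwarz map in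
each. -/
theorem tendsto_of_inf_principal {l : Filter ℂ} {m : Filter ℂ} {f : ℂ → ℂ} {s t : Set ℂ}
    (hst : s ∪ t = univ) (hs : Tendsto f (l ⊓ 𝓟 s) m) (ht : Tendsto f (l ⊓ 𝓟 t) m) :
    Tendsto f l m := by
  have : l = (l ⊓ 𝓟 s) ⊔ (l ⊓ 𝓟 t) := by
    rw [← inf_sup_left, sup_principal, hst, principal_univ, inf_top_eq]
  rw [this]
  exact hs.sup ht

theorem triangleMap_tendsto_one (h : TriangleParams a b) :
    Tendsto (triangleMap a b) (𝓝[upperHalf] 1) (𝓝 (rot (a + b))) := by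
  have ha := rot_ne_zero a
  have hb := rot_ne_zero b
  have hO : (oneA a b : ℂ) ≠ 0 := ofReal_ne_zero.2 (oneA_pos h.pos h.lt h.add_lt).ne'
  have hN : (negA a b : ℂ) ≠ 0 := ofReal_ne_zero.2 (negA_pos h.pos h.lt).ne'
  have him : ∀ s : Set ℂ, ∀ᶠ z in 𝓝[upperHalf] 1 ⊓ 𝓟 s, 0 < z.im := fun s =>
    Eventually.filter_mono inf_le_left self_mem_nhdsWithin
  have hre : ∀ (l : Filter ℂ) (s : Set ℂ), ∀ᶠ z in l ⊓ 𝓟 s, z ∈ s := fun l s =>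
    Eventually.filter_mono inf_le_right (mem_principal_self s)
  have hl : ∀ s : Set ℂ, 𝓝[upperHalf] 1 ⊓ 𝓟 s ≤ 𝓝 1 := fun s =>
    inf_le_left.trans nhdsWithin_le_nhds
  -- The sine identity `negA_mul_sin` multiplied by `2 * I`. It turns the limit into `rot (-(a + b))
  -- + (rot (a + b) - rot (-(a + b)))`.
  have hsin : (negA a b : ℂ) * (rot a - (rot a)⁻¹) =
      oneA a b * (rot a * rot b - (rot a * rot b)⁻¹) := by
    have := congrArg (fun t : ℝ => (t : ℂ)) (negA_mul_sin h)
    simp only [ofReal_mul] at this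
    rw [← rot_add, rot_sub_inv, rot_sub_inv]
    simp only [ofReal_mul, ofReal_ofNat]
    linear_combination 2 * I * this
  refine tendsto_of_inf_principal (s := {z | z.re ≤ 1}) (t := {z | 1 ≤ z.re})
    (eq_univ_of_forall fun z => le_total z.re 1) ?_ ?_
  · have t1 := tendsto_solOne_one h.pos h.lt h.add_lt (hl _) (hre (𝓝[upperHalf] 1) {z | z.re ≤ 1})
    have t2 := tendsto_solNeg_one h.pos h.b_pos (hl {z | z.re ≤ 1})
    have t := ((t2.div t1 hO).const_mul (rot a - (rot a)⁻¹)).const_add (rot a * rot b)⁻¹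
    have e : (rot a * rot b)⁻¹ + (rot a - (rot a)⁻¹) * ((negA a b : ℂ) / oneA a b) =
        rot (a + b) := by
      rw [← mul_div_assoc, mul_comm _ (negA a b : ℂ), hsin, mul_div_cancel_left₀ _ hO, rot_add]
      ring
    rw [e] at t
    refine t.congr' ?_
    filter_upwards [him _] with z hz
    exact (triangleMap_eq_negOne h (Or.inl hz)).symm
  · have t2 := tendsto_solNeg_one h.pos h.b_pos (hl {z | 1 ≤ z.re})
    have t3 := tendsto_solMid_one h.pos h.add_lt (hl _) (hre (𝓝[upperHalf] 1) {z | 1 ≤ z.re})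
    have hD : (negA a b : ℂ) - rot a * midA a b = (rot b)⁻¹ * oneA a b := by
      rw [relation_at_one_rot h]; ring
    have hD0 : (negA a b : ℂ) - rot a * midA a b ≠ 0 := by
      rw [hD]; exact mul_ne_zero (inv_ne_zero hb) hO
    have t := (((t2.const_mul (rot a)).sub t3).div (t2.sub (t3.const_mul (rot a))) hD0).const_mul
      (rot b)⁻¹
    have e : (rot b)⁻¹ * ((rot a * negA a b - midA a b) / (negA a b - rot a * midA a b)) =
        rot (a + b) := by
      rw [hD, rot_add]
      have hM : (midA a b : ℂ) = (rot a)⁻¹ * (negA a b - (rot b)⁻¹ * oneA a b) := by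
        rw [relation_at_one_rot h]; field_simp; ring
      rw [hM]
      field_simp
      field_simp at hsin
      linear_combination hsin
    rw [e] at t
    refine t.congr' ?_
    filter_upwards [him _] with z hz
    exact (triangleMap_eq_negMid h (Or.inl hz)).symm

theorem triangleMap_tendsto_infty (h : TriangleParams a b) :
    Tendsto (triangleMap a b) (Bornology.cobounded ℂ ⊓ 𝓟 upperHalf) (𝓝 (rot (b - a))) := by
  have := isCountablyGenerated_cobounded
  have ha := rot_ne_zero a
  have hb := rot_ne_zero b
  have hO : (oneB a b : ℂ) ≠ 0 := ofReal_ne_zero.2 (oneB_pos h.pos h.lt h.b_lt).ne'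
  set L := Bornology.cobounded ℂ ⊓ 𝓟 upperHalf
  have him : ∀ s : Set ℂ, ∀ᶠ z in L ⊓ 𝓟 s, 0 < z.im := fun s =>
    Eventually.filter_mono (inf_le_left.trans inf_le_right) (mem_principal_self upperHalf)
  have hre : ∀ s : Set ℂ, ∀ᶠ z in L ⊓ 𝓟 s, z ∈ s := fun s =>
    Eventually.filter_mono inf_le_right (mem_principal_self s)
  have hl : ∀ s : Set ℂ, L ⊓ 𝓟 s ≤ Bornology.cobounded ℂ := fun s => inf_le_left.trans inf_le_left
  have hsin : (midB a b : ℂ) * (rot a - (rot a)⁻¹) =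
      oneB a b * (rot b / rot a - (rot b / rot a)⁻¹) := by
    have := congrArg (fun t : ℝ => (t : ℂ)) (midB_mul_sin h)
    simp only [ofReal_mul] at this
    rw [← rot_sub, rot_sub_inv, rot_sub_inv]
    simp only [ofReal_mul, ofReal_ofNat]
    linear_combination 2 * I * this
  refine tendsto_of_inf_principal (s := {z | z.re ≤ 0}) (t := {z | 0 ≤ z.re})
    (eq_univ_of_forall fun z => le_total z.re 0) ?_ ?_
  · have t1 := tendsto_one_infty h.pos h.lt h.b_lt (hl _) (hre {z | z.re ≤ 0})
    have t2 := tendsto_mid_infty h.pos h.b_lt (hl {z | z.re ≤ 0})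
    have t := ((t2.div t1 hO).const_mul (rot a - (rot a)⁻¹)).const_add (rot a / rot b)
    have e : rot a / rot b + (rot a - (rot a)⁻¹) * ((midB a b : ℂ) / oneB a b) =
        rot (b - a) := by
      rw [← mul_div_assoc, mul_comm _ (midB a b : ℂ), hsin, mul_div_cancel_left₀ _ hO, rot_sub,
        inv_div]
      ring
    rw [e] at t
    refine t.congr' ?_
    filter_upwards [him _, hre _, eventually_norm_one_div (hl _)] with z hz hz' hn
    have hz0 : z ≠ 0 := by rintro rfl; simp at hz
    -- Both solutions carry the same factor, which cancels in the quotient; only the leading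
    -- coefficients survive.
    have hc : (-z) ^ ((-a : ℝ) : ℂ) ≠ 0 := by simp [cpow_eq_zero_iff, hz0]
    rw [triangleMap_eq_midOne h (Or.inl hz), triangleMidOne, solOne_eq_scaled hz' hz0,
      solMid'_eq_scaled hz' hz0 hn, mul_div_mul_left _ _ hc]
    rfl
  · have t2 := tendsto_neg_infty h.pos h.lt (hl _) (hre {z | 0 ≤ z.re})
    have t3 := tendsto_mid_infty h.pos h.b_lt (hl {z | 0 ≤ z.re})
    have hD : (negB a b : ℂ) - rot a * midB a b = rot a * (rot b)⁻¹ * oneB a b := by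
      rw [relation_at_infty_rot h]; ring
    have hD0 : (negB a b : ℂ) - rot a * midB a b ≠ 0 := by
      rw [hD]; exact mul_ne_zero (mul_ne_zero ha (inv_ne_zero hb)) hO
    have t := (((t2.const_mul (rot a)).sub t3).div (t2.sub (t3.const_mul (rot a))) hD0).const_mul
      (rot b)⁻¹
    have e : (rot b)⁻¹ * ((rot a * negB a b - midB a b) / (negB a b - rot a * midB a b)) =
        rot (b - a) := by
      rw [hD, rot_sub, relation_at_infty_rot h]
      field_simp
      field_simp at hsin
      linear_combination hsin
    rw [e] at t
    refine t.congr' ?_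
    filter_upwards [him _, hre _, eventually_norm_one_div (hl _)] with z hz hz' hn
    have hz0 : z ≠ 0 := by rintro rfl; simp at hz
    have hc : z ^ ((-a : ℝ) : ℂ) ≠ 0 := by simp [cpow_eq_zero_iff, hz0]
    rw [triangleMap_eq_negMid h (Or.inl hz), triangleNegMid, solNeg_eq_scaled hz' hz0,
      solMid_eq_scaled hz' hz0 hn]
    simp only [Pi.div_apply]
    rw [mul_left_comm (rot a) (z ^ _), mul_left_comm (rot a) (z ^ _), ← mul_sub, ← mul_sub,
      mul_div_mul_left _ _ hc]

end VertexLimits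

end TriangleMap

/-! ### The cusp at `0`. -/

section Cusp

variable {a b : ℝ}

/-- Points of the segment have argument strictly between `-π` and `π`, so the integral lies in the
sector of half-angle `π * a`. The two rotations test its two bounding rays. -/
theorem solNeg_im_le (h : TriangleParams a b) {z : ℂ} (hz : 0 < z.im) :
    |(solNeg a b z).im| * Real.cos (Real.pi * a) ≤ Real.sin (Real.pi * a) * (solNeg a b z).re := by
  have hpi := Real.pi_pos
  have ha := h.pos
  have ha2 := h.a_lt
  have hs := segment_subset_slitPlane_one (q := z) (Or.inr hz.ne')
  have harg : ∀ v ∈ segment ℝ 1 z, -Real.pi < arg v ∧ arg v < Real.pi := fun v hv =>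
    ⟨neg_pi_lt_arg v, lt_of_le_of_ne (arg_le_pi v) (mem_slitPlane_iff_arg.1 (hs hv)).1⟩
  have h1 := exp_mul_betaMean_re_pos (θ := Real.pi / 2 - Real.pi * a) h.pos.le h.b_pos h.pos hs
    fun v hv => by
      obtain ⟨e1, e2⟩ := harg v hv
      constructor <;> nlinarith
  have h2 := exp_mul_betaMean_re_pos (θ := -(Real.pi / 2 - Real.pi * a)) h.pos.le h.b_pos h.pos hs
    fun v hv => by
      obtain ⟨e1, e2⟩ := harg v hv
      constructor <;> nlinarith
  rw [mul_re, exp_ofReal_mul_I_re, exp_ofReal_mul_I_im, Real.cos_pi_div_two_sub,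
    Real.sin_pi_div_two_sub] at h1
  rw [mul_re, exp_ofReal_mul_I_re, exp_ofReal_mul_I_im, Real.cos_neg, Real.sin_neg,
    Real.cos_pi_div_two_sub, Real.sin_pi_div_two_sub] at h2
  rw [solNeg]
  rcases abs_cases (betaMean b a a 1 z).im with ⟨e, -⟩ | ⟨e, -⟩ <;> rw [e] <;> linarith

theorem triangleNegOne_im (a b : ℝ) (z : ℂ) : (triangleNegOne a b z).im =
    -Real.sin (Real.pi * (a + b)) +
      2 * Real.sin (Real.pi * a) * (solNeg a b z / solOne a b z).re := by
  rw [triangleNegOne, ← rot_add, ← rot_neg, rot_sub_inv, add_im, rot_im, mul_neg, Real.sin_neg,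
    mul_assoc, im_ofReal_mul, I_mul_im]

theorem triangleNegOne_re (a b : ℝ) (z : ℂ) : (triangleNegOne a b z).re =
    Real.cos (Real.pi * (a + b)) -
      2 * Real.sin (Real.pi * a) * (solNeg a b z / solOne a b z).im := by
  rw [triangleNegOne, ← rot_add, ← rot_neg, rot_sub_inv, add_re, rot_re, mul_neg, Real.cos_neg,
    mul_assoc, re_ofReal_mul, I_mul_re]
  ring

theorem triangleMidOne_im (a b : ℝ) (z : ℂ) : (triangleMidOne a b z).im =
    -Real.sin (Real.pi * (b - a)) +
      2 * Real.sin (Real.pi * a) * (solMid' a b z / solOne a b z).re := by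
  rw [triangleMidOne, ← rot_sub, rot_sub_inv, add_im, rot_im, mul_assoc, im_ofReal_mul, I_mul_im,
    ← neg_sub b a, mul_neg, Real.sin_neg]

theorem triangleMidOne_re (a b : ℝ) (z : ℂ) : (triangleMidOne a b z).re =
    Real.cos (Real.pi * (b - a)) -
      2 * Real.sin (Real.pi * a) * (solMid' a b z / solOne a b z).im := by
  rw [triangleMidOne, ← rot_sub, rot_sub_inv, add_re, rot_re, mul_assoc, re_ofReal_mul, I_mul_re,
    ← neg_sub b a, mul_neg, Real.cos_neg]
  ring

/-- The real part of `solNeg` tends to infinity and controls its imaginary part through `K = tan (π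
* a)`, while `1 / solOne` tends to the positive real number `1 / o`. Hence the real part of the
quotient is at least `(solNeg).re` times a factor tending to `1 / o`. -/
theorem triangleMap_tendsto_cusp (h : TriangleParams a b) :
    Tendsto (triangleMap a b) (𝓝[upperHalf] 0) atCusp := by
  have hsin := sin_pi_mul_pos h.pos (by linarith [h.a_lt])
  have hcos : 0 < Real.cos (Real.pi * a) := Real.cos_pos_of_mem_Ioo
    ⟨by nlinarith [Real.pi_pos, h.pos], by nlinarith [Real.pi_pos, h.a_lt]⟩
  set o : ℝ := betaMeanReal b (1 - b) a 1 1
  have ho : 0 < o := betaMeanReal_pos (h := fun _ => 1) h.pos.le (fun _ _ => one_pos)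
    (integrableOn_betaWeight_mul_const h.b_pos (by linarith [h.b_lt]) _) fun s _ => by linarith
  have ho' : solOne a b 0 = o := by
    simp only [o]
    rw [← betaMean_ofReal fun s hs => by linarith [hs.2], solOne]
    simp
  have tO : Tendsto (fun z => (solOne a b z)⁻¹) (𝓝[upperHalf] 0) (𝓝 ((o⁻¹ : ℝ) : ℂ)) := by
    have := (solOne_differentiableAt h.pos h.b_pos h.b_lt
      (one_sub_mem_slitPlane (z := 0) (Or.inr (by simp)))).continuousAt.tendsto
    rw [ho'] at this
    rw [ofReal_inv]
    exact (this.inv₀ (ofReal_ne_zero.2 ho.ne')).mono_left nhdsWithin_le_nhds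
  set K : ℝ := Real.sin (Real.pi * a) / Real.cos (Real.pi * a)
  have tF : Tendsto (fun z => ((solOne a b z)⁻¹).re - K * |((solOne a b z)⁻¹).im|)
      (𝓝[upperHalf] 0) (𝓝 o⁻¹) := by
    have t1 := (continuous_re.tendsto _).comp tO
    have t2 := ((continuous_im.tendsto _).comp tO).abs.const_mul K
    simpa using t1.sub t2
  have tN : Tendsto (fun z => (solNeg a b z).re) (𝓝[upperHalf] 0) atTop := by
    have t1 : Tendsto (fun z : ℂ => ‖z‖) (𝓝[upperHalf] 0) (𝓝[>] 0) := by
      refine tendsto_nhdsWithin_iff.2 ⟨?_, ?_⟩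
      · simpa using (continuous_norm.tendsto (0 : ℂ)).mono_left nhdsWithin_le_nhds
      · filter_upwards [self_mem_nhdsWithin] with z hz
        refine norm_pos_iff.2 ?_
        rintro rfl
        simp [upperHalf] at hz
    refine tendsto_atTop_mono' _ ?_
      (((tendsto_betaMeanReal_atTop h.pos h.b_pos h.b_lt).comp t1).const_mul_atTop hcos)
    filter_upwards [self_mem_nhdsWithin] with z hz
    exact re_betaMean_ge h.pos h.a_lt h.b_pos hz
  have tP := (tN.atTop_mul_pos (inv_pos.2 ho) tF).const_mul_atTop
    (by positivity : 0 < 2 * Real.sin (Real.pi * a))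
  have tQ := tendsto_atTop_add_const_left _ (-Real.sin (Real.pi * (a + b))) tP
  refine tendsto_comap_iff.2 (tendsto_atTop_mono' _ ?_ tQ)
  filter_upwards [self_mem_nhdsWithin] with z hz
  have hz' : 0 < z.im := hz
  simp only [Function.comp_apply]
  rw [triangleMap_eq_negOne h (Or.inl hz'), triangleNegOne_im, div_eq_mul_inv (solNeg a b z), mul_re]
  refine add_le_add le_rfl (mul_le_mul_of_nonneg_left ?_ (by positivity))
  have h1 : |(solNeg a b z).im| ≤ K * (solNeg a b z).re := by
    simp only [K]
    rw [div_mul_eq_mul_div, le_div_iff₀ hcos]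
    exact solNeg_im_le h hz'
  have h2 : (solNeg a b z).im * ((solOne a b z)⁻¹).im ≤
      K * (solNeg a b z).re * |((solOne a b z)⁻¹).im| := by
    refine (le_abs_self _).trans ?_
    rw [abs_mul]
    gcongr
  linarith

end Cusp

/-! ### Values on the three real intervals. -/

section Edges

variable {a b x : ℝ}

theorem solOne_ofReal (hx : x < 1) : solOne a b x = betaMeanReal b (1 - b) a 1 (1 - x) := by
  rw [solOne, ← betaMean_ofReal fun s hs => by nlinarith [hs.1, hs.2]]
  simp

theorem solNeg_ofReal (hx : 0 < x) : solNeg a b x = betaMeanReal b a a 1 x := by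
  rw [solNeg, ← betaMean_ofReal fun s hs => by nlinarith [hs.1, hs.2]]
  simp

theorem solMid_ofReal (hx : 1 < x) : solMid a b x = betaMeanReal a (1 - b) a x (x - 1) := by
  rw [solMid, ← betaMean_ofReal fun s hs => by nlinarith [hs.1, hs.2]]
  simp

theorem solMid'_ofReal (hx : x < 0) : solMid' a b x = betaMeanReal a (1 - b) a (-x) (1 - x) := by
  rw [solMid', ← betaMean_ofReal fun s hs => by nlinarith [hs.1, hs.2]]
  simp

/-- Both solutions are real here, so the quotient moves the value only vertically. Comparing
numerator and denominator with their values at `1` gives the strict bound, by `negA_mul_sin`. -/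
theorem triangleMap_Ioo (h : TriangleParams a b) (h0 : 0 < x) (h1 : x < 1) :
    (triangleMap a b x).re = Real.cos (Real.pi * (a + b)) ∧
      Real.sin (Real.pi * (a + b)) < (triangleMap a b x).im := by
  have hsa := sin_pi_mul_pos h.pos (by linarith [h.a_lt])
  have hsα := sin_pi_mul_pos (by linarith [h.pos, h.lt] : 0 < a + b) h.add_lt
  have hb := h.b_pos
  have hb1 := h.b_lt
  have hN : negA a b < betaMeanReal b a a 1 x :=
    betaMeanReal_lt (h := fun _ => x) h.pos (fun _ _ => h0)
      (integrableOn_betaWeight_mul_const hb h.pos _) (fun s hs => by nlinarith [hs.1, hs.2])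
      fun s hs => by nlinarith [hs.1, hs.2]
  have hO : betaMeanReal b (1 - b) a 1 (1 - x) < oneA a b :=
    betaMeanReal_lt (h := fun s => 1 * (1 - s)) h.pos (fun s hs => by linarith [hs.2])
      (integrableOn_betaWeight_mul_right zero_le_one hb (by linarith [h.add_lt]))
      (fun s hs => by nlinarith [hs.1, hs.2]) fun s hs => by nlinarith [hs.1, hs.2]
  have hO0 : 0 < betaMeanReal b (1 - b) a 1 (1 - x) :=
    betaMeanReal_pos (h := fun s => 1 * (1 - s)) h.pos.le (fun s hs => by linarith [hs.2])
      (integrableOn_betaWeight_mul_right zero_le_one hb (by linarith [h.add_lt]))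
      fun s hs => by nlinarith [hs.1, hs.2]
  rw [triangleMap_eq_negOne h (Or.inr ⟨by simpa using h0.le, by simpa using h1.le⟩),
    triangleNegOne_re, triangleNegOne_im, solNeg_ofReal h0, solOne_ofReal h1, ← ofReal_div, ofReal_im,
    ofReal_re]
  refine ⟨by ring, ?_⟩
  have key : Real.sin (Real.pi * (a + b)) <
      Real.sin (Real.pi * a) * (betaMeanReal b a a 1 x / betaMeanReal b (1 - b) a 1 (1 - x)) := by
    rw [← mul_div_assoc, lt_div_iff₀ hO0]
    have e := negA_mul_sin h
    have e1 := mul_lt_mul_of_pos_left hN hsa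
    have e2 := mul_lt_mul_of_pos_left hO hsα
    linarith
  linarith

/-- The comparison is now with the leading coefficients at `∞`, scaled by `(1 - x) ^ (-a)`; this
common factor cancels in the quotient. -/
theorem triangleMap_Iio (h : TriangleParams a b) (h0 : x < 0) :
    (triangleMap a b x).re = Real.cos (Real.pi * (b - a)) ∧
      Real.sin (Real.pi * (b - a)) < (triangleMap a b x).im := by
  have hsa := sin_pi_mul_pos h.pos (by linarith [h.a_lt])
  have hsβ := sin_pi_mul_pos (by linarith [h.lt] : 0 < b - a) (by linarith [h.pos, h.add_lt])
  have hb := h.b_pos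
  have hb1 := h.b_lt
  have hκ : 0 < (1 - x) ^ (-a) := Real.rpow_pos_of_pos (by linarith) _
  have hM : (1 - x) ^ (-a) * midB a b < betaMeanReal a (1 - b) a (-x) (1 - x) := by
    rw [midB, ← betaMeanReal_mul (by linarith) fun s hs => by linarith [hs.2]]
    exact betaMeanReal_lt (h := fun _ => -x) h.pos (fun _ _ => by linarith)
      (integrableOn_betaWeight_mul_const h.pos (by linarith) _)
      (fun s hs => by nlinarith [hs.1, hs.2]) fun s hs => by nlinarith [hs.1, hs.2]
  have hO : betaMeanReal b (1 - b) a 1 (1 - x) < (1 - x) ^ (-a) * oneB a b := by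
    rw [oneB, ← betaMeanReal_mul (by linarith) fun s hs => by linarith [hs.1]]
    exact betaMeanReal_lt (h := fun s => (1 - x) * s) h.pos
      (fun s hs => mul_pos (by linarith) hs.1)
      (integrableOn_betaWeight_mul_left (by linarith) (by linarith [h.lt]) (by linarith))
      (fun s hs => by linarith) fun s hs => by nlinarith [hs.1, hs.2]
  have hO0 : 0 < betaMeanReal b (1 - b) a 1 (1 - x) :=
    betaMeanReal_pos (h := fun _ => 1) h.pos.le (fun _ _ => one_pos)
      (integrableOn_betaWeight_mul_const hb (by linarith) _)
      fun s hs => by nlinarith [hs.1, hs.2]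
  rw [triangleMap_eq_midOne h (Or.inr (by simpa using h0)), triangleMidOne_re, triangleMidOne_im,
    solMid'_ofReal h0, solOne_ofReal (by linarith), ← ofReal_div, ofReal_im, ofReal_re]
  refine ⟨by ring, ?_⟩
  have key : Real.sin (Real.pi * (b - a)) < Real.sin (Real.pi * a) *
      (betaMeanReal a (1 - b) a (-x) (1 - x) / betaMeanReal b (1 - b) a 1 (1 - x)) := by
    rw [← mul_div_assoc, lt_div_iff₀ hO0]
    have e := congrArg (fun t => (1 - x) ^ (-a) * t) (midB_mul_sin h)
    have e1 := mul_lt_mul_of_pos_left hM hsa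
    have e2 := mul_lt_mul_of_pos_left hO hsβ
    linarith
  linarith

/-- With real solutions the numerator is `rot a` times the conjugate of the denominator, so the
quotient is unimodular. Comparison with the data at `1` gives `hup` and comparison with the data at
`∞` gives `hlo`; together they confine the value to the open arc between the two vertices. -/
theorem triangleMap_Ioi (h : TriangleParams a b) (h1 : 1 < x) :
    ‖triangleMap a b x‖ = 1 ∧ Real.cos (Real.pi * (a + b)) < (triangleMap a b x).re ∧
      (triangleMap a b x).re < Real.cos (Real.pi * (b - a)) ∧ 0 < (triangleMap a b x).im := by
  have hsa := sin_pi_mul_pos h.pos (by linarith [h.a_lt])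
  have hsb := sin_pi_mul_pos h.b_pos h.b_lt
  have hsα := sin_pi_mul_pos (by linarith [h.pos, h.lt] : 0 < a + b) h.add_lt
  have hsβ := sin_pi_mul_pos (by linarith [h.lt] : 0 < b - a) (by linarith [h.pos, h.add_lt])
  have hb := h.b_pos
  have hb1 := h.b_lt
  have hx : 0 < x := by linarith
  have hκ : 0 < x ^ (-a) := Real.rpow_pos_of_pos hx _
  have hMA : betaMeanReal a (1 - b) a x (x - 1) < x ^ (-a) * midA a b := by
    rw [midA, ← betaMeanReal_mul hx.le fun s hs => by linarith [hs.2]]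
    exact betaMeanReal_lt (h := fun s => x * (1 - s)) h.pos
      (fun s hs => mul_pos hx (by linarith [hs.2]))
      (integrableOn_betaWeight_mul_right hx.le h.pos (by linarith [h.add_lt]))
      (fun s hs => by linarith) fun s hs => by nlinarith [hs.1, hs.2]
  have hNA : x ^ (-a) * negA a b < betaMeanReal b a a 1 x := by
    rw [negA, ← betaMeanReal_mul hx.le fun s hs => by linarith [hs.2]]
    exact betaMeanReal_lt (h := fun _ => 1) h.pos (fun _ _ => one_pos)
      (integrableOn_betaWeight_mul_const hb h.pos _) (fun s hs => by nlinarith [hs.1, hs.2])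
      fun s hs => by nlinarith [hs.1, hs.2]
  have hMB : x ^ (-a) * midB a b < betaMeanReal a (1 - b) a x (x - 1) := by
    rw [midB, ← betaMeanReal_mul hx.le fun s hs => by linarith [hs.2]]
    exact betaMeanReal_lt (h := fun _ => x - 1) h.pos (fun _ _ => by linarith)
      (integrableOn_betaWeight_mul_const h.pos (by linarith) _)
      (fun s hs => by nlinarith [hs.1, hs.2]) fun s hs => by nlinarith [hs.1, hs.2]
  have hNB : betaMeanReal b a a 1 x < x ^ (-a) * negB a b := by
    rw [negB, ← betaMeanReal_mul hx.le fun s hs => by linarith [hs.1]]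
    exact betaMeanReal_lt (h := fun s => x * s) h.pos (fun s hs => mul_pos hx hs.1)
      (integrableOn_betaWeight_mul_left hx.le (by linarith [h.lt]) h.pos)
      (fun s hs => by linarith) fun s hs => by nlinarith [hs.1, hs.2]
  have hM0 := (mul_pos hκ (midB_pos h.pos hb1)).trans hMB
  have hN0 := (mul_pos hκ (negA_pos h.pos h.lt)).trans hNA
  have hD := h.solNeg_sub_ne_zero (z := x) (Or.inr (by simpa using h1))
  rw [triangleMap_eq_negMid h (Or.inr (by simpa using h1)), triangleNegMid]
  rw [solMid_ofReal h1, solNeg_ofReal hx] at hD ⊢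
  have eA := congrArg (fun t => x ^ (-a) * t) (midA_mul_sin h)
  have eB := congrArg (fun t => x ^ (-a) * t) (midB_mul_sin' h)
  set M := betaMeanReal a (1 - b) a x (x - 1)
  set N := betaMeanReal b a a 1 x
  have hup : M * Real.sin (Real.pi * (a + b)) < N * Real.sin (Real.pi * b) := by
    have e1 := mul_lt_mul_of_pos_right hMA hsα
    have e2 := mul_lt_mul_of_pos_right hNA hsb
    linarith
  have hlo : N * Real.sin (Real.pi * (b - a)) < M * Real.sin (Real.pi * b) := by
    have e1 := mul_lt_mul_of_pos_right hMB hsb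
    have e2 := mul_lt_mul_of_pos_right hNB hsβ
    linarith
  have hconj : (starRingEnd ℂ) ((N : ℂ) - rot a * M) = N - (rot a)⁻¹ * M := by
    simp [conj_rot]
  have ha0 := rot_ne_zero a
  have hb0 := rot_ne_zero b
  have hnum : rot a * N - M = rot a * (N - (rot a)⁻¹ * M) := by field_simp
  have hD' : (N : ℂ) - (rot a)⁻¹ * M ≠ 0 := by
    rw [← hconj]; exact (map_ne_zero _).2 hD
  set D := normSq ((N : ℂ) - rot a * M)
  have hDpos : 0 < D := normSq_pos.2 hD
  have hDD : ((N : ℂ) - rot a * M) * (N - (rot a)⁻¹ * M) = D := by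
    rw [← hconj, mul_conj]
  -- Multiplication by the conjugate of the denominator gives a positive real denominator `D` and a
  -- quadratic form in `N` and `M`, whose real and imaginary parts are then compared with `k1`, ...,
  -- `k4`.
  have hval : (rot b)⁻¹ * ((rot a * N - M) / (N - rot a * M)) =
      (rot (-(b - a)) * (N ^ 2 : ℝ) - rot (-b) * (2 * N * M : ℝ) +
        rot (-(a + b)) * (M ^ 2 : ℝ)) / (D : ℝ) := by
    rw [← hDD, hnum, neg_sub, rot_sub, rot_neg, rot_neg, rot_add, ← mul_div_assoc,
      div_eq_div_iff hD (mul_ne_zero hD hD')]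
    push_cast
    field_simp
    ring
  have hDval : D = N ^ 2 - 2 * N * M * Real.cos (Real.pi * a) + M ^ 2 := by
    simp only [D]
    rw [normSq_apply]
    simp only [sub_re, sub_im, ofReal_re, ofReal_im, re_mul_ofReal, im_mul_ofReal, rot_re, rot_im]
    linear_combination M ^ 2 * Real.sin_sq_add_cos_sq (Real.pi * a)
  refine ⟨?_, ?_⟩
  · rw [norm_mul, norm_div, norm_inv, norm_rot, hnum, norm_mul, norm_rot, ← hconj, norm_conj]
    rw [one_mul, div_self (norm_ne_zero_iff.2 hD)]
    norm_num
  · rw [hval, div_ofReal_re, div_ofReal_im, lt_div_iff₀ hDpos, div_lt_iff₀ hDpos]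
    simp only [add_re, sub_re, add_im, sub_im, re_mul_ofReal, im_mul_ofReal, rot_re, rot_im, mul_neg,
      Real.cos_neg, Real.sin_neg]
    rw [hDval] at hDpos ⊢
    have cα : Real.cos (Real.pi * (a + b)) = Real.cos (Real.pi * a) * Real.cos (Real.pi * b) -
        Real.sin (Real.pi * a) * Real.sin (Real.pi * b) := by rw [mul_add, Real.cos_add]
    have sα : Real.sin (Real.pi * (a + b)) = Real.sin (Real.pi * a) * Real.cos (Real.pi * b) +
        Real.cos (Real.pi * a) * Real.sin (Real.pi * b) := by rw [mul_add, Real.sin_add]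
    have cβ : Real.cos (Real.pi * (b - a)) = Real.cos (Real.pi * b) * Real.cos (Real.pi * a) +
        Real.sin (Real.pi * b) * Real.sin (Real.pi * a) := by rw [mul_sub, Real.cos_sub]
    have sβ : Real.sin (Real.pi * (b - a)) = Real.sin (Real.pi * b) * Real.cos (Real.pi * a) -
        Real.cos (Real.pi * b) * Real.sin (Real.pi * a) := by rw [mul_sub, Real.sin_sub]
    have hsq := Real.sin_sq_add_cos_sq (Real.pi * a)
    have k1 := mul_pos (mul_pos hN0 hsa) (sub_pos.2 hup)
    have k2 := mul_pos (mul_pos hM0 hsa) (sub_pos.2 hlo)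
    have k3 := mul_pos hM0 (sub_pos.2 hup)
    have k4 := mul_pos hN0 (sub_pos.2 hlo)
    refine ⟨?_, ?_, div_pos ?_ hDpos⟩
    · rw [← sub_pos]
      refine lt_of_lt_of_eq (mul_pos two_pos k1) ?_
      rw [sα, cα, cβ]
      linear_combination (-2 * N * M * Real.cos (Real.pi * b)) * hsq
    · rw [← sub_pos]
      refine lt_of_lt_of_eq (mul_pos two_pos k2) ?_
      rw [sβ, cα, cβ]
      linear_combination (2 * N * M * Real.cos (Real.pi * b)) * hsq
    · linarith

end Edges

/-! ### Topology of the cusped triangle. -/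

section Region

/-- The open circular triangle with a cusp at `i∞`, bounded by two vertical lines and the unit
circle. -/
def cuspRegion (c d : ℝ) : Set ℂ := {τ | 0 < τ.im ∧ c < τ.re ∧ τ.re < d ∧ 1 < ‖τ‖}

/-- The circular triangle together with its sides. -/
def closedCuspRegion (c d : ℝ) : Set ℂ := {τ | 0 < τ.im ∧ c ≤ τ.re ∧ τ.re ≤ d ∧ 1 ≤ ‖τ‖}

variable {c d : ℝ}

theorem isOpen_cuspRegion (c d : ℝ) : IsOpen (cuspRegion c d) :=
  (isOpen_lt continuous_const continuous_im).inter ((isOpen_lt continuous_const continuous_re).inter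
    ((isOpen_lt continuous_re continuous_const).inter (isOpen_lt continuous_const continuous_norm)))

theorem one_lt_norm_iff {τ : ℂ} : 1 < ‖τ‖ ↔ 1 < τ.re ^ 2 + τ.im ^ 2 := by
  rw [← one_lt_sq_iff₀ (norm_nonneg τ), ← normSq_eq_norm_sq, normSq_apply, sq, sq]

/-- Coordinates are the abscissa and the height above the unit circle. The real square root of a
negative number is `0`, so the same formula is correct when the abscissa exceeds `1` in absolute
value. -/
theorem cuspRegion_eq_image (c d : ℝ) : cuspRegion c d =
    (fun p : ℝ × ℝ => (p.1 : ℂ) + ((√(1 - p.1 ^ 2) + p.2 : ℝ) : ℂ) * I) '' (Ioo c d ×ˢ Ioi 0) := by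
  ext τ
  constructor
  · rintro ⟨h0, hc, hd, hn⟩
    rw [one_lt_norm_iff] at hn
    refine ⟨(τ.re, τ.im - √(1 - τ.re ^ 2)), ⟨⟨hc, hd⟩, ?_⟩, ?_⟩
    · refine mem_Ioi.2 (sub_pos.2 ?_)
      rw [Real.sqrt_lt' h0]; linarith
    · apply Complex.ext <;> simp
  · rintro ⟨⟨x, t⟩, ⟨⟨hc, hd⟩, ht⟩, rfl⟩
    have ht' : 0 < t := ht
    have hs := Real.sqrt_nonneg (1 - x ^ 2)
    have h1 : (√(1 - x ^ 2)) ^ 2 ≥ 1 - x ^ 2 := by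
      rcases le_total 0 (1 - x ^ 2) with h | h
      · rw [Real.sq_sqrt h]
      · exact h.trans (sq_nonneg _)
    refine ⟨?_, ?_, ?_, ?_⟩
    · simp; linarith
    · simpa using hc
    · simpa using hd
    · rw [one_lt_norm_iff]
      simp only [add_re, add_im, ofReal_re, ofReal_im, re_ofReal_mul, im_ofReal_mul, I_re, I_im]
      nlinarith

theorem isPreconnected_cuspRegion (c d : ℝ) : IsPreconnected (cuspRegion c d) := by
  rw [cuspRegion_eq_image]
  exact (isPreconnected_Ioo.prod isPreconnected_Ioi).image _ (by fun_prop)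

/-- From each point of the closed triangle a short straight path enters the interior: horizontally
towards the middle line, and upwards steeply enough to leave the circle. -/
theorem closedCuspRegion_subset_closure (hcd : c < d) :
    closedCuspRegion c d ⊆ closure (cuspRegion c d) := by
  rintro τ ⟨h0, hc, hd, hn⟩
  set m := (c + d) / 2
  -- Half the derivative of the squared norm along `v` is `τ.re * (m - τ.re) + k`; this `k` makes it
  -- positive, and dividing by `τ.im` in `v` makes the vertical contribution exactly `k`.
  set k := |τ.re * (m - τ.re)| + 1
  set v : ℂ := (m - τ.re : ℝ) + (k / τ.im : ℝ) * I
  have hv : v.re = m - τ.re ∧ v.im = k / τ.im := by simp [v]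
  have hk : 0 < k := by positivity
  have hn2 : 1 ≤ τ.re ^ 2 + τ.im ^ 2 := by
    have := one_le_pow₀ (n := 2) hn
    rwa [← normSq_eq_norm_sq, normSq_apply, ← sq, ← sq] at this
  have ht : Tendsto (fun ε : ℝ => τ + ε * v) (𝓝[>] 0) (𝓝 τ) := by
    have : Continuous fun ε : ℝ => τ + ε * v := by fun_prop
    simpa using (this.tendsto 0).mono_left nhdsWithin_le_nhds
  refine mem_closure_of_tendsto ht ?_
  filter_upwards [Ioo_mem_nhdsGT (zero_lt_one (α := ℝ))] with ε hε
  have hre : (τ + ε * v).re = τ.re + ε * (m - τ.re) := by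
    rw [add_re, re_ofReal_mul, hv.1]
  have him : (τ + ε * v).im = τ.im + ε * (k / τ.im) := by
    rw [add_im, im_ofReal_mul, hv.2]
  refine ⟨?_, ?_, ?_, ?_⟩
  · rw [him]; have := hε.1; positivity
  · rw [hre]; simp only [m]; nlinarith [hε.1, hε.2]
  · rw [hre]; simp only [m]; nlinarith [hε.1, hε.2]
  · rw [one_lt_norm_iff, hre, him]
    have h1 : τ.im * (k / τ.im) = k := by field_simp
    have h2 := neg_abs_le (τ.re * (m - τ.re))
    have h3 : 0 < τ.re * (m - τ.re) + k := by simp only [k]; linarith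
    have h4 := mul_pos hε.1 h3
    have h5 : (τ.re + ε * (m - τ.re)) ^ 2 + (τ.im + ε * (k / τ.im)) ^ 2 =
        τ.re ^ 2 + τ.im ^ 2 + 2 * (ε * (τ.re * (m - τ.re) + k)) +
          (ε * (m - τ.re)) ^ 2 + (ε * (k / τ.im)) ^ 2 := by
      linear_combination 2 * ε * h1
    rw [h5]
    nlinarith [sq_nonneg (ε * (m - τ.re)), sq_nonneg (ε * (k / τ.im))]

theorem interior_closedCuspRegion_subset (c d : ℝ) :
    interior (closedCuspRegion c d) ⊆ cuspRegion c d := by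
  intro τ hτ
  have h0 := interior_subset hτ
  have h1 : τ ∈ interior {z : ℂ | c ≤ z.re} := interior_mono (fun z hz => hz.2.1) hτ
  have h2 : τ ∈ interior {z : ℂ | z.re ≤ d} := interior_mono (fun z hz => hz.2.2.1) hτ
  have h3 : τ ∈ interior (Metric.ball (0 : ℂ) 1)ᶜ :=
    interior_mono (fun z hz => by simpa using hz.2.2.2) hτ
  rw [interior_setOfPred_le_re] at h1
  rw [interior_setOfPred_re_le] at h2
  rw [interior_compl, closure_ball _ one_ne_zero] at h3
  exact ⟨h0.1, h1, h2, by simpa using h3⟩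

theorem interior_eq_cuspRegion {S : Set ℂ} (h1 : cuspRegion c d ⊆ S) (h2 : S ⊆ closedCuspRegion c d) :
    interior S = cuspRegion c d :=
  ((interior_mono h2).trans (interior_closedCuspRegion_subset c d)).antisymm
    ((isOpen_cuspRegion c d).subset_interior_iff.2 h1)

/-- The exterior is a union of three half-planes and a disc; the lower half-plane meets each of the
other three convex sets, at `c - 1`, `d + 1` and `0`. -/
theorem isPreconnected_compl_closedCuspRegion (c d : ℝ) :
    IsPreconnected (closedCuspRegion c d)ᶜ := by
  have h : (closedCuspRegion c d)ᶜ =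
      (({z : ℂ | z.im ≤ 0} ∪ {z | z.re < c}) ∪ {z | d < z.re}) ∪ Metric.ball 0 1 := by
    ext z
    simp only [closedCuspRegion, mem_compl_iff, mem_ofPred_eq, mem_union, Metric.mem_ball,
      dist_zero_right]
    rw [not_and_or, not_and_or, not_and_or, not_lt, not_le, not_le, not_le, or_assoc, or_assoc]
  rw [h]
  have h1 := (convex_halfSpace_im_le 0).isPreconnected
  have h2 := (convex_halfSpace_re_lt c).isPreconnected
  have h3 := (convex_halfSpace_re_gt d).isPreconnected
  refine IsPreconnected.union 0 (Or.inl (Or.inl (by simp))) (by simp) ?_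
    (convex_ball 0 1).isPreconnected
  refine IsPreconnected.union ((d + 1 : ℝ) : ℂ) (Or.inl (by simp)) (by simp) ?_ h3
  exact IsPreconnected.union ((c - 1 : ℝ) : ℂ) (by simp) (by simp) h1 h2

end Region

/-! ### The image of the upper half-plane and of the intervals. -/

section Mapping

variable {a b : ℝ}

theorem triangleMap_differentiableOn (h : TriangleParams a b) :
    DifferentiableOn ℂ (triangleMap a b) cutPlane := fun _ hz =>
  (triangleMap_differentiableAt h hz).differentiableWithinAt

theorem nhdsWithin_upperHalf_neBot (x : ℝ) : (𝓝[upperHalf] (x : ℂ)).NeBot := by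
  refine mem_closure_iff_nhdsWithin_neBot.1 ?_
  rw [upperHalf, closure_setOfPred_lt_im]
  simp

/-- The open mapping theorem; a constant map is excluded by the cusp. -/
theorem isOpen_triangleMap_image (h : TriangleParams a b) : IsOpen (triangleMap a b '' upperHalf) := by
  have hd : DifferentiableOn ℂ (triangleMap a b) upperHalf :=
    (triangleMap_differentiableOn h).mono upperHalf_subset_cutPlane
  rcases (hd.analyticOnNhd isOpen_upperHalf).is_constant_or_isOpen
    (convex_halfSpace_im_gt 0).isPreconnected with ⟨w, hw⟩ | hopen
  · exfalso
    have := nhdsWithin_upperHalf_neBot 0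
    have h1 := tendsto_comap_iff.1 (triangleMap_tendsto_cusp h)
    have h2 : Tendsto (Complex.im ∘ triangleMap a b) (𝓝[upperHalf] ((0 : ℝ) : ℂ)) (𝓝 w.im) := by
      refine tendsto_const_nhds.congr' ?_
      filter_upwards [self_mem_nhdsWithin] with z hz
      simp [hw z hz]
    rw [ofReal_zero] at *
    exact not_tendsto_nhds_of_tendsto_atTop h1 _ h2
  · exact hopen _ subset_rfl isOpen_upperHalf

/-- The preimages of an approximating sequence accumulate somewhere on the closed half-plane
completed by `∞`. Accumulation at `0` is impossible, since imaginary parts would be unbounded; every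
other place gives one of the alternatives. -/
theorem mem_closure_triangleMap_image (h : TriangleParams a b) {τ : ℂ}
    (hτ : τ ∈ closure (triangleMap a b '' upperHalf)) :
    τ ∈ triangleMap a b '' upperHalf ∨ (∃ x : ℝ, x ≠ 0 ∧ x ≠ 1 ∧ triangleMap a b x = τ) ∨
      τ = rot (a + b) ∨ τ = rot (b - a) := by
  obtain ⟨w, hw, hlim⟩ := mem_closure_iff_seq_limit.1 hτ
  choose z hz hzw using hw
  set U : Ultrafilter ℂ := (Filter.hyperfilter ℕ).map z
  have hU : Tendsto (triangleMap a b) U (𝓝 τ) := by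
    refine tendsto_map'_iff.2 ?_
    have : triangleMap a b ∘ z = w := funext hzw
    rw [this]
    exact hlim.mono_left Nat.hyperfilter_le_atTop
  have hUH : upperHalf ∈ U := Ultrafilter.mem_map.2 (univ_mem' hz)
  have hUH' : (U : Filter ℂ) ≤ 𝓟 upperHalf := le_principal_iff.2 hUH
  -- An ultrafilter either contains a closed ball, and then converges by compactness, or contains
  -- the complement of every ball, and then tends to `∞`.
  by_cases hb : ∃ R : ℝ, Metric.closedBall (0 : ℂ) R ∈ U
  · obtain ⟨R, hR⟩ := hb
    obtain ⟨z₀, -, hz₀⟩ := isCompact_iff_ultrafilter_le_nhds.1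
      (isCompact_closedBall (0 : ℂ) R) U (le_principal_iff.2 hR)
    have hUz : (U : Filter ℂ) ≤ 𝓝[upperHalf] z₀ := le_inf hz₀ hUH'
    have him : 0 ≤ z₀.im := by
      by_contra! hneg
      have h1 : {z : ℂ | z.im < 0} ∈ U := hz₀ ((isOpen_lt continuous_im continuous_const).mem_nhds hneg)
      obtain ⟨y, hy1, hy2⟩ := U.nonempty_of_mem (inter_mem h1 hUH)
      exact lt_asymm (show y.im < 0 from hy1) (show 0 < y.im from hy2)
    by_cases hcut : z₀ ∈ cutPlane
    · have h1 := (triangleMap_differentiableAt h hcut).continuousAt.tendsto.mono_left hz₀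
      have h2 := tendsto_nhds_unique hU h1
      rcases him.lt_or_eq with h3 | h3
      · exact Or.inl ⟨z₀, h3, h2.symm⟩
      · have h4 : ((z₀.re : ℝ) : ℂ) = z₀ := Complex.ext (by simp) (by simpa using h3)
        refine Or.inr (Or.inl ⟨z₀.re, fun h5 => ?_, fun h5 => ?_, by rw [h4, h2]⟩)
        · exact (hcut (Or.inl h5)).ne h3
        · exact (hcut (Or.inr h5)).ne h3
    · simp only [cutPlane, mem_ofPred_eq, Classical.not_imp, not_lt] at hcut
      have h0 := le_antisymm hcut.2 him
      rcases hcut.1 with h1 | h1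
      · have h2 : z₀ = 0 := Complex.ext h1 h0
        rw [h2] at hUz
        have h3 := tendsto_comap_iff.1 ((triangleMap_tendsto_cusp h).mono_left hUz)
        exact absurd ((continuous_im.tendsto τ).comp hU) (not_tendsto_nhds_of_tendsto_atTop h3 _)
      · have h2 : z₀ = 1 := Complex.ext h1 h0
        rw [h2] at hUz
        exact Or.inr (Or.inr (Or.inl
          (tendsto_nhds_unique hU ((triangleMap_tendsto_one h).mono_left hUz))))
  · push Not at hb
    have hcob : (U : Filter ℂ) ≤ Bornology.cobounded ℂ := by
      rw [(Metric.hasBasis_cobounded_compl_closedBall (0 : ℂ)).ge_iff]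
      intro R _
      exact Ultrafilter.compl_mem_iff_notMem.2 (hb R)
    exact Or.inr (Or.inr (Or.inr (tendsto_nhds_unique hU
      ((triangleMap_tendsto_infty h).mono_left (le_inf hcob hUH')))))

theorem cos_lt_cos_params (h : TriangleParams a b) :
    Real.cos (Real.pi * (a + b)) < Real.cos (Real.pi * (b - a)) := by
  have hpi := Real.pi_pos
  have h1 := h.pos
  have h2 := h.lt
  have h3 := h.add_lt
  exact Real.cos_lt_cos_of_nonneg_of_le_pi (by nlinarith) (by nlinarith) (by nlinarith)

/-- The region onto which the Schwarz map sends the upper half-plane. -/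
def paramRegion (a b : ℝ) : Set ℂ :=
  cuspRegion (Real.cos (Real.pi * (a + b))) (Real.cos (Real.pi * (b - a)))

/-- The region of the Schwarz map together with its sides. -/
def closedParamRegion (a b : ℝ) : Set ℂ :=
  closedCuspRegion (Real.cos (Real.pi * (a + b))) (Real.cos (Real.pi * (b - a)))

theorem one_lt_norm_of_sin_lt {τ : ℂ} {θ : ℝ} (hre : τ.re = Real.cos θ) (hs : 0 ≤ Real.sin θ)
    (him : Real.sin θ < τ.im) : 1 < ‖τ‖ := by
  rw [one_lt_norm_iff, hre]
  nlinarith [Real.sin_sq_add_cos_sq θ]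

theorem triangleMap_ofReal_mem (h : TriangleParams a b) {x : ℝ} (h0 : x ≠ 0) (h1 : x ≠ 1) :
    triangleMap a b x ∈ closedParamRegion a b \ paramRegion a b := by
  have hsα := sin_pi_mul_pos (by linarith [h.pos, h.lt] : 0 < a + b) h.add_lt
  have hsβ := sin_pi_mul_pos (by linarith [h.lt] : 0 < b - a) (by linarith [h.pos, h.add_lt])
  have hcos := cos_lt_cos_params h
  rcases h0.lt_or_gt with hx | hx
  · obtain ⟨e1, e2⟩ := triangleMap_Iio h hx
    exact ⟨⟨hsβ.trans e2, e1 ▸ hcos.le, e1.le, (one_lt_norm_of_sin_lt e1 hsβ.le e2).le⟩,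
      fun hm => hm.2.2.1.ne e1⟩
  · rcases h1.lt_or_gt with hx1 | hx1
    · obtain ⟨e1, e2⟩ := triangleMap_Ioo h hx hx1
      exact ⟨⟨hsα.trans e2, e1.ge, e1 ▸ hcos.le, (one_lt_norm_of_sin_lt e1 hsα.le e2).le⟩,
        fun hm => hm.2.1.ne' e1⟩
    · obtain ⟨e1, e2, e3, e4⟩ := triangleMap_Ioi h hx1
      exact ⟨⟨e4, e2.le, e3.le, e1.ge⟩, fun hm => hm.2.2.2.ne' e1⟩

theorem rot_add_mem (h : TriangleParams a b) :
    rot (a + b) ∈ closedParamRegion a b \ paramRegion a b := by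
  have hsα := sin_pi_mul_pos (by linarith [h.pos, h.lt] : 0 < a + b) h.add_lt
  exact ⟨⟨by rwa [rot_im], (rot_re _).ge, (rot_re _).trans_le (cos_lt_cos_params h).le,
    (norm_rot _).ge⟩, fun hm => hm.2.2.2.ne' (norm_rot _)⟩

theorem rot_sub_mem (h : TriangleParams a b) :
    rot (b - a) ∈ closedParamRegion a b \ paramRegion a b := by
  have hsβ := sin_pi_mul_pos (by linarith [h.lt] : 0 < b - a) (by linarith [h.pos, h.add_lt])
  exact ⟨⟨by rwa [rot_im], (cos_lt_cos_params h).le.trans (rot_re _).ge, (rot_re _).le,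
    (norm_rot _).ge⟩, fun hm => hm.2.2.2.ne' (norm_rot _)⟩

theorem mem_image_or_boundary (h : TriangleParams a b) {τ : ℂ}
    (hτ : τ ∈ closure (triangleMap a b '' upperHalf)) :
    τ ∈ triangleMap a b '' upperHalf ∨ τ ∈ closedParamRegion a b \ paramRegion a b := by
  rcases mem_closure_triangleMap_image h hτ with h1 | ⟨x, h0, h1, rfl⟩ | rfl | rfl
  · exact Or.inl h1
  · exact Or.inr (triangleMap_ofReal_mem h h0 h1)
  · exact Or.inr (rot_add_mem h)
  · exact Or.inr (rot_sub_mem h)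

/-- This value would require a zero of `solNeg`, the numerator of the quotient. -/
theorem triangleMap_ne_rot (h : TriangleParams a b) {z : ℂ} (hz : z ∈ upperHalf) :
    triangleMap a b z ≠ rot (-(a + b)) := by
  have hz' : 0 < z.im := hz
  rw [triangleMap_eq_negOne h (Or.inl hz'), triangleNegOne, rot_neg, rot_add, ne_eq, add_eq_left]
  refine mul_ne_zero ?_ (div_ne_zero ?_ (h.solOne_ne_zero (Or.inl hz')))
  · have := sin_pi_mul_pos h.pos (by linarith [h.a_lt])
    rw [rot_sub_inv]
    exact mul_ne_zero (ofReal_ne_zero.2 (by positivity)) I_ne_zero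
  · exact solNeg_ne_zero h.pos h.a_lt h.b_pos (Or.inr hz'.ne')

/-- A connected set that meets the open image but none of its frontier lies inside the image. For
the exterior this is impossible because of the omitted value `rot (-(a + b))`, which lies in the
lower half-plane; for the open triangle it gives surjectivity. -/
theorem triangleMap_image_upperHalf (h : TriangleParams a b) :
    triangleMap a b '' upperHalf = paramRegion a b := by
  have hopen := isOpen_triangleMap_image h
  have hsub : triangleMap a b '' upperHalf ⊆ closedParamRegion a b := by
    by_contra hcon
    obtain ⟨τ, hτ, hτ'⟩ := not_subset.1 hcon
    have hE : (closedParamRegion a b)ᶜ ⊆ triangleMap a b '' upperHalf := by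
      refine (isPreconnected_compl_closedCuspRegion _ _).subset_of_closure_inter_subset hopen
        ⟨τ, hτ', hτ⟩ ?_
      rintro σ ⟨h1, h2⟩
      exact (mem_image_or_boundary h h1).resolve_right fun h3 => h2 h3.1
    have hp : rot (-(a + b)) ∈ (closedParamRegion a b)ᶜ := by
      intro hm
      have h1 := hm.1
      have hsα := sin_pi_mul_pos (by linarith [h.pos, h.lt] : 0 < a + b) h.add_lt
      rw [rot_im, mul_neg, Real.sin_neg] at h1
      linarith
    obtain ⟨z, hz, hzp⟩ := hE hp
    exact triangleMap_ne_rot h hz hzp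
  have hsub' : triangleMap a b '' upperHalf ⊆ paramRegion a b :=
    (hopen.subset_interior_iff.2 hsub).trans (interior_closedCuspRegion_subset _ _)
  refine hsub'.antisymm ?_
  refine (isPreconnected_cuspRegion _ _).subset_of_closure_inter_subset hopen ?_ ?_
  · have hI : I ∈ upperHalf := by simp [upperHalf]
    exact ⟨_, hsub' (mem_image_of_mem _ hI), mem_image_of_mem _ hI⟩
  · rintro σ ⟨h1, h2⟩
    exact (mem_image_or_boundary h h1).resolve_right fun h3 => h3.2 h2

/-- Each side lies in the closure of the open triangle, which is the image, so its points come from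
the real line or are vertices. In the next three theorems the interval is identified by exclusion,
because the three intervals have values on disjoint open sides. -/
theorem exists_real_of_mem_boundary (h : TriangleParams a b) {τ : ℂ}
    (hτ : τ ∈ closedParamRegion a b \ paramRegion a b) (h1 : τ ≠ rot (a + b)) (h2 : τ ≠ rot (b - a)) :
    ∃ x : ℝ, x ≠ 0 ∧ x ≠ 1 ∧ triangleMap a b x = τ := by
  have hcl := closedCuspRegion_subset_closure (cos_lt_cos_params h) hτ.1
  rw [show cuspRegion _ _ = triangleMap a b '' upperHalf from
    (triangleMap_image_upperHalf h).symm] at hcl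
  rcases mem_closure_triangleMap_image h hcl with h3 | h3 | h3 | h3
  · rw [triangleMap_image_upperHalf h] at h3
    exact absurd h3 hτ.2
  · exact h3
  · exact absurd h3 h1
  · exact absurd h3 h2

theorem triangleMap_image_Ioo (h : TriangleParams a b) :
    (fun x : ℝ => triangleMap a b x) '' Ioo 0 1 =
      {τ | τ.re = Real.cos (Real.pi * (a + b)) ∧ Real.sin (Real.pi * (a + b)) < τ.im} := by
  have hsα := sin_pi_mul_pos (by linarith [h.pos, h.lt] : 0 < a + b) h.add_lt
  have hcos := cos_lt_cos_params h
  refine Subset.antisymm ?_ ?_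
  · rintro _ ⟨x, hx, rfl⟩
    exact triangleMap_Ioo h hx.1 hx.2
  · rintro τ ⟨h1, h2⟩
    have hn := one_lt_norm_of_sin_lt h1 hsα.le h2
    obtain ⟨x, hx0, hx1, rfl⟩ := exists_real_of_mem_boundary h (τ := τ)
      ⟨⟨hsα.trans h2, h1.ge, h1 ▸ hcos.le, hn.le⟩, fun hm => hm.2.1.ne' h1⟩
      (by rintro rfl; exact hn.ne' (norm_rot _)) (by rintro rfl; exact hn.ne' (norm_rot _))
    refine ⟨x, ⟨?_, ?_⟩, rfl⟩
    · by_contra! hx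
      exact hcos.ne (h1.symm.trans (triangleMap_Iio h (lt_of_le_of_ne hx hx0)).1)
    · by_contra! hx
      exact hn.ne' (triangleMap_Ioi h (lt_of_le_of_ne hx hx1.symm)).1

theorem triangleMap_image_Iio (h : TriangleParams a b) :
    (fun x : ℝ => triangleMap a b x) '' Iio 0 =
      {τ | τ.re = Real.cos (Real.pi * (b - a)) ∧ Real.sin (Real.pi * (b - a)) < τ.im} := by
  have hsβ := sin_pi_mul_pos (by linarith [h.lt] : 0 < b - a) (by linarith [h.pos, h.add_lt])
  have hcos := cos_lt_cos_params h
  refine Subset.antisymm ?_ ?_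
  · rintro _ ⟨x, hx, rfl⟩
    exact triangleMap_Iio h hx
  · rintro τ ⟨h1, h2⟩
    have hn := one_lt_norm_of_sin_lt h1 hsβ.le h2
    obtain ⟨x, hx0, hx1, rfl⟩ := exists_real_of_mem_boundary h (τ := τ)
      ⟨⟨hsβ.trans h2, h1 ▸ hcos.le, h1.le, hn.le⟩, fun hm => hm.2.2.1.ne h1⟩
      (by rintro rfl; exact hn.ne' (norm_rot _)) (by rintro rfl; exact hn.ne' (norm_rot _))
    refine ⟨x, ?_, rfl⟩
    by_contra hx
    have hx' : 0 < x := lt_of_le_of_ne (not_lt.1 hx) hx0.symm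
    rcases hx1.lt_or_gt with hx1 | hx1
    · exact hcos.ne ((triangleMap_Ioo h hx' hx1).1.symm.trans h1)
    · exact hn.ne' (triangleMap_Ioi h hx1).1

theorem triangleMap_image_Ioi (h : TriangleParams a b) :
    (fun x : ℝ => triangleMap a b x) '' Ioi 1 =
      {τ | 0 < τ.im ∧ ‖τ‖ = 1 ∧ Real.cos (Real.pi * (a + b)) < τ.re ∧
        τ.re < Real.cos (Real.pi * (b - a))} := by
  refine Subset.antisymm ?_ ?_
  · rintro _ ⟨x, hx, rfl⟩
    obtain ⟨e1, e2, e3, e4⟩ := triangleMap_Ioi h hx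
    exact ⟨e4, e1, e2, e3⟩
  · rintro τ ⟨h0, hn, h1, h2⟩
    obtain ⟨x, hx0, hx1, rfl⟩ := exists_real_of_mem_boundary h (τ := τ)
      ⟨⟨h0, h1.le, h2.le, hn.ge⟩, fun hm => hm.2.2.2.ne' hn⟩
      (by rintro rfl; exact h1.ne' (rot_re _)) (by rintro rfl; exact h2.ne (rot_re _))
    refine ⟨x, ?_, rfl⟩
    by_contra hx
    have hx' : x < 1 := lt_of_le_of_ne (not_lt.1 hx) hx1
    rcases hx0.lt_or_gt with hx0 | hx0
    · exact h2.ne (triangleMap_Iio h hx0).1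
    · exact h1.ne' (triangleMap_Ioo h hx0 hx').1

end Mapping

/-! ### Uniqueness of the continuation and its local expression. -/

section Continuation

theorem isOpen_cutPlane : IsOpen cutPlane := by
  have : cutPlane = upperHalf ∪ ({z : ℂ | z.re ≠ 0} ∩ {z | z.re ≠ 1}) := by
    ext z
    simp only [cutPlane, upperHalf, mem_union, mem_inter_iff, mem_ofPred_eq]
    tauto
  rw [this]
  exact isOpen_upperHalf.union ((isOpen_ne_fun continuous_re continuous_const).inter
    (isOpen_ne_fun continuous_re continuous_const))

theorem isPreconnected_cutPlane : IsPreconnected cutPlane := by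
  have : cutPlane = ((upperHalf ∪ {z : ℂ | z.re < 0}) ∪ {z | 1 < z.re}) ∪
      ({z | 0 < z.re} ∩ {z | z.re < 1}) := by
    ext z
    simp only [cutPlane, upperHalf, mem_union, mem_inter_iff, mem_ofPred_eq]
    constructor
    · intro h
      by_contra! hcon
      obtain ⟨⟨⟨h1, h2⟩, h3⟩, h4⟩ := hcon
      rcases h2.eq_or_lt with h5 | h5
      · exact absurd (h (Or.inl h5.symm)) (not_lt.2 h1)
      · exact absurd (h (Or.inr (le_antisymm h3 (h4 h5)))) (not_lt.2 h1)
    · rintro (((h | h) | h) | ⟨h, h'⟩) (h0 | h0) <;> first | exact h | linarith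
  rw [this]
  have h0 : IsPreconnected upperHalf := (convex_halfSpace_im_gt 0).isPreconnected
  have h1 := (convex_halfSpace_re_lt 0).isPreconnected
  have h2 := (convex_halfSpace_re_gt 1).isPreconnected
  have h3 := ((convex_halfSpace_re_gt 0).inter (convex_halfSpace_re_lt 1)).isPreconnected
  refine IsPreconnected.union ⟨1 / 2, 1⟩ (Or.inl (Or.inl (by simp [upperHalf])))
    ⟨by norm_num, by norm_num⟩ ?_ h3
  refine IsPreconnected.union ⟨2, 1⟩ (Or.inl (by simp [upperHalf])) (by simp) ?_ h2
  exact IsPreconnected.union ⟨-1, 1⟩ (by simp [upperHalf]) (by simp) h0 h1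

/-- The identity theorem on the connected cut plane, started at `1 / 2`, a point of the open lens.
-/
theorem IsContinuationOf.eqOn {f φ ψ : ℂ → ℂ} (h1 : IsContinuationOf f φ)
    (h2 : IsContinuationOf f ψ) : EqOn φ ψ cutPlane := by
  have hopen : IsOpen lens := (isOpen_lt continuous_norm continuous_const).inter
    (isOpen_lt (continuous_const.sub continuous_id).norm continuous_const)
  have hmem : (1 / 2 : ℂ) ∈ lens := by constructor <;> norm_num
  refine (h1.1.analyticOnNhd isOpen_cutPlane).eqOn_of_preconnected_of_eventuallyEq
    (h2.1.analyticOnNhd isOpen_cutPlane) isPreconnected_cutPlane (lens_subset_cutPlane hmem) ?_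
  filter_upwards [hopen.mem_nhds hmem] with z hz
  rw [h1.2 hz, h2.2 hz]

/-- Euler's integral for both solutions; the reflection formula evaluates `B(b, 1 - b)` as `π / sin
(π * b)`, which supplies the second sine and the denominator `π`. -/
theorem triangleMap_eq_on_lens {a b : ℝ} (h : TriangleParams a b) {z : ℂ} (hz : z ∈ lens) :
    triangleMap a b z = rot (-(a + b)) +
      ((2 * Real.sin (Real.pi * a) * Real.sin (Real.pi * b) : ℝ) : ℂ) * I *
        (betaIntegral (a : ℂ) (b : ℂ) / (Real.pi : ℂ)) *
        (ordinaryHypergeometric (a : ℂ) (b : ℂ) ((a + b : ℝ) : ℂ) (1 - z) /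
          ordinaryHypergeometric (a : ℂ) (b : ℂ) 1 z) := by
  have h0 : 0 ≤ z.re ∧ z.re ≤ 1 := by
    have e1 := (abs_le.1 ((abs_re_le_norm z).trans hz.1.le)).2
    have e2 := (abs_le.1 ((abs_re_le_norm (1 - z)).trans hz.2.le)).2
    rw [sub_re, one_re] at e2
    exact ⟨by linarith, e1⟩
  have hsb := (sin_pi_mul_pos h.b_pos h.b_lt).ne'
  have e1 : solOne a b z = (Real.pi / Real.sin (Real.pi * b) : ℝ) *
      ordinaryHypergeometric (a : ℂ) (b : ℂ) 1 z := by
    rw [solOne, betaMean_eq_hypergeometric h.b_pos (by linarith [h.b_lt]) hz.1,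
      betaIntegral_eq_Gamma_mul_div _ _ (by simpa using h.b_pos) (by simpa using h.b_lt)]
    have := Complex.Gamma_mul_Gamma_one_sub (b : ℂ)
    push_cast
    rw [add_sub_cancel, Complex.Gamma_one, div_one, this]
  have e2 : solNeg a b z = betaIntegral (a : ℂ) (b : ℂ) *
      ordinaryHypergeometric (a : ℂ) (b : ℂ) ((a + b : ℝ) : ℂ) (1 - z) := by
    have := betaMean_eq_hypergeometric (a := a) h.b_pos h.pos hz.2
    rw [sub_sub_cancel] at this
    rw [solNeg, this, betaIntegral_symm, add_comm b a]
  rw [triangleMap_eq_negOne h (Or.inr h0), triangleNegOne, ← rot_add, ← rot_neg, rot_sub_inv, e1, e2]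
  have hsb' : ((Real.sin (Real.pi * b) : ℝ) : ℂ) ≠ 0 := ofReal_ne_zero.2 hsb
  have hpi : (Real.pi : ℂ) ≠ 0 := ofReal_ne_zero.2 Real.pi_ne_zero
  rw [ofReal_div, ofReal_mul, ofReal_mul, ofReal_mul, mul_div_mul_comm]
  field_simp

end Continuation

/-! ### The two parameter pairs `(1/6, 1/2)` and `(1/12, 5/12)`. -/

section Specialisation

theorem triangleParams_one : TriangleParams (1 / 6) (1 / 2) := by
  constructor <;> norm_num

theorem triangleParams_two : TriangleParams (1 / 12) (5 / 12) := by
  constructor <;> norm_num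

theorem cos_pi_mul_third : Real.cos (Real.pi * (1 / 3)) = 1 / 2 := by
  rw [mul_one_div, Real.cos_pi_div_three]

theorem sin_pi_mul_third : Real.sin (Real.pi * (1 / 3)) = √3 / 2 := by
  rw [mul_one_div, Real.sin_pi_div_three]

theorem cos_pi_mul_two_thirds : Real.cos (Real.pi * (2 / 3)) = -(1 / 2) := by
  rw [show Real.pi * (2 / 3) = Real.pi - Real.pi * (1 / 3) by ring, Real.cos_pi_sub,
    cos_pi_mul_third]

theorem sin_pi_mul_two_thirds : Real.sin (Real.pi * (2 / 3)) = √3 / 2 := by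
  rw [show Real.pi * (2 / 3) = Real.pi - Real.pi * (1 / 3) by ring, Real.sin_pi_sub,
    sin_pi_mul_third]

theorem rot_two_thirds : rot (2 / 3) = omega := by
  apply Complex.ext
  · rw [rot_re, cos_pi_mul_two_thirds, omega]; norm_num
  · rw [rot_im, sin_pi_mul_two_thirds, omega]; norm_num

theorem rot_neg_two_thirds : rot (-(2 / 3)) = omega ^ 2 := by
  rw [← rot_two_thirds, sq, ← rot_add, show (2 / 3 + 2 / 3 : ℝ) = -(2 / 3) + 2 by norm_num, rot_add]
  have : rot 2 = 1 := by
    rw [rot, ← exp_two_pi_mul_I]; congr 1; push_cast; ring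
  rw [this, mul_one]

theorem rot_third : rot (1 / 3) = -omega ^ 2 := by
  rw [← rot_neg_two_thirds, show (1 / 3 : ℝ) = -(2 / 3) + 1 by norm_num, rot_add]
  have : rot 1 = -1 := by
    rw [rot, ← exp_pi_mul_I]; congr 1; push_cast; ring
  rw [this]; ring

theorem rot_half : rot (1 / 2) = I := by
  rw [rot, mul_one_div]
  push_cast
  exact exp_pi_div_two_mul_I

/-- The coefficient of the quotient in the local expression is thus the width of the triangle: `1`
for the first pair and `1 / 2` for the second, as in `schwarzLocal₁` and `schwarzLocal₂`. -/
theorem two_mul_sin_mul_sin (a b : ℝ) : 2 * Real.sin (Real.pi * a) * Real.sin (Real.pi * b) =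
    Real.cos (Real.pi * (b - a)) - Real.cos (Real.pi * (a + b)) := by
  rw [mul_sub, mul_add, Real.cos_sub, Real.cos_add]; ring

theorem isContinuationOf_triangleMap {a b : ℝ} (h : TriangleParams a b) {f : ℂ → ℂ}
    (hf : EqOn (triangleMap a b) f lens) : IsContinuationOf f (triangleMap a b) :=
  ⟨triangleMap_differentiableOn h, hf⟩

theorem triangleMap_eqOn_schwarzLocal₁ : EqOn (triangleMap (1 / 6) (1 / 2)) schwarzLocal₁ lens := by
  intro z hz
  have e1 : (1 / 6 + 1 / 2 : ℝ) = 2 / 3 := by norm_num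
  have e2 : (1 / 2 - 1 / 6 : ℝ) = 1 / 3 := by norm_num
  have e3 : ((1 / 2 - -(1 / 2) : ℝ) : ℂ) = 1 := by norm_num
  rw [triangleMap_eq_on_lens triangleParams_one hz, two_mul_sin_mul_sin, e1, e2,
    cos_pi_mul_third, cos_pi_mul_two_thirds, rot_neg_two_thirds, e3, one_mul, schwarzLocal₁]
  push_cast
  rfl

theorem triangleMap_eqOn_schwarzLocal₂ : EqOn (triangleMap (1 / 12) (5 / 12)) schwarzLocal₂ lens := by
  intro z hz
  have e1 : (1 / 12 + 5 / 12 : ℝ) = 1 / 2 := by norm_num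
  have e2 : (5 / 12 - 1 / 12 : ℝ) = 1 / 3 := by norm_num
  rw [triangleMap_eq_on_lens triangleParams_two hz, two_mul_sin_mul_sin, e1, e2, mul_one_div _ 2,
    Real.cos_pi_div_two, cos_pi_mul_third, rot_neg, rot_half, inv_I, schwarzLocal₂]
  push_cast
  ring

theorem paramRegion_one : paramRegion (1 / 6) (1 / 2) = cuspRegion (-(1 / 2)) (1 / 2) := by
  rw [paramRegion, show (1 / 6 + 1 / 2 : ℝ) = 2 / 3 by norm_num,
    show (1 / 2 - 1 / 6 : ℝ) = 1 / 3 by norm_num, cos_pi_mul_third, cos_pi_mul_two_thirds]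

theorem paramRegion_two : paramRegion (1 / 12) (5 / 12) = cuspRegion 0 (1 / 2) := by
  rw [paramRegion, show (1 / 12 + 5 / 12 : ℝ) = 1 / 2 by norm_num,
    show (5 / 12 - 1 / 12 : ℝ) = 1 / 3 by norm_num, cos_pi_mul_third, mul_one_div,
    Real.cos_pi_div_two]

theorem interior_fundDomain : interior fundDomain = cuspRegion (-(1 / 2)) (1 / 2) := by
  refine interior_eq_cuspRegion (fun τ h => Or.inl ⟨h.1, h.2.1, h.2.2.1.le, h.2.2.2⟩) ?_
  rintro τ (⟨h0, h1, h2, h3⟩ | ⟨h0, h1, h2, h3⟩)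
  · exact ⟨h0, h1.le, h2, h3.le⟩
  · exact ⟨h0, by linarith, h3, h1.ge⟩

theorem interior_right_half_fundDomain :
    interior {τ ∈ fundDomain | 0 ≤ τ.re} = cuspRegion 0 (1 / 2) := by
  refine interior_eq_cuspRegion
    (fun τ h => ⟨Or.inl ⟨h.1, by linarith [h.2.1], h.2.2.1.le, h.2.2.2⟩, h.2.1.le⟩) ?_
  rintro τ ⟨⟨h0, h1, h2, h3⟩ | ⟨h0, h1, h2, h3⟩, h4⟩
  · exact ⟨h0, h4, h2, h3.le⟩
  · exact ⟨h0, h4, h3, h1.ge⟩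

end Specialisation

/-! ### The theorem, transferred from `triangleMap` to every continuation. -/

theorem mainTheorem9 :
    ((∃ φ, IsContinuationOf schwarzLocal₁ φ) ∧
      ∀ φ, IsContinuationOf schwarzLocal₁ φ →
        φ '' upperHalf = {τ : ℂ | 0 < τ.im ∧ -(1 / 2) < τ.re ∧ τ.re < 1 / 2 ∧ 1 < ‖τ‖} ∧
        φ '' upperHalf = interior fundDomain ∧
        Tendsto φ (𝓝[upperHalf] 0) atCusp ∧
        Tendsto φ (𝓝[upperHalf] 1) (𝓝 omega) ∧
        Tendsto φ (Bornology.cobounded ℂ ⊓ 𝓟 upperHalf) (𝓝 (-omega ^ 2)) ∧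
        (fun x : ℝ => φ x) '' Ioo 0 1 =
          {τ : ℂ | 0 < τ.im ∧ τ.re = -(1 / 2) ∧ Real.sqrt 3 / 2 < τ.im} ∧
        (fun x : ℝ => φ x) '' Iio 0 =
          {τ : ℂ | 0 < τ.im ∧ τ.re = 1 / 2 ∧ Real.sqrt 3 / 2 < τ.im} ∧
        (fun x : ℝ => φ x) '' Ioi 1 =
          {τ : ℂ | 0 < τ.im ∧ ‖τ‖ = 1 ∧ |τ.re| < 1 / 2}) ∧
    ((∃ φ, IsContinuationOf schwarzLocal₂ φ) ∧
      ∀ φ, IsContinuationOf schwarzLocal₂ φ →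
        φ '' upperHalf = {τ : ℂ | 0 < τ.im ∧ 0 < τ.re ∧ τ.re < 1 / 2 ∧ 1 < ‖τ‖} ∧
        φ '' upperHalf = interior {τ ∈ fundDomain | 0 ≤ τ.re} ∧
        Tendsto φ (𝓝[upperHalf] 0) atCusp ∧
        Tendsto φ (𝓝[upperHalf] 1) (𝓝 I) ∧
        Tendsto φ (Bornology.cobounded ℂ ⊓ 𝓟 upperHalf) (𝓝 (-omega ^ 2))) := by
  have c1 := isContinuationOf_triangleMap triangleParams_one triangleMap_eqOn_schwarzLocal₁
  have c2 := isContinuationOf_triangleMap triangleParams_two triangleMap_eqOn_schwarzLocal₂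
  have hsqrt : 0 < √3 / 2 := by positivity
  have himage : ∀ {ψ φ : ℂ → ℂ} (S : Set ℝ), EqOn φ ψ cutPlane → (∀ x ∈ S, x ≠ 0 ∧ x ≠ 1) →
      (fun x : ℝ => φ x) '' S = (fun x : ℝ => ψ x) '' S := fun S heq hS =>
    image_congr fun x hx => heq (ofReal_mem_cutPlane (hS x hx).1 (hS x hx).2)
  refine ⟨⟨⟨_, c1⟩, fun φ hφ => ?_⟩, ⟨_, c2⟩, fun φ hφ => ?_⟩
  · have heq := hφ.eqOn c1
    have hH := heq.mono upperHalf_subset_cutPlane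
    have hcongr : ∀ {l m : Filter ℂ}, 𝓟 upperHalf ≥ l → Tendsto (triangleMap (1 / 6) (1 / 2)) l m →
        Tendsto φ l m := fun hl ht =>
      ht.congr' ((hH.symm.eventuallyEq_of_mem (hl (mem_principal_self _))))
    have e1 : (1 / 6 + 1 / 2 : ℝ) = 2 / 3 := by norm_num
    have e2 : (1 / 2 - 1 / 6 : ℝ) = 1 / 3 := by norm_num
    have himg : φ '' upperHalf = cuspRegion (-(1 / 2)) (1 / 2) := by
      rw [hH.image_eq, triangleMap_image_upperHalf triangleParams_one, paramRegion_one]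
    refine ⟨himg, himg.trans interior_fundDomain.symm,
      hcongr inf_le_right (triangleMap_tendsto_cusp triangleParams_one),
      hcongr inf_le_right ?_, hcongr inf_le_right ?_, ?_, ?_, ?_⟩
    · simpa only [e1, rot_two_thirds] using triangleMap_tendsto_one triangleParams_one
    · simpa only [e2, rot_third] using triangleMap_tendsto_infty triangleParams_one
    · rw [himage _ heq fun x hx => ⟨hx.1.ne', hx.2.ne⟩, triangleMap_image_Ioo triangleParams_one,
        e1, cos_pi_mul_two_thirds, sin_pi_mul_two_thirds]
      ext τ
      exact ⟨fun h => ⟨hsqrt.trans h.2, h⟩, fun h => h.2⟩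
    · rw [himage (Iio 0) heq fun x hx => ⟨ne_of_lt hx, ne_of_lt (lt_trans hx one_pos)⟩,
        triangleMap_image_Iio triangleParams_one, e2, cos_pi_mul_third, sin_pi_mul_third]
      ext τ
      exact ⟨fun h => ⟨hsqrt.trans h.2, h⟩, fun h => h.2⟩
    · rw [himage (Ioi 1) heq fun x hx => ⟨ne_of_gt (lt_trans one_pos hx), ne_of_gt hx⟩,
        triangleMap_image_Ioi triangleParams_one, e1, e2, cos_pi_mul_third, cos_pi_mul_two_thirds]
      ext τ
      simp only [mem_ofPred_eq, abs_lt]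
  · have heq := hφ.eqOn c2
    have hH := heq.mono upperHalf_subset_cutPlane
    have hcongr : ∀ {l m : Filter ℂ}, 𝓟 upperHalf ≥ l → Tendsto (triangleMap (1 / 12) (5 / 12)) l m →
        Tendsto φ l m := fun hl ht =>
      ht.congr' ((hH.symm.eventuallyEq_of_mem (hl (mem_principal_self _))))
    have e1 : (1 / 12 + 5 / 12 : ℝ) = 1 / 2 := by norm_num
    have e2 : (5 / 12 - 1 / 12 : ℝ) = 1 / 3 := by norm_num
    have himg : φ '' upperHalf = cuspRegion 0 (1 / 2) := by
      rw [hH.image_eq, triangleMap_image_upperHalf triangleParams_two, paramRegion_two]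
    refine ⟨himg, himg.trans interior_right_half_fundDomain.symm,
      hcongr inf_le_right (triangleMap_tendsto_cusp triangleParams_two),
      hcongr inf_le_right ?_, hcongr inf_le_right ?_⟩
    · simpa only [e1, rot_half] using triangleMap_tendsto_one triangleParams_two
    · simpa only [e2, rot_third] using triangleMap_tendsto_infty triangleParams_two
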